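/- **Theorem.** There is a deterministic Turing machine, running in time polynomial in the length of its input, that solves the following problem. *Given* a deterministic and decomposable Boolean circuit $C$ over a finite set of features $X$, an entity $e : X \to \{0,1\}$ and a feature $x \in X$, *compute* the rational number $\mathsf{SHAP}(C, e, x)$ under the uniform distribution on entities, written as a fraction $p/q$ of two binary integers with $q > 0$. Here the notions are as follows. *SHAP-score.* Let $\mathsf{ent}(X)$ be the set of entities, that is, of functions $X \to \{0,1\}$, with the uniform distribution $P(E) = |E| / 2^{|X|}$. For $M : \mathsf{ent}(X) \to \{0,1\}$, $e \in \mathsf{ent}(X)$ and $S \subseteq X$, put $$\mathsf{cw}(e,S) = \{ e' \in \mathsf{ent}(X) : e'(y) = e(y) \text{ for all } y \in S\}, \qquad \phi(M,e,S) = \mathbb{E}\big[ M(e') \mid e' \in \mathsf{cw}(e,S) \big],$$ and for $x \in X$ $$\mathsf{SHAP}(M,e,x) = \sum_{S \subseteq X \setminus \{x\}} \frac{|S|!\,(|X|-|S|-1)!}{|X|!}\,\big( \phi(M,e,S\cup\{x\}) - \phi(M,e,S) \big).$$ *Circuits.* A Boolean circuit $C$ over $X$ is a finite directed acyclic graph whose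 nodes (gates) without incoming edges are labeled by a variable in $X$ or by a constant $0$ or $1$, whose other gates are labeled by $\wedge$, $\vee$ or $\neg$, where a $\neg$-gate has exactly one incoming edge and the fan-in of $\wedge$- and $\vee$-gates is unbounded, and in which exactly one gate, the output gate, has no outgoing edges. For a gate $g$, $C_g$ is the subcircuit of the gates from which there is a (possibly empty) path to $g$, $C_g(e)$ is the value of $g$ on the entity $e$, and $\mathsf{var}(g)$ is the set of variables that label a gate of $C_g$. The circuit $C$ represents the function that maps $e$ to the value $C(e)$ of its output gate, and $\mathsf{SHAP}(C,e,x)$ is the score of that function. The circuit is *deterministic* if for every $\vee$-gate and any two distinct input gates $g_1, g_2$ of it, no entity $e$ satisfies $C_{g_1}(e) = C_{g_2}(e) = 1$. It is *decomposable* if for every $\wedge$-gate and any two distinct input gates $g_1, g_2$ of it, $\mathsf{var}(g_1) \cap \mathsf{var}(g_2) = \emptyset$. *Encoding.* The input is written over a finite alphabet as the list of the values $e(y)$, $y \in X$, with $x$ marked, followed by the list of the gates of $C$ in any order, each with its label and its row of the adjacency matrix of $C$ (variables being given by indicator vectors); this has length polynomial in $|X|$ and the number of gates. -/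

import Mathlib

/-! ### Entities, the uniform distribution, and the SHAP-score -/

section Shap

variable {X : Type} [Fintype X] [DecidableEq X]

/-- The probability of an event under the uniform distribution on the entities `X → Bool`. -/
def uniformProb (E : Finset (X → Bool)) : ℚ :=
  (E.card : ℚ) / 2 ^ Fintype.card X

/-- The set `cw(e, S)` of entities that coincide with `e` on each feature of `S`. -/
def consistentWith (e : X → Bool) (S : Finset X) : Finset (X → Bool) :=
  Finset.univ.filter fun e' => ∀ x ∈ S, e' x = e x

/-- `φ(M, e, S)`: the conditional expectation `𝔼[M(e') | e' ∈ cw(e, S)]` of the classifier `M`,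
under the uniform distribution. The conditioning event contains `e`, so its probability is
positive. -/
def expectedValue (M : (X → Bool) → Bool) (e : X → Bool) (S : Finset X) : ℚ :=
  (∑ e' ∈ consistentWith e S, uniformProb {e'} * (if M e' then 1 else 0)) /
    uniformProb (consistentWith e S)

/-- The SHAP-score of the feature `x` on the entity `e` with respect to the classifier `M`. -/
def SHAP (M : (X → Bool) → Bool) (e : X → Bool) (x : X) : ℚ :=
  ∑ S ∈ (Finset.univ.erase x).powerset,
    ((S.card.factorial : ℚ) * ((Fintype.card X - S.card - 1).factorial : ℚ) /
        ((Fintype.card X).factorial : ℚ)) *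
      (expectedValue M e (insert x S) - expectedValue M e S)

end Shap

/-! ### Boolean circuits -/

/-- The labels of the gates of a Boolean circuit over the variables `X`. -/
inductive GateLabel (X : Type) : Type
  | var (x : X)
  | const (b : Bool)
  | and
  | or
  | not
  deriving DecidableEq

/-- Variable and constant gates, as opposed to logic gates. -/
def GateLabel.IsSource {X : Type} : GateLabel X → Prop
  | .var _ => True
  | .const _ => True
  | _ => False

/-- A Boolean circuit over `X`: a directed acyclic graph on the gates `0, …, size - 1` (numbered in
any order), where `inputs g` is the set of gates with an edge to `g`. The fan-in of `∧`- and
`∨`-gates is unbounded. -/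
structure BoolCircuit (X : Type) where
  size : ℕ
  label : Fin size → GateLabel X
  inputs : Fin size → Finset (Fin size)
  /-- The output gate. -/
  output : Fin size
  /-- There is no directed cycle. -/
  acyclic : ∀ g, ¬ Relation.TransGen (fun h h' => h ∈ inputs h') g g
  /-- The gates without incoming edges are the variable and constant gates. -/
  source_iff : ∀ g, inputs g = ∅ ↔ (label g).IsSource
  /-- A `¬`-gate has exactly one incoming edge. -/
  not_fanin : ∀ g, label g = GateLabel.not → (inputs g).card = 1
  /-- The output gate is the only gate without outgoing edges. -/
  sink_iff : ∀ g, (∀ h, g ∉ inputs h) ↔ g = output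

namespace BoolCircuit

/-- There is an edge from the gate `h` to the gate `g`. -/
def Wire {X : Type} (C : BoolCircuit X) (h g : Fin C.size) : Prop := h ∈ C.inputs g

theorem wire_wellFounded {X : Type} (C : BoolCircuit X) : WellFounded C.Wire := by
  have : IsTrans (Fin C.size) (Relation.TransGen C.Wire) := ⟨fun _ _ _ => Relation.TransGen.trans⟩
  have : Std.Irrefl (Relation.TransGen C.Wire) := ⟨C.acyclic⟩
  exact Subrelation.wf (fun h => Relation.TransGen.single h)
    (Finite.wellFounded_of_trans_of_irrefl (Relation.TransGen C.Wire))

open Classical in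
/-- The value `C_g(e)` of the gate `g` when the circuit is evaluated over the entity `e`. It only
depends on the subcircuit `C_g` of the gates from which there is a path to `g`. -/
noncomputable def eval {X : Type} (C : BoolCircuit X) (e : X → Bool) : Fin C.size → Bool :=
  C.wire_wellFounded.fix fun g val =>
    match C.label g with
    | .var x => e x
    | .const b => b
    | .and => decide (∀ h, ∀ hg : C.Wire h g, val h hg = true)
    | .or => decide (∃ h, ∃ hg : C.Wire h g, val h hg = true)
    | .not => decide (∃ h, ∃ hg : C.Wire h g, val h hg = false)

open Classical in
/-- The evaluation of a gate from the values of its input gates. -/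
theorem eval_eq {X : Type} (C : BoolCircuit X) (e : X → Bool) (g : Fin C.size) :
    C.eval e g =
      match C.label g with
      | .var x => e x
      | .const b => b
      | .and => decide (∀ h ∈ C.inputs g, C.eval e h = true)
      | .or => decide (∃ h ∈ C.inputs g, C.eval e h = true)
      | .not => decide (∃ h ∈ C.inputs g, C.eval e h = false) := by
  rw [eval, WellFounded.fix_eq]
  cases C.label g <;> simp only [Wire, exists_prop] <;> congr

/-- The Boolean classifier represented by the circuit: the value of the output gate. -/
noncomputable def classifier {X : Type} (C : BoolCircuit X) (e : X → Bool) : Bool :=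
  C.eval e C.output

/-- `var(g)`: the variables that label a gate from which there is a (possibly empty) path
to `g`. -/
def vars {X : Type} (C : BoolCircuit X) (g : Fin C.size) : Set X :=
  {x | ∃ h, Relation.ReflTransGen C.Wire h g ∧ C.label h = GateLabel.var x}

/-- Any two distinct input gates of an `∨`-gate are never both true. -/
def Deterministic {X : Type} (C : BoolCircuit X) : Prop :=
  ∀ g, C.label g = GateLabel.or → ∀ g₁ ∈ C.inputs g, ∀ g₂ ∈ C.inputs g, g₁ ≠ g₂ →
    ¬ ∃ e : X → Bool, C.eval e g₁ = true ∧ C.eval e g₂ = true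

/-- Any two distinct input gates of an `∧`-gate depend on disjoint sets of variables. -/
def Decomposable {X : Type} (C : BoolCircuit X) : Prop :=
  ∀ g, C.label g = GateLabel.and → ∀ g₁ ∈ C.inputs g, ∀ g₂ ∈ C.inputs g, g₁ ≠ g₂ →
    Disjoint (C.vars g₁) (C.vars g₂)

end BoolCircuit

/-! ### The computational problem and its encoding -/

/-- An input of the problem: a deterministic and decomposable Boolean circuit over a finite set of
features, an entity and a feature. The features are named `0, …, numFeatures - 1`. -/
structure ShapInput where
  numFeatures : ℕ
  circuit : BoolCircuit (Fin numFeatures)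
  deterministic : circuit.Deterministic
  decomposable : circuit.Decomposable
  entity : Fin numFeatures → Bool
  feature : Fin numFeatures

/-- The (finite) input alphabet. -/
inductive InputSymbol : Type
  | bit (b : Bool)
  | varGate
  | constGate (b : Bool)
  | andGate
  | orGate
  | notGate
  | endEntity
  deriving DecidableEq, Fintype

/-- The symbol for the kind of a gate. -/
def GateLabel.symbol {X : Type} : GateLabel X → InputSymbol
  | .var _ => .varGate
  | .const b => .constGate b
  | .and => .andGate
  | .or => .orGate
  | .not => .notGate

/-- A gate is written as its kind, a bit telling whether it is the output gate, the indicator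
vector of its variable (all zero if it is not a variable gate), and its row of the adjacency
matrix. -/
def BoolCircuit.encodeGate {n : ℕ} (C : BoolCircuit (Fin n)) (g : Fin C.size) : List InputSymbol :=
  (C.label g).symbol :: InputSymbol.bit (decide (g = C.output)) ::
    (List.ofFn (fun y : Fin n => InputSymbol.bit (decide (C.label g = GateLabel.var y))) ++
      List.ofFn (fun h : Fin C.size => InputSymbol.bit (decide (h ∈ C.inputs g))))

/-- An input is written as the bits of the entity, each followed by a mark for the given feature,
then the gates one after the other. With `n` features and `m` gates its length is
`2 * n + 1 + m * (2 + n + m)`, which is polynomially related to the length of any other usual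
encoding (such as adjacency lists with binary indices). -/
def ShapInput.encode (i : ShapInput) : List InputSymbol :=
  (List.ofFn fun y : Fin i.numFeatures =>
      [InputSymbol.bit (i.entity y), InputSymbol.bit (decide (y = i.feature))]).flatten ++
    InputSymbol.endEntity ::
      (List.ofFn fun g : Fin i.circuit.size => i.circuit.encodeGate g).flatten

/-- A fraction `p / q` is written as the sign of `p`, the binary digits of `|p|` (least significant
first), the separator `none`, and the binary digits of `q`. -/
def encodeFraction (r : ℤ × ℕ) : List (Option Bool) :=
  some (decide (r.1 < 0)) :: (r.1.natAbs.bits.map some ++ none :: r.2.bits.map some)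

/-! Let n be the number of features and V a formal variable. Give an entity a product weight: each
feature y ≠ x agrees with e with weight 1 - V and disagrees with weight V, while x is forced to
agree (c = true) or to disagree (c = false). Let P_c(V) be the total weight of the accepted
entities. Writing 1 - V = (1 - 2V) + V and expanding over the set S of features for which 1 - 2V is
chosen gives P_c(V) = ∑_S a_c(S) (1 - 2V)^|S| V^(n-1-|S|), where a_c(S) counts the accepted entities
that agree with e on S and agree, or disagree, on x (`weightedCount_agreementWeight`). Now φ(S ∪
{x}) - φ(S) = (a_true(S) - a_false(S)) / 2^(n-|S|) (`expectedValue_sub`), and the integral of (1 -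
2V)^s V^(n-1-s) over [0, 1/2] is s! (n-1-s)! / (n! 2^(n-s)) (`halfIntegral_beta`). Hence the
SHAP-score is the integral of P_true - P_false over [0, 1/2] (`SHAP_eq_halfIntegral`), and the sum
over subsets has disappeared.

Over any commutative ring the weighted model count of a deterministic and decomposable circuit is
computed gate by gate: products at ∧, sums at ∨, 1 minus the input at ¬. Instead of polynomials the
circuit is evaluated at the integer V = 2^L, where L is the input length. The coefficients of P_true
- P_false are at most 2^(2n+1) < 2^(L-1) in absolute value and the degree is below L, so they are
the balanced digits of the resulting integer in base 2^L; adding 2^(L-1) at every position makes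
them ordinary digits (`digit_eval`). The integral is then ∑ c_k / ((k+1) 2^(k+1)), accumulated as an
unreduced fraction (`weightedSum`).

Polynomial time holds by construction: a language whose only loop repeats its body L times is
compiled to a multi-stack machine. On top of it runs an abstract machine with exact integers, of
which only the residues modulo 2^(L^3) are stored. Since ring operations respect congruences,
overflow does no harm; only the final numerator and denominator must fit into a word
(`weightedSum_digit_lt`). The gates come in arbitrary order, so all of them are recomputed L times
from the previous values; a gate is correct as soon as its predecessors have been, whatever the
initial values were (`isOutputValue_modelCount`). -/

/-! ### A loop language for polynomial time

Programs act on finitely many stacks over a finite alphabet. The only loop construct repeats its body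
`L` times, where `L` is the length of the input, so every program runs in polynomial time. -/

namespace LoopProgram

open Function Turing StateTransition

/-- Programs on the stacks `K` over the alphabet `Γ`. -/
inductive Cmd (K Γ : Type) : Type
  | skip
  | push (k : K) (a : Γ)
  | pop (k : K) (f : Option Γ → Cmd K Γ)
  | seq (c d : Cmd K Γ)
  | loop (c : Cmd K Γ)

namespace Cmd

variable {K Γ : Type}

/-- The effect of a program on the stacks, where loops are repeated `L` times. -/
def run [DecidableEq K] (L : ℕ) : Cmd K Γ → (K → List Γ) → K → List Γ
  | skip, s => s
  | push k a, s => update s k (a :: s k)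
  | pop k f, s => (f (s k).head?).run L (update s k (s k).tail)
  | seq c d, s => d.run L (c.run L s)
  | loop c, s => (c.run L)^[L] s

/-- The nesting depth of the loops. -/
def depth [Fintype Γ] : Cmd K Γ → ℕ
  | skip => 0
  | push _ _ => 0
  | pop _ f => Finset.univ.sup fun o => (f o).depth
  | seq c d => max c.depth d.depth
  | loop c => c.depth + 1

/-- A bound for the number of steps, in terms of the number of repetitions of the loops. -/
noncomputable def time [Fintype Γ] : Cmd K Γ → Polynomial ℕ
  | skip => 1
  | push _ _ => 1
  | pop _ f => 1 + ∑ o, (f o).time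
  | seq c d => c.time + d.time
  | loop c => Polynomial.X * (1 + c.time) + 1 + (Polynomial.X + 1)

/-- The positions in a program, which serve as the labels of the machine that executes it. -/
inductive Pos : Cmd K Γ → Type
  | skip : Pos skip
  | push (k : K) (a : Γ) : Pos (push k a)
  | pop (k : K) (f : Option Γ → Cmd K Γ) : Pos (pop k f)
  | branch (k : K) {f : Option Γ → Cmd K Γ} (o : Option Γ) (p : Pos (f o)) : Pos (pop k f)
  | fst {c : Cmd K Γ} (d : Cmd K Γ) (p : Pos c) : Pos (seq c d)
  | snd (c : Cmd K Γ) {d : Cmd K Γ} (p : Pos d) : Pos (seq c d)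
  | down (c : Cmd K Γ) : Pos (loop c)
  | up (c : Cmd K Γ) : Pos (loop c)
  | body {c : Cmd K Γ} (p : Pos c) : Pos (loop c)

theorem finite_pos [Finite Γ] : ∀ c : Cmd K Γ, Finite c.Pos
  | skip => Finite.of_surjective (fun _ : Unit => Pos.skip) fun p => by
      cases p; exact ⟨(), rfl⟩
  | push k a => Finite.of_surjective (fun _ : Unit => Pos.push k a) fun p => by
      cases p; exact ⟨(), rfl⟩
  | pop k f =>
    have := fun o => (f o).finite_pos
    Finite.of_surjective
      (fun q : Option (Σ o, (f o).Pos) => q.elim (Pos.pop k f) fun p => Pos.branch k p.1 p.2)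
      fun p => by
        cases p with
        | pop => exact ⟨none, rfl⟩
        | branch _ o p => exact ⟨some ⟨o, p⟩, rfl⟩
  | seq c d =>
    have := c.finite_pos
    have := d.finite_pos
    Finite.of_surjective (Sum.elim (Pos.fst d) (Pos.snd c)) fun p => by
      cases p with
      | fst _ p => exact ⟨.inl p, rfl⟩
      | snd _ p => exact ⟨.inr p, rfl⟩
  | loop c =>
    have := c.finite_pos
    Finite.of_surjective
      (Sum.elim (fun b : Bool => cond b (Pos.down c) (Pos.up c)) Pos.body) fun p => by
      cases p with
      | down => exact ⟨.inl true, rfl⟩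
      | up => exact ⟨.inl false, rfl⟩
      | body p => exact ⟨.inr p, rfl⟩

/-- The initial position. -/
def entry : ∀ c : Cmd K Γ, c.Pos
  | skip => .skip
  | push k a => .push k a
  | pop k f => .pop k f
  | seq c d => .fst d c.entry
  | loop c => .down c

end Cmd

/-- The contents of the machine that executes a program: besides those of the program, an input and an
output stack, and for each depth a pair of stacks that holds the loop counter. -/
inductive Stk (K : Type) (D : ℕ) : Type
  | inp
  | out
  | reg (k : K)
  | yard (i : Fin (D + 1)) (b : Bool)
  deriving DecidableEq, Fintype

/-- The alphabets of the stacks of the machine. -/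
@[reducible] def Alph {K : Type} {D : ℕ} (Γ Δ : Type) : Stk K D → Type
  | .out => Δ
  | _ => Γ

/-! ### Simulation of a loop program by a multi-stack machine -/

section Machine

variable {K Γ Δ : Type} {D : ℕ}

/-- The contents of all stacks of the machine. -/
def contents (i : List Γ) (o : List Δ) (s : K → List Γ) (y : Fin (D + 1) → Bool → List Γ) :
    ∀ k : Stk K D, List (Alph Γ Δ k)
  | .inp => i
  | .out => o
  | .reg k => s k
  | .yard j b => y j b

section Update

variable [DecidableEq K] (i : List Γ) (o : List Δ) (s : K → List Γ)
  (y : Fin (D + 1) → Bool → List Γ)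

theorem update_contents_inp (l : List Γ) :
    update (contents i o s y) (.inp : Stk K D) l = contents l o s y := by
  funext k
  cases k <;> simp [contents]

theorem update_contents_out (l : List Δ) :
    update (contents i o s y) (.out : Stk K D) l = contents i l s y := by
  funext k
  cases k <;> simp [contents]

theorem update_contents_reg (k : K) (l : List Γ) :
    update (contents i o s y) (.reg k : Stk K D) l = contents i o (update s k l) y := by
  funext k'
  cases k' with
  | reg k' =>
    by_cases h : k' = k
    · subst h; simp [contents]
    · rw [update_of_ne (by simpa using h)]; simp [contents, h]
  | _ => simp [contents]

theorem update_contents_yard (j : Fin (D + 1)) (b : Bool) (l : List Γ) :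
    update (contents i o s y) (.yard j b : Stk K D) l =
      contents i o s (update y j (update (y j) b l)) := by
  funext k'
  cases k' with
  | yard j' b' =>
    by_cases h : j' = j
    · subst h
      by_cases h : b' = b
      · subst h; simp [contents]
      · rw [update_of_ne (by simpa using h)]; simp [contents, h]
    · rw [update_of_ne (by simp [h])]; simp [contents, h]
  | _ => simp [contents]

end Update

variable [Inhabited Γ]

/-- A loop counter after `b` of `a + b` repetitions. -/
def counter (a b : ℕ) (t : Bool) : List Γ :=
  List.replicate (if t then a else b) default

theorem update_counter_true (a b c : ℕ) :
    update (counter a b : Bool → List Γ) true (List.replicate c default) = counter c b := by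
  funext t; cases t <;> simp [counter]

theorem update_counter_false (a b c : ℕ) :
    update (counter a b : Bool → List Γ) false (List.replicate c default) = counter a c := by
  funext t; cases t <;> simp [counter]

open Turing.TM2.Stmt in
/-- The statement at a position of a program, where the positions are embedded in the labels by `emb`
and the program is left to the label `ex`. -/
def stmt [Fintype Γ] (Δ : Type) (D : ℕ) {Λ : Type} : ∀ c : Cmd K Γ, (c.Pos → Λ) → Λ → c.Pos →
    TM2.Stmt (Alph Γ Δ : Stk K D → Type) Λ (Option Γ)
  | .skip, _, ex, .skip => goto fun _ => ex
  | .push k a, _, ex, .push _ _ => push (.reg k) (fun _ => a) (goto fun _ => ex)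
  | .pop k f, emb, _, .pop _ _ =>
    pop (.reg k) (fun _ o => o) (goto fun v => emb (.branch k v (f v).entry))
  | .pop k f, emb, ex, .branch _ o p => stmt Δ D (f o) (fun q => emb (.branch k o q)) ex p
  | .seq c d, emb, _, .fst _ p => stmt Δ D c (fun q => emb (.fst d q)) (emb (.snd c d.entry)) p
  | .seq c d, emb, ex, .snd _ p => stmt Δ D d (fun q => emb (.snd c q)) ex p
  | .loop c, emb, _, .down _ =>
    pop (.yard (Fin.ofNat (D + 1) c.depth) true) (fun _ o => o)
      (branch Option.isSome
        (push (.yard (Fin.ofNat (D + 1) c.depth) false) (fun _ => (default : Γ))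
          (goto fun _ => emb (.body c.entry)))
        (goto fun _ => emb (.up c)))
  | .loop c, emb, ex, .up _ =>
    pop (.yard (Fin.ofNat (D + 1) c.depth) false) (fun _ o => o)
      (branch Option.isSome
        (push (.yard (Fin.ofNat (D + 1) c.depth) true) (fun _ => (default : Γ))
          (goto fun _ => emb (.up c)))
        (goto fun _ => ex))
  | .loop c, emb, _, .body p => stmt Δ D c (fun q => emb (.body q)) (emb (.down c)) p

/-- `b` is reached from `a` in at most `n` steps. -/
def ReachesIn {σ : Type} (f : σ → Option σ) (n : ℕ) (a b : σ) : Prop :=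
  ∃ k ≤ n, (flip bind f)^[k] (some a) = some b

theorem ReachesIn.refl {σ : Type} (f : σ → Option σ) (n : ℕ) (a : σ) : ReachesIn f n a a :=
  ⟨0, n.zero_le, rfl⟩

theorem ReachesIn.trans {σ : Type} {f : σ → Option σ} {m n : ℕ} {a b c : σ}
    (h : ReachesIn f m a b) (h' : ReachesIn f n b c) : ReachesIn f (m + n) a c := by
  obtain ⟨k, hk, e⟩ := h
  obtain ⟨k', hk', e'⟩ := h'
  exact ⟨k' + k, by omega, by rw [iterate_add_apply, e, e']⟩

theorem ReachesIn.single {σ : Type} {f : σ → Option σ} {a b : σ} (h : f a = some b) :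
    ReachesIn f 1 a b :=
  ⟨1, le_rfl, h⟩

theorem ReachesIn.head {σ : Type} {f : σ → Option σ} {n : ℕ} {a b c : σ}
    (h : f a = some b) (h' : ReachesIn f n b c) : ReachesIn f (1 + n) a c :=
  (ReachesIn.single h).trans h'

theorem ReachesIn.congr_right {σ : Type} {f : σ → Option σ} {n : ℕ} {a b c : σ}
    (h : ReachesIn f n a b) (e : b = c) : ReachesIn f n a c :=
  e ▸ h

theorem ReachesIn.mono {σ : Type} {f : σ → Option σ} {m n : ℕ} {a b : σ}
    (h : ReachesIn f m a b) (hmn : m ≤ n) : ReachesIn f n a b :=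
  let ⟨k, hk, e⟩ := h
  ⟨k, hk.trans hmn, e⟩

variable [Fintype Γ] [DecidableEq K] {Λ : Type}

section Counter

variable (M : Λ → TM2.Stmt (Alph Γ Δ : Stk K D → Type) Λ (Option Γ)) (c : Cmd K Γ)
  (emb : (Cmd.loop c).Pos → Λ) (ex : Λ) (i : List Γ) (o : List Δ) (s : K → List Γ)

theorem step_up_zero (hM : ∀ p, M (emb p) = stmt Δ D _ emb ex p) (v : Option Γ)
    (y : Fin (D + 1) → Bool → List Γ) (a : ℕ)
    (hy : y (Fin.ofNat (D + 1) c.depth) = counter a 0) :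
    TM2.step M ⟨some (emb (.up c)), v, contents i o s y⟩ =
      some ⟨some ex, none, contents i o s y⟩ := by
  rw [TM2.step, hM, stmt]
  generalize Fin.ofNat (D + 1) c.depth = j at *
  have h : contents i o s y (.yard j false : Stk K D) = [] := by simp [contents, hy, counter]
  have e : update (contents i o s y) (.yard j false : Stk K D) [] = contents i o s y := by
    rw [← h, update_eq_self]
  simp only [TM2.stepAux, h, List.head?_nil, List.tail_nil, e, Option.isSome_none, cond_false]

theorem step_up_succ (hM : ∀ p, M (emb p) = stmt Δ D _ emb ex p) (v : Option Γ)
    (y : Fin (D + 1) → Bool → List Γ) (a b : ℕ)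
    (hy : y (Fin.ofNat (D + 1) c.depth) = counter a (b + 1)) :
    TM2.step M ⟨some (emb (.up c)), v, contents i o s y⟩ =
      some ⟨some (emb (.up c)), some default,
        contents i o s (update y (Fin.ofNat (D + 1) c.depth) (counter (a + 1) b))⟩ := by
  rw [TM2.step, hM, stmt]
  generalize Fin.ofNat (D + 1) c.depth = j at *
  have h : contents i o s y (.yard j false : Stk K D) = default :: List.replicate b default := by
    simp [contents, hy, counter, List.replicate_succ]
  have h' : contents i o s (update y j (counter a b)) (.yard j true : Stk K D) =
      List.replicate a default := by simp [contents, counter]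
  simp only [TM2.stepAux, h, List.head?_cons, List.tail_cons, Option.isSome_some, cond_true,
    update_contents_yard]
  simp only [hy, update_counter_false, update_counter_true, h', ← List.replicate_succ, update_self,
    update_idem]

theorem step_down_zero (hM : ∀ p, M (emb p) = stmt Δ D _ emb ex p) (v : Option Γ)
    (y : Fin (D + 1) → Bool → List Γ) (b : ℕ)
    (hy : y (Fin.ofNat (D + 1) c.depth) = counter 0 b) :
    TM2.step M ⟨some (emb (.down c)), v, contents i o s y⟩ =
      some ⟨some (emb (.up c)), none, contents i o s y⟩ := by
  rw [TM2.step, hM, stmt]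
  generalize Fin.ofNat (D + 1) c.depth = j at *
  have h : contents i o s y (.yard j true : Stk K D) = [] := by simp [contents, hy, counter]
  have e : update (contents i o s y) (.yard j true : Stk K D) [] = contents i o s y := by
    rw [← h, update_eq_self]
  simp only [TM2.stepAux, h, List.head?_nil, List.tail_nil, e, Option.isSome_none, cond_false]

theorem step_down_succ (hM : ∀ p, M (emb p) = stmt Δ D _ emb ex p) (v : Option Γ)
    (y : Fin (D + 1) → Bool → List Γ) (a b : ℕ)
    (hy : y (Fin.ofNat (D + 1) c.depth) = counter (a + 1) b) :
    TM2.step M ⟨some (emb (.down c)), v, contents i o s y⟩ =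
      some ⟨some (emb (.body c.entry)), some default,
        contents i o s (update y (Fin.ofNat (D + 1) c.depth) (counter a (b + 1)))⟩ := by
  rw [TM2.step, hM, stmt]
  generalize Fin.ofNat (D + 1) c.depth = j at *
  have h : contents i o s y (.yard j true : Stk K D) = default :: List.replicate a default := by
    simp [contents, hy, counter, List.replicate_succ]
  have h' : contents i o s (update y j (counter a b)) (.yard j false : Stk K D) =
      List.replicate b default := by simp [contents, counter]
  simp only [TM2.stepAux, h, List.head?_cons, List.tail_cons, Option.isSome_some, cond_true,
    update_contents_yard]
  simp only [hy, update_counter_false, update_counter_true, h', ← List.replicate_succ, update_self,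
    update_idem]

/-- A finished loop has moved its counter from the `true` stack to the `false` stack. Moving it back
restores the full counter, so that the loop can be entered again from an enclosing loop. -/
theorem reachesIn_up (hM : ∀ p, M (emb p) = stmt Δ D _ emb ex p) (b : ℕ) :
    ∀ (a : ℕ) (v : Option Γ) (y : Fin (D + 1) → Bool → List Γ),
    y (Fin.ofNat (D + 1) c.depth) = counter a b →
    ∃ v', ReachesIn (TM2.step M) (b + 1) ⟨some (emb (.up c)), v, contents i o s y⟩
      ⟨some ex, v', contents i o s (update y (Fin.ofNat (D + 1) c.depth) (counter (a + b) 0))⟩ := by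
  induction b with
  | zero =>
    intro a v y hy
    refine ⟨none, .head (n := 0) (step_up_zero M c emb ex i o s hM v y a hy) ?_⟩
    rw [add_zero, ← hy, update_eq_self]
    exact .refl _ _ _
  | succ b ih =>
    intro a v y hy
    obtain ⟨v', h⟩ := ih (a + 1) (some default)
      (update y (Fin.ofNat (D + 1) c.depth) (counter (a + 1) b)) (update_self ..)
    refine ⟨v', (ReachesIn.head (step_up_succ M c emb ex i o s hM v y a b hy) ?_).mono
      (Nat.add_comm 1 (b + 1)).le⟩
    rwa [update_idem, add_assoc, add_comm 1 b] at h

end Counter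

/-- Induction on the program. The machine `M`, the embedding of positions and the exit label are
arbitrary, so that the statement applies to a subprogram inside the whole machine. Only the counters
below the depth of the program have to be full: while the body of a loop runs, the counter of the
loop itself is partly spent, but the body never touches it. -/
theorem reachesIn_run (L : ℕ) (i : List Γ) (o : List Δ) :
    ∀ (c : Cmd K Γ) (_ : c.depth ≤ D) {Λ : Type}
      (M : Λ → TM2.Stmt (Alph Γ Δ : Stk K D → Type) Λ (Option Γ)) (emb : c.Pos → Λ) (ex : Λ)
      (_ : ∀ p, M (emb p) = stmt Δ D _ emb ex p) (v : Option Γ) (s : K → List Γ)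
      (y : Fin (D + 1) → Bool → List Γ)
      (_ : ∀ j < c.depth, y (Fin.ofNat (D + 1) j) = counter L 0),
      ∃ v', ReachesIn (TM2.step M) (c.time.eval L) ⟨some (emb c.entry), v, contents i o s y⟩
        ⟨some ex, v', contents i o (c.run L s) y⟩
  | .skip, _, _, M, emb, ex, hM, v, s, y, _ => by
    refine ⟨v, (ReachesIn.single ?_).mono (by simp [Cmd.time])⟩
    rw [TM2.step, hM]
    rfl
  | .push k a, _, _, M, emb, ex, hM, v, s, y, _ => by
    refine ⟨v, (ReachesIn.single ?_).mono (by simp [Cmd.time])⟩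
    rw [TM2.step, hM, Cmd.entry, stmt]
    simp only [TM2.stepAux, update_contents_reg]
    rfl
  | .pop k f, hD, _, M, emb, ex, hM, v, s, y, hy => by
    have hle : ∀ o, (f o).depth ≤ (Cmd.pop k f).depth := fun o =>
      Finset.le_sup (f := fun o => (f o).depth) (Finset.mem_univ o)
    obtain ⟨v', h⟩ := reachesIn_run L i o (f (s k).head?) ((hle _).trans hD) M
      (fun q => emb (.branch k _ q)) ex (fun p => hM _) (s k).head? (update s k (s k).tail) y
      (fun j hj => hy j (hj.trans_le (hle _)))
    refine ⟨v', (ReachesIn.head ?_ h).mono ?_⟩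
    · rw [TM2.step, hM, Cmd.entry, stmt]
      simp only [TM2.stepAux, update_contents_reg]
      rfl
    · simp only [Cmd.time, Polynomial.eval_add, Polynomial.eval_one, Polynomial.eval_finsetSum]
      gcongr
      exact Finset.single_le_sum (f := fun o => (f o).time.eval L) (fun _ _ => Nat.zero_le _)
        (Finset.mem_univ (s k).head?)
  | .seq c d, hD, _, M, emb, ex, hM, v, s, y, hy => by
    obtain ⟨v', h⟩ := reachesIn_run L i o c ((le_max_left _ _).trans hD) M
      (fun q => emb (.fst d q)) (emb (.snd c d.entry)) (fun p => hM _) v s y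
      (fun j hj => hy j (hj.trans_le (le_max_left _ _)))
    obtain ⟨v'', h'⟩ := reachesIn_run L i o d ((le_max_right _ _).trans hD) M
      (fun q => emb (.snd c q)) ex (fun p => hM _) v' (c.run L s) y
      (fun j hj => hy j (hj.trans_le (le_max_right _ _)))
    exact ⟨v'', (h.trans h').mono (by simp [Cmd.time])⟩
  | .loop c, hD, _, M, emb, ex, hM, v, s, y, hy => by
    have hbody : ∀ (a b : ℕ) (v : Option Γ) (s : K → List Γ) (y : Fin (D + 1) → Bool → List Γ),
        (∀ j < c.depth, y (Fin.ofNat (D + 1) j) = counter L 0) →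
        y (Fin.ofNat (D + 1) c.depth) = counter a b →
        ∃ v', ReachesIn (TM2.step M) (a * (1 + c.time.eval L) + 1)
          ⟨some (emb (.down c)), v, contents i o s y⟩
          ⟨some (emb (.up c)), v', contents i o ((c.run L)^[a] s)
            (update y (Fin.ofNat (D + 1) c.depth) (counter 0 (a + b)))⟩ := by
      intro a
      induction a with
      | zero =>
        intro b v s y _ hy
        refine ⟨none, ?_⟩
        rw [zero_add, ← hy, update_eq_self, zero_mul, zero_add]
        exact .single (step_down_zero M c emb ex i o s hM v y b hy)
      | succ a ih =>
        intro b v s y hy' hy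
        -- Since the depths are at most `D`, `Fin.ofNat` does not identify the index of this loop
        -- with those used by its body.
        have hy'' : ∀ j < c.depth, update y (Fin.ofNat (D + 1) c.depth) (counter a (b + 1))
            (Fin.ofNat (D + 1) j) = counter L 0 := by
          intro j hj
          rw [update_of_ne, hy' j hj]
          intro h
          have h := congrArg Fin.val h
          simp only [Cmd.depth] at hD
          simp only [Fin.ofNat] at h
          rw [Nat.mod_eq_of_lt (by omega), Nat.mod_eq_of_lt (by omega)] at h
          omega
        obtain ⟨v', h⟩ := reachesIn_run L i o c ((Nat.le_succ _).trans hD) M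
          (fun q => emb (.body q)) (emb (.down c)) (fun p => hM _) (some default) s
          (update y (Fin.ofNat (D + 1) c.depth) (counter a (b + 1))) hy''
        obtain ⟨v'', h'⟩ := ih (b + 1) v' (c.run L s) _ hy'' (update_self ..)
        rw [update_idem, ← add_assoc, add_right_comm] at h'
        refine ⟨v'', (ReachesIn.head (step_down_succ M c emb ex i o s hM v y a b hy)
          (h.trans h')).mono ?_⟩
        rw [Nat.succ_mul]
        omega
    obtain ⟨v', h⟩ := hbody L 0 v s y (fun j hj => hy j (hj.trans (Nat.lt_succ_self _)))
      (hy _ (Nat.lt_succ_self _))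
    obtain ⟨v'', h'⟩ := reachesIn_up M c emb ex i o ((c.run L)^[L] s) hM L 0 v' _ (update_self _ _ y)
    refine ⟨v'', ?_⟩
    rw [update_idem, zero_add, ← hy _ (Nat.lt_succ_self _), update_eq_self] at h'
    refine (h.trans h').mono ?_
    simp [Cmd.time]

end Machine

end LoopProgram

/-! ### From loop programs to polynomial-time Turing machines -/

namespace LoopProgram

open Function Turing StateTransition

section Run

variable {K Γ : Type} [DecidableEq K] [Fintype Γ]

/-- A step pushes at most one symbol on a given stack, so the time bound also bounds the growth of
the stacks. This controls the cost of writing the output and of clearing. -/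
theorem length_run_le (L : ℕ) : ∀ (c : Cmd K Γ) (s : K → List Γ) (k : K),
    (c.run L s k).length ≤ (s k).length + c.time.eval L
  | .skip, s, k => Nat.le_add_right _ _
  | .push k' a, s, k => by
    by_cases h : k = k'
    · subst h; simp [Cmd.run, Cmd.time]
    · simp [Cmd.run, h]
  | .pop k' f, s, k => by
    refine (length_run_le L (f (s k').head?) _ k).trans (Nat.add_le_add ?_ ?_)
    · by_cases h : k = k'
      · subst h; simp
      · simp [h]
    · simp only [Cmd.time, Polynomial.eval_add, Polynomial.eval_finsetSum]
      exact Nat.le_add_left_of_le (Finset.single_le_sum (f := fun o => (f o).time.eval L)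
        (fun _ _ => Nat.zero_le _) (Finset.mem_univ (s k').head?))
  | .seq c d, s, k => by
    have h := length_run_le L c s k
    have h' := length_run_le L d (c.run L s) k
    simp only [Cmd.run, Cmd.time, Polynomial.eval_add]
    omega
  | .loop c, s, k => by
    have h : ∀ n, ((c.run L)^[n] s k).length ≤ (s k).length + n * c.time.eval L := by
      intro n
      induction n with
      | zero => simp
      | succ n ih =>
        rw [iterate_succ_apply', Nat.succ_mul]
        have := length_run_le L c ((c.run L)^[n] s) k
        omega
    refine (h L).trans ?_
    simp only [Cmd.time, Polynomial.eval_add, Polynomial.eval_mul, Polynomial.eval_X,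
      Polynomial.eval_one, Nat.mul_add]
    omega

end Run

section Executor

variable {K Γ Δ : Type} {D : ℕ} [Inhabited Γ]

/-- The labels for reading the input, writing the output and clearing the stacks. -/
inductive Ctl : Type
  | read
  | write
  | clear

instance : Finite Ctl :=
  Finite.of_surjective (fun b : Option Bool => b.elim Ctl.read fun b => cond b .write .clear)
    fun c => by
      cases c
      · exact ⟨none, rfl⟩
      · exact ⟨some true, rfl⟩
      · exact ⟨some false, rfl⟩

/-- Pops all stacks in a list, and keeps in mind whether there was a nonempty one. -/
def popAll {Λ : Type} (ks : List (Stk K D)) (q : TM2.Stmt (Alph Γ Δ : Stk K D → Type) Λ (Option Γ)) :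
    TM2.Stmt (Alph Γ Δ : Stk K D → Type) Λ (Option Γ) :=
  ks.foldr (fun k q => .pop k (fun v o => if o.isSome then some default else v) q) q

/-- Pushes a symbol on all stacks in a list of counters. -/
def pushAll {Λ : Type} (js : List (Fin (D + 1)))
    (q : TM2.Stmt (Alph Γ Δ : Stk K D → Type) Λ (Option Γ)) :
    TM2.Stmt (Alph Γ Δ : Stk K D → Type) Λ (Option Γ) :=
  js.foldr (fun j q => .push (.yard j true) (fun _ => (default : Γ)) q) q

variable [DecidableEq K]

theorem stepAux_popAll {Λ : Type} (q : TM2.Stmt (Alph Γ Δ : Stk K D → Type) Λ (Option Γ))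
    (ks : List (Stk K D)) (hks : ks.Nodup) : ∀ (v : Option Γ) (S : ∀ k, List (Alph Γ Δ k)),
    ∃ v', TM2.stepAux (popAll ks q) v S =
        TM2.stepAux q v' (fun k => if k ∈ ks then (S k).tail else S k) ∧
      (v' = none ↔ v = none ∧ ∀ k ∈ ks, S k = []) := by
  induction ks with
  | nil => intro v S; exact ⟨v, by simp [popAll]⟩
  | cons k ks ih =>
    intro v S
    obtain ⟨hk, hks⟩ := List.nodup_cons.1 hks
    obtain ⟨v', h, hv'⟩ := ih hks (if (S k).head?.isSome then some default else v)
      (update S k (S k).tail)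
    refine ⟨v', ?_, ?_⟩
    · rw [popAll, List.foldr_cons, TM2.stepAux, ← popAll, h]
      congr 1
      funext k'
      by_cases e : k' = k
      · subst e; simp [hk]
      · simp [e]
    · rw [hv', List.forall_mem_cons]
      have h : ∀ k' ∈ ks, update S k (S k).tail k' = S k' := fun k' hk' =>
        update_of_ne (by rintro rfl; exact hk hk') _ _
      rw [forall₂_congr fun k' hk' => by rw [h k' hk']]
      cases S k with
      | nil => simp
      | cons a l => simp

theorem stepAux_pushAll {Λ : Type} (q : TM2.Stmt (Alph Γ Δ : Stk K D → Type) Λ (Option Γ))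
    (i : List Γ) (o : List Δ) (s : K → List Γ) (js : List (Fin (D + 1))) (hjs : js.Nodup) :
    ∀ (v : Option Γ) (y : Fin (D + 1) → Bool → List Γ) (n : ℕ), (∀ j ∈ js, y j = counter n 0) →
    TM2.stepAux (pushAll js q) v (contents i o s y) = TM2.stepAux q v
      (contents i o s fun j => if j ∈ js then counter (n + 1) 0 else y j) := by
  induction js with
  | nil => intro v y n _; simp [pushAll]
  | cons j js ih =>
    intro v y n hy
    obtain ⟨hj, hjs⟩ := List.nodup_cons.1 hjs
    rw [pushAll, List.foldr_cons, TM2.stepAux, ← pushAll]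
    have h : contents i o s y (.yard j true : Stk K D) = List.replicate n default := by
      simp [contents, hy j (by simp), counter]
    simp only [h, ← List.replicate_succ, update_contents_yard]
    rw [hy j (by simp), update_counter_true, ih hjs _ _ n]
    · congr 2
      funext j'
      by_cases e : j' = j
      · subst e; simp [hj]
      · simp [e]
    · intro j' hj'
      rw [update_of_ne (by rintro rfl; exact hj hj'), hy j' (by simp [hj'])]

variable [Fintype K] [Fintype Γ]

/-- The program of the machine that moves its input to the stack `kin`, executes `c` and outputs the
stack `kout`, after a translation of the symbols. -/
noncomputable def executorStmt (c : Cmd K Γ) (kin kout : K) (tr : Γ → Δ) : Ctl ⊕ c.Pos →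
    TM2.Stmt (Alph Γ Δ : Stk K c.depth → Type) (Ctl ⊕ c.Pos) (Option Γ)
  | .inl .read =>
    .pop .inp (fun _ o => o)
      (.branch Option.isSome
        (.push (.reg kin) (fun v => v.getD default)
          (pushAll Finset.univ.toList (.goto fun _ => .inl .read)))
        (.goto fun _ => .inr c.entry))
  | .inl .write =>
    .pop (.reg kout) (fun _ o => o)
      (.branch Option.isSome
        (.push .out (fun v => tr (v.getD default)) (.goto fun _ => .inl .write))
        (.goto fun _ => .inl .clear))
  | .inl .clear =>
    .load (fun _ => none)
      (popAll (Finset.univ.erase .out).toList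
        (.branch Option.isSome (.goto fun _ => .inl .clear) .halt))
  | .inr p => stmt Δ c.depth c .inr (.inl .write) p

/-- The machine that moves its input to the stack `kin`, executes `c` and outputs the stack `kout`,
after a translation of the symbols. -/
noncomputable def executor (c : Cmd K Γ) (kin kout : K) (tr : Γ → Δ) : FinTM2 :=
  have := c.finite_pos
  { K := Stk K c.depth
    k₀ := .inp
    k₁ := .out
    Γ := Alph Γ Δ
    Λ := Ctl ⊕ c.Pos
    main := .inl .read
    ΛFin := Fintype.ofFinite _
    σ := Option Γ
    initialState := none
    Γk₀Fin := inferInstanceAs (Fintype Γ)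
    m := executorStmt c kin kout tr }

variable (c : Cmd K Γ) (kin kout : K) (tr : Γ → Δ)

/-- The loop counters are filled in the same pass that moves the input: each symbol read adds one to
every counter, so all of them end up at the input length. -/
theorem reachesIn_read (l : List Γ) : ∀ (v : Option Γ) (o : List Δ) (s : K → List Γ) (n : ℕ),
    ReachesIn (TM2.step (executorStmt c kin kout tr)) (l.length + 1)
      ⟨some (.inl .read), v, contents l o s fun _ => counter n 0⟩
      ⟨some (.inr c.entry), none, contents [] o (update s kin (l.reverse ++ s kin))
        fun _ => counter (n + l.length) 0⟩ := by
  induction l with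
  | nil =>
    intro v o s n
    refine .single ?_
    have h : contents [] o s (fun _ => counter n 0) (.inp : Stk K c.depth) = [] := rfl
    rw [TM2.step, executorStmt]
    simp only [TM2.stepAux, update_contents_inp, h, List.head?_nil, List.tail_nil,
      Option.isSome_none, cond_false]
    simp
  | cons a l ih =>
    intro v o s n
    have h : contents (a :: l) o s (fun _ => counter n 0) (.inp : Stk K c.depth) = a :: l := rfl
    have h' : contents l o s (fun _ => counter n 0) (.reg kin : Stk K c.depth) = s kin := rfl
    have e := ih (some a) o (update s kin (a :: s kin)) (n + 1)
    rw [update_idem, update_self] at e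
    refine (((ReachesIn.single ?_).trans e).mono (by simp; omega)).congr_right ?_
    · rw [TM2.step, executorStmt]
      simp only [TM2.stepAux, update_contents_inp, update_contents_reg, h, h', List.head?_cons,
        List.tail_cons, Option.isSome_some, cond_true, Option.getD_some]
      rw [stepAux_pushAll _ _ _ _ _ (Finset.nodup_toList _) _ _ n (fun _ _ => rfl)]
      simp
    · simp [add_assoc, add_comm 1]

theorem reachesIn_write (l : List Γ) : ∀ (v : Option Γ) (o : List Δ) (s : K → List Γ)
    (y : Fin (c.depth + 1) → Bool → List Γ), s kout = l →
    ReachesIn (TM2.step (executorStmt c kin kout tr)) (l.length + 1)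
      ⟨some (.inl .write), v, contents [] o s y⟩
      ⟨some (.inl .clear), none, contents [] (l.reverse.map tr ++ o) (update s kout []) y⟩ := by
  induction l with
  | nil =>
    intro v o s y hs
    refine .single ?_
    have h : contents [] o s y (.reg kout : Stk K c.depth) = [] := hs
    rw [TM2.step, executorStmt]
    simp only [TM2.stepAux, update_contents_reg, h, List.head?_nil, List.tail_nil,
      Option.isSome_none, cond_false]
    simp
  | cons a l ih =>
    intro v o s y hs
    have h : contents [] o s y (.reg kout : Stk K c.depth) = a :: l := hs
    have h' : contents [] o (update s kout l) y (.out : Stk K c.depth) = o := rfl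
    have e := ih (some a) (tr a :: o) (update s kout l) y (update_self ..)
    rw [update_idem] at e
    refine (((ReachesIn.single ?_).trans e).mono (by simp; omega)).congr_right ?_
    · rw [TM2.step, executorStmt]
      simp only [TM2.stepAux, update_contents_out, update_contents_reg, h, h', List.head?_cons,
        List.tail_cons, Option.isSome_some, cond_true, Option.getD_some]
    · simp

theorem step_clear (o : List Δ) (v : Option Γ) (s : K → List Γ)
    (y : Fin (c.depth + 1) → Bool → List Γ) :
    ∃ v', TM2.step (executorStmt c kin kout tr) ⟨some (.inl .clear), v, contents [] o s y⟩ =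
      some ⟨if v' = none then none else some (.inl .clear), v',
        contents [] o (fun k => (s k).tail) (fun j b => (y j b).tail)⟩ ∧
      (v' = none ↔ (∀ k, s k = []) ∧ ∀ j b, y j b = []) := by
  obtain ⟨v', h, hv'⟩ := stepAux_popAll (Γ := Γ) (Δ := Δ) (Λ := Ctl ⊕ c.Pos)
    (.branch Option.isSome (.goto fun _ => .inl .clear) .halt)
    ((Finset.univ : Finset (Stk K c.depth)).erase .out).toList (Finset.nodup_toList _) none
    (contents [] o s y)
  refine ⟨v', ?_, ?_⟩
  · rw [TM2.step, executorStmt, TM2.stepAux, h]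
    have e : (fun k => if k ∈ ((Finset.univ : Finset (Stk K c.depth)).erase .out).toList then
        (contents [] o s y k).tail else contents [] o s y k) =
        contents [] o (fun k => (s k).tail) (fun j b => (y j b).tail) := by
      funext k
      cases k <;> simp [contents]
    rw [e]
    cases v' <;> simp [TM2.stepAux]
  · rw [hv']
    constructor
    · rintro ⟨-, h⟩
      exact ⟨fun k => h (.reg k) (by simp), fun j b => h (.yard j b) (by simp)⟩
    · rintro ⟨h, h'⟩
      refine ⟨rfl, fun k hk => ?_⟩
      cases k with
      | inp => rfl
      | out => simp at hk
      | reg k => exact h k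
      | yard j b => exact h' j b

/-- The halting configuration required by `haltList` has an empty stack everywhere except for the
output. A round pops every stack once; the extra `+ 1` is the round that finds all of them empty and
halts. -/
theorem reachesIn_clear (o : List Δ) (n : ℕ) : ∀ (v : Option Γ) (s : K → List Γ)
    (y : Fin (c.depth + 1) → Bool → List Γ), (∀ k, (s k).length ≤ n) →
    (∀ j b, (y j b).length ≤ n) →
    ReachesIn (TM2.step (executorStmt c kin kout tr)) (n + 1)
      ⟨some (.inl .clear), v, contents [] o s y⟩
      ⟨none, none, contents [] o (fun _ => []) (fun _ _ => [])⟩ := by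
  induction n with
  | zero =>
    intro v s y hs hy
    obtain ⟨v', h, hv'⟩ := step_clear c kin kout tr o v s y
    simp only [Nat.le_zero, List.length_eq_zero_iff] at hs hy
    obtain rfl : v' = none := hv'.2 ⟨hs, hy⟩
    refine .single (h.trans ?_)
    simp [hs, hy]
  | succ n ih =>
    intro v s y hs hy
    obtain ⟨v', h, hv'⟩ := step_clear c kin kout tr o v s y
    by_cases e : v' = none
    · subst e
      obtain ⟨hs, hy⟩ := hv'.1 rfl
      refine (ReachesIn.single (h.trans ?_)).mono (by omega)
      simp [hs, hy]
    · rw [if_neg e] at h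
      refine (ReachesIn.head h (ih v' _ _ (fun k => ?_) (fun j b => ?_))).mono (by omega)
      · simpa using hs k
      · simpa using hy j b

/-- A function is computable in polynomial time if a program computes it, where the program starts
with the reversed input on the stack `kin` and ends with the reversed output on the stack `kout`. -/
theorem nonempty_tm2ComputableInPolyTime {α β : Type} {ea : α → List Γ} {eb : β → List Δ}
    {f : α → β} (h : ∀ a, ((c.run (ea a).length (update (fun _ => []) kin (ea a).reverse)
      kout).reverse.map tr) = eb (f a)) :
    Nonempty (TM2ComputableInPolyTime ea eb f) := by
  refine ⟨{
    tm := executor c kin kout tr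
    inputAlphabet := Equiv.refl _
    outputAlphabet := Equiv.refl _
    time := (Polynomial.X + 1) + (c.time + ((Polynomial.X + c.time + 1) +
      (Polynomial.X + c.time + 1)))
    outputsFun := fun a => ?_ }⟩
  have key : ReachesIn (TM2.step (executorStmt c kin kout tr))
      (((Polynomial.X + 1) + (c.time + ((Polynomial.X + c.time + 1) +
        (Polynomial.X + c.time + 1))) : Polynomial ℕ).eval (ea a).length)
      ⟨some (.inl .read), none, contents (ea a) [] (fun _ => []) fun _ => counter 0 0⟩
      ⟨none, none, contents [] (eb (f a)) (fun _ => []) (fun _ _ => [])⟩ := by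
    have h₁ := reachesIn_read c kin kout tr (ea a) none [] (fun _ => []) 0
    rw [List.append_nil, zero_add] at h₁
    obtain ⟨v, h₂⟩ := reachesIn_run (D := c.depth) (ea a).length [] [] c le_rfl
      (executorStmt c kin kout tr) .inr (.inl .write) (fun _ => rfl) none
      (update (fun _ => []) kin (ea a).reverse) (fun _ => counter (ea a).length 0) (fun _ _ => rfl)
    have hlen : ∀ k, (c.run (ea a).length (update (fun _ => []) kin (ea a).reverse) k).length ≤
        (ea a).length + c.time.eval (ea a).length := by
      intro k
      refine (length_run_le _ _ _ _).trans (Nat.add_le_add_right ?_ _)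
      by_cases e : k = kin
      · subst e; simp
      · simp [e]
    have h₃ := (reachesIn_write c kin kout tr _ v []
      (c.run (ea a).length (update (fun _ => []) kin (ea a).reverse))
      (fun _ => counter (ea a).length 0) rfl).mono (Nat.add_le_add_right (hlen kout) 1)
    rw [List.append_nil, List.map_reverse, ← List.map_reverse, h] at h₃
    have h₄ := reachesIn_clear c kin kout tr (eb (f a))
      ((ea a).length + c.time.eval (ea a).length) none
      (update (c.run (ea a).length (update (fun _ => []) kin (ea a).reverse)) kout [])
      (fun _ => counter (ea a).length 0)
      (fun k => by
        by_cases e : k = kout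
        · subst e; simp
        · simpa [e] using hlen k)
      (fun j b => by cases b <;> simp [counter])
    simpa using h₁.trans (h₂.trans (h₃.trans h₄))
  have hinit : initList (executor c kin kout tr) (ea a) =
      (⟨some (.inl .read), none, contents (ea a) [] (fun _ => []) fun _ => counter 0 0⟩ :
        TM2.Cfg (Alph Γ Δ : Stk K c.depth → Type) (Ctl ⊕ c.Pos) (Option Γ)) := by
    refine congrArg (TM2.Cfg.mk _ _) (funext fun k => ?_)
    cases k with
    | yard j b => cases b <;> rfl
    | _ => rfl
  have hhalt : haltList (executor c kin kout tr) (eb (f a)) =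
      (⟨none, none, contents [] (eb (f a)) (fun _ => []) (fun _ _ => [])⟩ :
        TM2.Cfg (Alph Γ Δ : Stk K c.depth → Type) (Ctl ⊕ c.Pos) (Option Γ)) := by
    refine congrArg (TM2.Cfg.mk _ _) (funext fun k => ?_)
    cases k <;> rfl
  rw [← hinit, ← hhalt] at key
  -- The required statement speaks of words translated along the alphabets, which is here a
  -- `List.map` of the identity; generalizing the words lets `List.map_id` remove it at the end.
  have out : ∀ (l : List Γ) (l' : List Δ), l = ea a → l' = eb (f a) →
      TM2OutputsInTime (executor c kin kout tr) l (some l')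
        (((Polynomial.X + 1) + (c.time + ((Polynomial.X + c.time + 1) +
          (Polynomial.X + c.time + 1))) : Polynomial ℕ).eval (ea a).length) := by
    rintro _ _ rfl rfl
    exact ⟨⟨key.choose, key.choose_spec.2⟩, key.choose_spec.1⟩
  exact out _ _ (List.map_id _) (List.map_id _)

end Executor

end LoopProgram

namespace LoopProgram

open Function

/-! ### Words

The lowest bits of integers in two's complement, and programs for their arithmetic. -/

/-- The `n` lowest binary digits of an integer, least significant first. -/
def bits : ℕ → ℤ → List Bool
  | 0, _ => []
  | n + 1, z => decide (z % 2 = 1) :: bits n (z / 2)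

@[simp]
theorem length_bits (n : ℕ) (z : ℤ) : (bits n z).length = n := by
  induction n generalizing z with
  | zero => rfl
  | succ n ih => simp [bits, ih]

theorem bits_zero (n : ℕ) : bits n 0 = List.replicate n false := by
  induction n with
  | zero => rfl
  | succ n ih => simp [bits, ih, List.replicate_succ]

theorem bits_neg_one (n : ℕ) : bits n (-1) = List.replicate n true := by
  induction n with
  | zero => rfl
  | succ n ih => simp [bits, ih, List.replicate_succ]

/-- This is why truncation is harmless: the stored word depends only on the residue, and arithmetic
on residues follows arithmetic on integers. -/
theorem bits_congr (n : ℕ) : ∀ {z z' : ℤ}, z ≡ z' [ZMOD 2 ^ n] → bits n z = bits n z' := by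
  induction n with
  | zero => intros; rfl
  | succ n ih =>
    intro z z' h
    obtain ⟨c, hc⟩ := h.dvd
    rw [pow_succ, mul_right_comm, mul_comm] at hc
    obtain rfl : z' = z + 2 * (2 ^ n * c) := by linarith
    rw [bits, bits, Int.add_mul_emod_self_left, Int.add_mul_ediv_left _ _ two_ne_zero, ih]
    exact (Int.modEq_iff_dvd.2 ⟨c, by ring⟩)

/-- The number with given binary digits, least significant first. -/
def ofBits : List Bool → ℤ
  | [] => 0
  | b :: l => (if b then 1 else 0) + 2 * ofBits l

theorem ofBits_bits (n : ℕ) (z : ℤ) : ofBits (bits n z) = z % 2 ^ n := by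
  induction n generalizing z with
  | zero => simp [bits, ofBits]
  | succ n ih =>
    have e : z % 2 ^ (n + 1) = z % 2 + 2 * (z / 2 % 2 ^ n) := by
      rw [pow_succ', Int.emod_def, Int.emod_def (z / 2), ← Int.ediv_ediv_of_nonneg (by norm_num)]
      have := Int.emod_add_mul_ediv z 2
      linarith
    rw [bits, ofBits, ih, e]
    rcases Int.emod_two_eq_zero_or_one z with h | h <;> simp [h]

theorem bits_add (m n : ℕ) (z : ℤ) : bits (m + n) z = bits m z ++ bits n (z / 2 ^ m) := by
  induction m generalizing z with
  | zero => simp [bits]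
  | succ m ih =>
    rw [Nat.succ_add, bits, bits, ih, List.cons_append, pow_succ',
      Int.ediv_ediv_of_nonneg (by norm_num)]

/-- The state of the abstract machine: stacks of integers and stacks of symbols. -/
@[ext]
structure St (W S : Type) where
  word : W → List ℤ
  sym : S → List InputSymbol

/-- The stacks on which the state of the abstract machine is stored. -/
inductive Store (W S : Type) : Type
  | word (r : W)
  | sym (q : S)
  | tmp
  | carry
  deriving DecidableEq, Fintype

instance : Inhabited InputSymbol := ⟨.endEntity⟩

variable {W S : Type}

/-- A stack of integers is stored as the `L ^ 3` lowest digits of each entry. -/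
def encWords (L : ℕ) (l : List ℤ) : List InputSymbol :=
  l.flatMap fun z => (bits (L ^ 3) z).map .bit

/-- The stored state of the abstract machine. -/
def enc (L : ℕ) (σ : St W S) : Store W S → List InputSymbol
  | .word r => encWords L (σ.word r)
  | .sym q => σ.sym q
  | .tmp => []
  | .carry => []

/-- Padding by zero digits makes an empty stack read as the number 0, in accordance with the default
in `headD`. -/
theorem takeD_encWords (L : ℕ) (l : List ℤ) :
    (encWords L l).takeD (L ^ 3) (.bit false) = (bits (L ^ 3) (l.headD 0)).map .bit := by
  cases l with
  | nil => simp [encWords, bits_zero]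
  | cons z l =>
    have := List.takeD_left' (l₁ := (bits (L ^ 3) z).map InputSymbol.bit) (l₂ := encWords L l)
      (n := L ^ 3) (a := .bit false) (by simp)
    simpa [encWords] using this

theorem drop_encWords (L : ℕ) (l : List ℤ) :
    (encWords L l).drop (L ^ 3) = encWords L l.tail := by
  cases l with
  | nil => simp [encWords]
  | cons z l => simp [encWords]

namespace St

variable [DecidableEq W] [DecidableEq S]

def setWord (r : W) (l : List ℤ) (σ : St W S) : St W S := { σ with word := update σ.word r l }

def setSym (q : S) (l : List InputSymbol) (σ : St W S) : St W S := { σ with sym := update σ.sym q l }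

@[simp] theorem word_setWord (r : W) (l : List ℤ) (σ : St W S) :
    (σ.setWord r l).word = update σ.word r l := rfl

@[simp] theorem sym_setWord (r : W) (l : List ℤ) (σ : St W S) : (σ.setWord r l).sym = σ.sym := rfl

@[simp] theorem word_setSym (q : S) (l : List InputSymbol) (σ : St W S) :
    (σ.setSym q l).word = σ.word := rfl

@[simp] theorem sym_setSym (q : S) (l : List InputSymbol) (σ : St W S) :
    (σ.setSym q l).sym = update σ.sym q l := rfl

theorem enc_setWord (L : ℕ) (r : W) (l : List ℤ) (σ : St W S) :
    enc L (σ.setWord r l) = update (enc L σ) (.word r) (encWords L l) := by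
  funext k
  cases k with
  | word r' =>
    by_cases h : r' = r
    · subst h; simp [enc]
    · simp [enc, h]
  | _ => simp [enc]

theorem enc_setSym (L : ℕ) (q : S) (l : List InputSymbol) (σ : St W S) :
    enc L (σ.setSym q l) = update (enc L σ) (.sym q) l := by
  funext k
  cases k with
  | sym q' =>
    by_cases h : q' = q
    · subst h; simp [enc]
    · simp [enc, h]
  | _ => simp [enc]

/-- Drops the top entry of a stack of integers. -/
def drop (r : W) (σ : St W S) : St W S := σ.setWord r (σ.word r).tail

/-- Pushes an integer. -/
def push (r : W) (z : ℤ) (σ : St W S) : St W S := σ.setWord r (z :: σ.word r)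

/-- The top entry of a stack of integers, or zero. -/
def top (r : W) (σ : St W S) : ℤ := (σ.word r).headD 0

/-- Moves the top entry of `r` to `r'`. -/
def move (r r' : W) (σ : St W S) : St W S := (σ.drop r).push r' (σ.top r)

/-- Copies the top entry of `r` to `r'`. -/
def copy (r r' : W) (σ : St W S) : St W S := ((σ.drop r).push r (σ.top r)).push r' (σ.top r)

/-- Adds the top entry of `r'`, which is removed, to that of `r`. -/
def add (r r' : W) (σ : St W S) : St W S := ((σ.drop r).drop r').push r (σ.top r + σ.top r')

/-- Subtracts the top entry of `r'`, which is removed, from that of `r`. -/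
def sub (r r' : W) (σ : St W S) : St W S := ((σ.drop r).drop r').push r (σ.top r - σ.top r')

/-- Multiplies the top entry of `r` by the top entry of `r'`, which is removed. -/
def mul (r r' : W) (σ : St W S) : St W S := ((σ.drop r).drop r').push r (σ.top r * σ.top r')

/-- Moves the digits of the top entry of `r` to `q`. -/
def toBits (L : ℕ) (r : W) (q : S) (σ : St W S) : St W S :=
  (σ.drop r).setSym q ((bits (L ^ 3) (σ.top r)).map .bit ++ σ.sym q)

end St

/-! ### Digitwise primitives: moving, copying, adding -/

section Primitive

variable {K : Type} [DecidableEq K]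

/-- Three nested loops. -/
def Cmd.cube {Γ : Type} (c : Cmd K Γ) : Cmd K Γ := .loop (.loop (.loop c))

theorem Cmd.run_cube {Γ : Type} (L : ℕ) (c : Cmd K Γ) : c.cube.run L = (c.run L)^[L ^ 3] := by
  have : L ^ 3 = L * L * L := by ring
  rw [this, iterate_mul, iterate_mul]
  rfl

/-- Moves a bit. -/
def shift (k k' : K) : Cmd K InputSymbol := .pop k fun o => .push k' (o.getD (.bit false))

/-- Digits arrive in reverse order, so a word is moved by shifting it twice, by way of `tmp`. -/
theorem run_shift (L : ℕ) (k k' : K) (hk : k ≠ k') (n : ℕ) (s : K → List InputSymbol) :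
    ((shift k k').run L)^[n] s = update (update s k ((s k).drop n)) k'
      (((s k).takeD n (.bit false)).reverse ++ s k') := by
  induction n generalizing s with
  | zero => simp
  | succ n ih =>
    rw [iterate_succ_apply, ih]
    funext x
    by_cases h : x = k'
    · subst h; simp [shift, Cmd.run, hk, hk.symm]
    · by_cases h' : x = k
      · subst h'; simp [shift, Cmd.run, h]
      · simp [shift, Cmd.run, h, h']

/-- Moves a bit to two stacks. -/
def shift₂ (k k' k'' : K) : Cmd K InputSymbol :=
  .pop k fun o => .seq (.push k' (o.getD (.bit false))) (.push k'' (o.getD (.bit false)))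

theorem run_shift₂ (L : ℕ) (k k' k'' : K) (hk : k ≠ k') (hk' : k ≠ k'') (n : ℕ)
    (hk'' : k' ≠ k'') (s : K → List InputSymbol) :
    ((shift₂ k k' k'').run L)^[n] s = update (update (update s k ((s k).drop n)) k'
      (((s k).takeD n (.bit false)).reverse ++ s k')) k''
      (((s k).takeD n (.bit false)).reverse ++ s k'') := by
  induction n generalizing s with
  | zero => simp
  | succ n ih =>
    rw [iterate_succ_apply, ih]
    funext x
    by_cases h : x = k'
    · subst h; simp [shift₂, Cmd.run, hk, hk', hk'', hk.symm]
    · by_cases h' : x = k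
      · subst h'; simp [shift₂, Cmd.run, hk, hk']
      · by_cases h'' : x = k''
        · subst h''; simp [shift₂, Cmd.run, h, h', hk, hk']
        · simp [shift₂, Cmd.run, h, h', h'']

/-- The bit that a symbol stands for. -/
def toBool (o : Option InputSymbol) : Bool := decide (o = some (.bit true))

/-- One step of the addition (or subtraction, if `f` is true). -/
def addStep (f : Bool) (k k' out carry : K) : Cmd K InputSymbol :=
  .pop carry fun c => .pop k fun a => .pop k' fun b =>
    .seq (.push out (.bit (toBool a ^^ (toBool b ^^ f) ^^ toBool c)))
      (.push carry (.bit (bif toBool c then toBool a || (toBool b ^^ f)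
        else toBool a && (toBool b ^^ f))))

/-- Complementing the digits of y turns it into -1 - y, so the same ripple-carry adder subtracts
when the digits are flipped and the initial carry is 1. -/
theorem run_addStep (L : ℕ) (f : Bool) (k k' out carry : K) (h₁ : k ≠ k') (h₂ : k ≠ out)
    (h₃ : k ≠ carry) (h₄ : k' ≠ out) (h₅ : k' ≠ carry) (h₆ : out ≠ carry) (n : ℕ) :
    ∀ (s : K → List InputSymbol) (x y : ℤ) (c : Bool), s carry = [.bit c] →
    (s k).takeD n (.bit false) = (bits n x).map .bit →
    (s k').takeD n (.bit false) = (bits n y).map .bit →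
    ∃ c', ((addStep f k k' out carry).run L)^[n] s =
      update (update (update (update s k ((s k).drop n)) k' ((s k').drop n)) carry [.bit c']) out
        (((bits n (x + (if f then -1 - y else y) + if c then 1 else 0)).map .bit).reverse ++
          s out) := by
  induction n with
  | zero =>
    intro s x y c hc _ _
    refine ⟨c, ?_⟩
    simp [← hc, bits]
  | succ n ih =>
    intro s x y c hc hx hy
    rw [List.takeD_succ, bits, List.map_cons, List.cons.injEq] at hx hy
    have ha : toBool (s k).head? = decide (x % 2 = 1) := by
      cases h : (s k).head? <;> simp_all [toBool]
    have hb : toBool (s k').head? = decide (y % 2 = 1) := by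
      cases h : (s k').head? <;> simp_all [toBool]
    set d := bif c then decide (x % 2 = 1) || (decide (y % 2 = 1) ^^ f)
      else decide (x % 2 = 1) && (decide (y % 2 = 1) ^^ f) with hd
    set e := decide (x % 2 = 1) ^^ (decide (y % 2 = 1) ^^ f) ^^ c with he
    have hstep : (addStep f k k' out carry).run L s =
        update (update (update (update s k (s k).tail) k' (s k').tail) carry [.bit d]) out
          (.bit e :: s out) := by
      simp only [addStep, Cmd.run, update_of_ne h₃, update_of_ne h₅, update_of_ne h₁.symm,
        ha, hb, hc, List.head?_cons, List.tail_cons]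
      have : toBool (some (.bit c)) = c := by cases c <;> rfl
      rw [this, ← hd, ← he]
      funext z
      by_cases e₁ : z = carry
      · subst e₁; simp [h₃.symm, h₅.symm, h₆.symm]
      by_cases e₂ : z = out
      · subst e₂; simp [h₂.symm, h₄.symm, h₆]
      by_cases e₃ : z = k'
      · subst e₃; simp [e₁, e₂]
      by_cases e₄ : z = k
      · subst e₄; simp [e₁, e₂, e₃]
      simp [e₁, e₂, e₃, e₄]
    obtain ⟨c', h⟩ := ih ((addStep f k k' out carry).run L s) (x / 2) (y / 2) d
      (by rw [hstep]; simp [h₆.symm]) (by rw [hstep]; simpa [h₁, h₂, h₃] using hx.2)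
      (by rw [hstep]; simpa [h₄, h₅] using hy.2)
    refine ⟨c', (iterate_succ_apply _ _ _).trans (h.trans ?_)⟩
    -- One column of the addition: the lowest digit of the sum is the exclusive or of both digits
    -- and the carry, and halving the sum leaves the sum of the halves plus the majority of the
    -- three.
    have key : bits (n + 1) (x + (if f then -1 - y else y) + if c then 1 else 0) =
        e :: bits n (x / 2 + (if f then -1 - y / 2 else y / 2) + if d then 1 else 0) := by
      rw [bits, List.cons.injEq, he, hd]
      rcases Int.emod_two_eq_zero_or_one x with hx | hx <;>
      rcases Int.emod_two_eq_zero_or_one y with hy | hy <;>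
      cases c <;> cases f <;> simp [hx, hy] <;>
      first
        | omega
        | exact ⟨by omega, congrArg _ (by omega)⟩
    rw [key, hstep]
    funext z
    by_cases e₂ : z = out
    · subst e₂; simp
    by_cases e₁ : z = carry
    · subst e₁; simp [e₂]
    by_cases e₃ : z = k'
    · subst e₃; simp [e₁, e₂]
    by_cases e₄ : z = k
    · subst e₄; simp [e₁, e₂, e₃]
    simp [e₁, e₂, e₃, e₄]

end Primitive

end LoopProgram

/-! ### Operations on integer stacks that are realized by programs -/

namespace LoopProgram

open Function

section Realizable

variable {W S : Type} [DecidableEq W] [DecidableEq S]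

/-- A family of functions on the states of the abstract machine that is computed by a program. -/
def Realizable (F : ℕ → St W S → St W S) : Prop :=
  ∃ c : Cmd (Store W S) InputSymbol, ∀ L, 0 < L → ∀ σ, c.run L (enc L σ) = enc L (F L σ)

namespace Realizable

variable {F G : ℕ → St W S → St W S}

theorem id : Realizable (fun _ (σ : St W S) => σ) := ⟨.skip, fun _ _ _ => rfl⟩

theorem comp (hG : Realizable G) (hF : Realizable F) : Realizable fun L σ => G L (F L σ) := by
  obtain ⟨c, hc⟩ := hF
  obtain ⟨d, hd⟩ := hG
  exact ⟨.seq c d, fun L hL σ => by rw [Cmd.run, hc L hL, hd L hL]⟩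

/-- Only the stored digits have to coincide. Integer entries may therefore be changed by multiples
of 2^(L^3), which multiplication needs. -/
theorem congr (hF : Realizable F) (h : ∀ L σ, enc L (F L σ) = enc L (G L σ)) : Realizable G := by
  obtain ⟨c, hc⟩ := hF
  exact ⟨c, fun L hL σ => (hc L hL σ).trans (h L σ)⟩

theorem loop (hF : Realizable F) : Realizable fun L => (F L)^[L] := by
  obtain ⟨c, hc⟩ := hF
  refine ⟨.loop c, fun L hL σ => ?_⟩
  exact ((Semiconj.iterate_right (f := enc L) (ga := F L) (gb := c.run L)
    (fun σ => (hc L hL σ).symm) L) σ).symm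

theorem cube (hF : Realizable F) : Realizable fun L => (F L)^[L ^ 3] := by
  have h := hF.loop.loop.loop
  refine h.congr fun L σ => ?_
  rw [← iterate_mul, ← iterate_mul, pow_three]

theorem popSym (q : S) {F : Option InputSymbol → ℕ → St W S → St W S}
    (hF : ∀ o, Realizable (F o)) :
    Realizable fun L σ => F (σ.sym q).head? L (σ.setSym q (σ.sym q).tail) := by
  choose c hc using hF
  refine ⟨.pop (.sym q) c, fun L hL σ => ?_⟩
  rw [← hc _ L hL, St.enc_setSym]
  rfl

theorem pushSym (q : S) (a : InputSymbol) :
    Realizable fun _ (σ : St W S) => σ.setSym q (a :: σ.sym q) :=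
  ⟨.push (.sym q) a, fun L _ σ => by rw [St.enc_setSym]; rfl⟩

/-- Each entry occupies L^3 cells, which is positive for L > 0, so the first symbol reveals whether
the stack of integers is empty; a symbol popped for the test is pushed back. -/
theorem ite (r : W) (hF : Realizable F) (hG : Realizable G) :
    Realizable fun L σ => if σ.word r = [] then F L σ else G L σ := by
  obtain ⟨c, hc⟩ := hF
  obtain ⟨d, hd⟩ := hG
  refine ⟨.pop (.word r) fun o => o.elim c fun a => .seq (.push (.word r) a) d,
    fun L hL σ => ?_⟩
  beta_reduce
  have e : enc L σ (.word r) = encWords L (σ.word r) := rfl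
  cases h : σ.word r with
  | nil =>
    have e' : encWords L ([] : List ℤ) = [] := rfl
    rw [h, e'] at e
    rw [if_pos rfl, ← hc L hL, Cmd.run, e, List.head?_nil, List.tail_nil, ← e, update_eq_self]
    rfl
  | cons z l =>
    obtain ⟨n, hn⟩ : ∃ n, L ^ 3 = n + 1 := Nat.exists_eq_succ_of_ne_zero (by positivity)
    have e' : encWords L (z :: l) =
        .bit (decide (z % 2 = 1)) :: ((bits n (z / 2)).map .bit ++ encWords L l) := by
      simp [encWords, hn, bits]
    rw [h, e'] at e
    rw [if_neg (by simp), ← hd L hL, Cmd.run, e]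
    simp only [List.head?_cons, List.tail_cons, Option.elim_some, Cmd.run, update_self, update_idem]
    rw [← e, update_eq_self]

theorem drop (r : W) : Realizable fun _ (σ : St W S) => σ.drop r := by
  refine ⟨.cube (.pop (.word r) fun _ => .skip), fun L _ σ => ?_⟩
  beta_reduce
  rw [St.drop, St.enc_setWord, Cmd.run_cube, ← drop_encWords]
  have h : ∀ (n : ℕ) (s : Store W S → List InputSymbol),
      ((Cmd.pop (.word r) fun _ => .skip).run L)^[n] s =
        update s (.word r) ((s (.word r)).drop n) := by
    intro n
    induction n with
    | zero => simp
    | succ n ih =>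
      intro s
      rw [iterate_succ_apply, ih]
      simp [Cmd.run]
  exact h _ _

/-- A word with equal digits is 0 or -1 in two's complement. All other constants are derived from
these two. -/
theorem const (b : Bool) (r : W) :
    Realizable fun _ (σ : St W S) => σ.push r (if b then -1 else 0) := by
  refine ⟨.cube (.push (.word r) (.bit b)), fun L _ σ => ?_⟩
  beta_reduce
  have h : ∀ (n : ℕ) (s : Store W S → List InputSymbol),
      ((Cmd.push (.word r) (.bit b)).run L)^[n] s =
        update s (.word r) (List.replicate n (.bit b) ++ s (.word r)) := by
    intro n
    induction n with
    | zero => simp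
    | succ n ih =>
      intro s
      rw [iterate_succ_apply, ih]
      simp [Cmd.run, List.replicate_succ']
  rw [Cmd.run_cube, h, St.push, St.enc_setWord]
  congr 1
  cases b <;> simp [encWords, bits_zero, bits_neg_one, enc]

theorem encWords_cons (L : ℕ) (z : ℤ) (l : List ℤ) :
    encWords L (z :: l) = (bits (L ^ 3) z).map .bit ++ encWords L l := rfl

theorem takeD_top (L : ℕ) (r : W) (σ : St W S) :
    (enc L σ (.word r)).takeD (L ^ 3) (.bit false) = (bits (L ^ 3) (σ.top r)).map .bit :=
  takeD_encWords L (σ.word r)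

theorem run_shift_word (L : ℕ) (r : W) (σ : St W S) :
    ((shift (.word r) .tmp).cube.run L) (enc L σ) =
      update (enc L (σ.drop r)) .tmp ((bits (L ^ 3) (σ.top r)).map .bit).reverse := by
  rw [Cmd.run_cube, run_shift _ _ _ (by simp), takeD_top, St.drop, St.enc_setWord, ← drop_encWords]
  simp [enc]

theorem takeD_reverse_bits (n : ℕ) (z : ℤ) (l : List InputSymbol) :
    (((bits n z).map InputSymbol.bit).reverse ++ l).takeD n (.bit false) =
      ((bits n z).map .bit).reverse :=
  List.takeD_left' (by simp)

theorem run_unshift (L n : ℕ) (k : Store W S) (hk : k ≠ .tmp) (z : ℤ)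
    (s : Store W S → List InputSymbol) (hs : s .tmp = []) (hn : n = L ^ 3) :
    ((shift .tmp k).cube.run L) (update s .tmp ((bits n z).map .bit).reverse) =
      update s k ((bits n z).map .bit ++ s k) := by
  subst hn
  have h := takeD_reverse_bits (L ^ 3) z []
  rw [List.append_nil] at h
  rw [Cmd.run_cube, run_shift _ _ _ hk.symm, update_self, h]
  funext k'
  by_cases e : k' = k
  · subst e; simp [hk]
  · by_cases e' : k' = .tmp
    · subst e'; simp [e, hs]
    · simp [e, e']

theorem move (r r' : W) : Realizable fun _ (σ : St W S) => σ.move r r' := by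
  refine ⟨.seq (.cube (shift (.word r) .tmp)) (.cube (shift .tmp (.word r'))), fun L _ σ => ?_⟩
  beta_reduce
  rw [Cmd.run, run_shift_word, run_unshift _ _ _ (by simp) _ _ rfl rfl, St.move, St.push,
    St.enc_setWord, encWords_cons]
  rfl

theorem toBits (r : W) (q : S) : Realizable fun L (σ : St W S) => σ.toBits L r q := by
  refine ⟨.seq (.cube (shift (.word r) .tmp)) (.cube (shift .tmp (.sym q))), fun L _ σ => ?_⟩
  beta_reduce
  rw [Cmd.run, run_shift_word, run_unshift _ _ _ (by simp) _ _ rfl rfl, St.toBits,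
    St.enc_setSym]
  rfl

theorem copy (r r' : W) (hr : r ≠ r') : Realizable fun _ (σ : St W S) => σ.copy r r' := by
  refine ⟨.seq (.cube (shift (.word r) .tmp)) (.cube (shift₂ .tmp (.word r) (.word r'))),
    fun L _ σ => ?_⟩
  beta_reduce
  have h := takeD_reverse_bits (L ^ 3) (σ.top r) []
  rw [List.append_nil] at h
  rw [Cmd.run, run_shift_word, Cmd.run_cube, run_shift₂ _ _ _ _ (by simp) (by simp) _ (by simpa),
    update_self, h, St.copy, St.push, St.enc_setWord, encWords_cons, St.push, St.enc_setWord,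
    encWords_cons]
  funext k'
  by_cases e : k' = .word r'
  · subst e; simp [St.drop, hr.symm, enc]
  · by_cases e' : k' = .tmp
    · subst e'; simp [enc]
    · by_cases e'' : k' = .word r
      · subst e''; simp [e, enc]
      · simp [e, e', e'']

theorem addSub (f : Bool) (r r' : W) (hr : r ≠ r') : Realizable fun _ (σ : St W S) =>
    ((σ.drop r).drop r').push r (if f then σ.top r - σ.top r' else σ.top r + σ.top r') := by
  refine ⟨.seq (.push .carry (.bit f)) (.seq (.cube (addStep f (.word r) (.word r') .tmp .carry))
    (.seq (.cube (shift .tmp (.word r))) (.pop .carry fun _ => .skip))), fun L _ σ => ?_⟩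
  beta_reduce
  obtain ⟨c, h⟩ := run_addStep L f (.word r) (.word r') .tmp .carry (by simpa) (by simp) (by simp)
    (by simp) (by simp) (by simp) (L ^ 3) (update (enc L σ) .carry [.bit f]) (σ.top r) (σ.top r') f
    (by simp) (by simpa using takeD_top L r σ) (by simpa using takeD_top L r' σ)
  have hz : σ.top r + (if f then -1 - σ.top r' else σ.top r') + (if f then 1 else 0) =
      if f then σ.top r - σ.top r' else σ.top r + σ.top r' := by
    cases f <;> simp; ring
  rw [hz] at h
  generalize (if f then σ.top r - σ.top r' else σ.top r + σ.top r') = z at h ⊢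
  rw [Cmd.run, Cmd.run, Cmd.run, Cmd.run_cube _ (addStep ..), Cmd.run]
  have hc : enc L σ .carry = [] := rfl
  rw [hc, h]
  have ht : update (enc L σ) Store.carry [.bit f] .tmp = [] := rfl
  rw [ht, List.append_nil, run_unshift _ _ _ (by simp) _ _ (by simp [enc]) rfl]
  rw [St.push, St.enc_setWord, encWords_cons, St.drop, St.enc_setWord, St.drop, St.enc_setWord]
  funext k'
  simp only [Cmd.run]
  by_cases e : k' = .carry
  · subst e; simp [enc]
  by_cases e' : k' = .word r
  · subst e'
    simp [hr, enc, ← drop_encWords]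
  by_cases e'' : k' = .word r'
  · subst e''
    simp [hr.symm, enc, ← drop_encWords]
  simp [e, e', e'']

theorem add (r r' : W) (hr : r ≠ r') : Realizable fun _ (σ : St W S) => σ.add r r' :=
  addSub false r r' hr

theorem sub (r r' : W) (hr : r ≠ r') : Realizable fun _ (σ : St W S) => σ.sub r r' :=
  addSub true r r' hr

end Realizable

end Realizable

end LoopProgram

/-! ### Multiplication by repeated doubling -/

namespace LoopProgram

open Function

section Mul

variable {W S : Type} [DecidableEq W] [DecidableEq S]

namespace St

/-- Doubles the top entry of `r`. -/
def double (r t : W) (σ : St W S) : St W S := (σ.copy r t).add r t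

/-- One step of the multiplication of `r` by the number with the binary digits on `q`. -/
def mulStep (r acc t : W) (o : Option InputSymbol) (σ : St W S) : St W S :=
  if o = some (.bit true) then ((σ.copy r t).add acc t).double r t else σ.double r t

theorem double_eq (r t : W) (hr : r ≠ t) (σ : St W S) (a : ℤ) (l : List ℤ)
    (hσ : σ.word r = a :: l) : σ.double r t = σ.setWord r (2 * a :: l) := by
  ext1
  · funext k
    by_cases h : k = t
    · subst h; simp [double, copy, add, drop, push, top, hσ, hr, hr.symm]
    by_cases h' : k = r
    · subst h'; simp [double, copy, add, drop, push, top, hσ, hr, hr.symm, two_mul]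
    simp [double, copy, add, drop, push, top, h, h']
  · rfl

theorem add_copy_eq (r acc t : W) (hr : r ≠ t) (ha : acc ≠ t) (hra : r ≠ acc) (σ : St W S) (a c : ℤ)
    (l l' : List ℤ) (hσ : σ.word r = a :: l) (hσ' : σ.word acc = c :: l') :
    (σ.copy r t).add acc t = σ.setWord acc ((c + a) :: l') := by
  ext1
  · funext k
    by_cases h : k = t
    · subst h; simp [copy, add, drop, push, top, hσ, ha.symm, hr.symm]
    by_cases h' : k = r
    · subst h'; simp [copy, add, drop, push, top, hσ, hr, hra]
    by_cases h'' : k = acc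
    · subst h''; simp [copy, add, drop, push, top, hσ, hσ', hra.symm, ha]
    simp [copy, add, drop, push, top, h, h', h'']
  · rfl

/-- The digits of the multiplier come least significant first, while the multiplicand is doubled in
each step and added to the accumulator whenever the digit is 1. -/
theorem iterate_mulStep (r acc t : W) (q : S) (hr : r ≠ t) (ha : acc ≠ t) (hra : r ≠ acc)
    (l l' : List ℤ) (m : List InputSymbol) (bs : List Bool) : ∀ (a c : ℤ) (σ : St W S),
    σ.word r = a :: l → σ.word acc = c :: l' → σ.sym q = bs.map .bit ++ m →
    (fun σ : St W S => (σ.setSym q (σ.sym q).tail).mulStep r acc t (σ.sym q).head?)^[bs.length] σ =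
      ((σ.setWord r (a * 2 ^ bs.length :: l)).setWord acc ((c + a * ofBits bs) :: l')).setSym q m := by
  induction bs with
  | nil =>
    intro a c σ h₁ h₂ h₃
    ext1
    · simp [ofBits, ← h₁, ← h₂]
    · simpa [ofBits] using h₃
  | cons b bs ih =>
    intro a c σ h₁ h₂ h₃
    rw [List.length_cons, iterate_succ_apply]
    have h : (σ.setSym q (σ.sym q).tail).mulStep r acc t (σ.sym q).head? =
        ((σ.setWord r (2 * a :: l)).setWord acc ((c + if b then a else 0) :: l')).setSym q
          (bs.map .bit ++ m) := by
      rw [h₃, mulStep]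
      cases b with
      | true =>
        rw [if_pos (by simp), add_copy_eq r acc t hr ha hra _ a c l l' (by simpa) (by simpa),
          double_eq r t hr _ a l (by simpa [hra])]
        ext1
        · simp [update_comm hra]
        · simp
      | false =>
        rw [if_neg (by simp), double_eq r t hr _ a l (by simpa)]
        ext1
        · have : update (update σ.word r (2 * a :: l)) acc (c :: l') = update σ.word r (2 * a :: l) := by
            rw [← h₂, update_comm hra, update_eq_self]
          simp [this]
        · simp
    rw [h, ih (2 * a) (c + if b then a else 0) _ (by simp [hra]) (by simp) (by simp)]
    ext1
    · funext k
      by_cases e : k = acc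
      · subst e
        cases b <;> simp [ofBits] <;> ring
      by_cases e' : k = r
      · subst e'
        simp [hra]; ring
      simp [e, e']
    · simp

end St

theorem Realizable.mul (r r' acc t : W) (q : S) (hr : r ≠ t) (ha : acc ≠ t) (hra : r ≠ acc)
    (hrr : r ≠ r') (hra' : r' ≠ acc) : Realizable fun _ (σ : St W S) => σ.mul r r' := by
  have hdouble : Realizable fun _ (σ : St W S) => σ.double r t := (add r t hr).comp (copy r t hr)
  have hstep : Realizable fun _ (σ : St W S) =>
      (σ.setSym q (σ.sym q).tail).mulStep r acc t (σ.sym q).head? := by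
    refine popSym q (F := fun o _ σ => σ.mulStep r acc t o) fun o => ?_
    by_cases h : o = some (.bit true)
    · simp only [St.mulStep, h, if_true]
      exact hdouble.comp ((add acc t ha).comp (copy r t hr))
    · simpa only [St.mulStep, h, if_false] using hdouble
  -- Read from right to left. Copying the top of `r` and dropping the copy turns an implicit zero on
  -- an empty stack into an actual entry, as `iterate_mulStep` requires.
  have h := (move acc r).comp ((drop r).comp (hstep.cube.comp ((const false acc).comp
    ((toBits r' q).comp ((drop acc).comp (copy r acc hra))))))
  refine h.congr fun L σ => ?_
  have e := St.iterate_mulStep r acc t q hr ha hra (σ.word r).tail (σ.word acc) (σ.sym q)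
    (bits (L ^ 3) (σ.top r')) (σ.top r) 0
    ((((((σ.copy r acc).drop acc).toBits L r' q)).push acc 0))
    (by simp [St.copy, St.push, St.drop, St.toBits, hra, hrr])
    (by simp [St.copy, St.push, St.drop, St.toBits, hra.symm, hra'.symm])
    (by simp [St.copy, St.push, St.drop, St.toBits, St.top, hra', hrr.symm])
  rw [length_bits] at e
  simp only [if_false, Bool.false_eq_true]
  -- The loop has multiplied by the residue of the multiplier only; the stored digits of the product
  -- are the same.
  have hb : bits (L ^ 3) (σ.top r * (σ.top r' % 2 ^ L ^ 3)) =
      bits (L ^ 3) (σ.top r * σ.top r') := bits_congr _ (Int.ModEq.mul_left _ (Int.mod_modEq _ _))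
  rw [e, St.mul, St.push, St.push, St.enc_setWord, Realizable.encWords_cons, ← hb,
    ← Realizable.encWords_cons, ← St.enc_setWord]
  congr 1
  ext1
  · funext k
    by_cases e₁ : k = r
    · subst e₁
      simp [St.move, St.drop, St.top, St.push, St.toBits, St.copy, ofBits_bits, hra, hra.symm, hrr]
    by_cases e₂ : k = acc
    · subst e₂
      simp [St.move, St.drop, St.push, e₁, hra'.symm]
    by_cases e₃ : k = r'
    · subst e₃
      simp [St.move, St.drop, St.top, St.copy, St.push, St.toBits, e₁, e₂]
    simp [St.move, St.drop, St.top, St.copy, St.push, St.toBits, e₁, e₂, e₃]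
  · funext k
    by_cases e : k = q
    · subst e; simp [St.move, St.push, St.drop]
    simp [St.drop, e, St.move, St.push, St.copy, St.toBits]

end Mul

end LoopProgram

/-! ### A programming language for the abstract machine -/

namespace LoopProgram

open Function

/-- The integer stacks of the program for the SHAP-score. -/
inductive WReg : Type
  | acc | aux | base | half | leaf (c : Bool) | leafBack | val | valBack | sum | prod | new | out
  | res | arg | off | dig | unit | idx | pow | wt | num | den | neg
  deriving DecidableEq, Fintype

/-- The symbol stacks of the program for the SHAP-score. -/
inductive SReg : Type
  | mulBits | store | toks | gates | gatesBack | pend | digs | sgn | sgnBack | numBits | outq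
  deriving DecidableEq

instance : Finite SReg := by
  have : ∀ q, q ∈ [SReg.mulBits, .store, .toks, .gates, .gatesBack, .pend, .digs, .sgn, .sgnBack,
    .numBits, .outq] := by intro q; cases q <;> simp
  exact Finite.of_injective (fun q => (⟨q, this q⟩ : {q // q ∈ _}))
    fun _ _ h => congrArg Subtype.val h

/-- Programs of the abstract machine. -/
inductive Prog : Type
  | skip
  | const (b : Bool) (r : WReg)
  | drop (r : WReg)
  | move (r r' : WReg)
  | copy (r r' : WReg) (h : r ≠ r' := by simp)
  | add (r r' : WReg) (h : r ≠ r' := by simp)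
  | sub (r r' : WReg) (h : r ≠ r' := by simp)
  | mul (r r' : WReg) (h : r ≠ r' := by simp) (h₁ : r ≠ .aux := by simp) (h₂ : r ≠ .acc := by simp)
      (h₃ : r' ≠ .acc := by simp)
  | toBits (r : WReg) (q : SReg)
  | push (q : SReg) (a : InputSymbol)
  | pop (q : SReg) (f : Option InputSymbol → Prog)
  | ifEmpty (r : WReg) (p p' : Prog)
  | seq (p p' : Prog)
  | loop (p : Prog)

namespace Prog

infixr:60 " ;; " => Prog.seq

/-- The effect of a program. -/
def eval (L : ℕ) : Prog → St WReg SReg → St WReg SReg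
  | skip, σ => σ
  | const b r, σ => σ.push r (if b then -1 else 0)
  | drop r, σ => σ.drop r
  | move r r', σ => σ.move r r'
  | copy r r' _, σ => σ.copy r r'
  | add r r' _, σ => σ.add r r'
  | sub r r' _, σ => σ.sub r r'
  | mul r r' _ _ _ _, σ => σ.mul r r'
  | toBits r q, σ => σ.toBits L r q
  | push q a, σ => σ.setSym q (a :: σ.sym q)
  | pop q f, σ => (f (σ.sym q).head?).eval L (σ.setSym q (σ.sym q).tail)
  | ifEmpty r p p', σ => if σ.word r = [] then p.eval L σ else p'.eval L σ
  | seq p p', σ => p'.eval L (p.eval L σ)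
  | loop p, σ => (p.eval L)^[L] σ

theorem realizable_eval : ∀ p : Prog, Realizable fun L => p.eval L
  | skip => .id
  | const b r => .const b r
  | drop r => .drop r
  | move r r' => .move r r'
  | copy r r' h => .copy r r' h
  | add r r' h => .add r r' h
  | sub r r' h => .sub r r' h
  | mul r r' h h₁ h₂ h₃ => .mul r r' .acc .aux .mulBits h₁ (by simp) h₂ h h₃
  | toBits r q => .toBits r q
  | push q a => .pushSym q a
  | pop q f => .popSym q fun o => (f o).realizable_eval
  | ifEmpty r p p' => .ite r p.realizable_eval p'.realizable_eval
  | seq p p' => (Realizable.comp p'.realizable_eval p.realizable_eval :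
      Realizable fun L σ => p'.eval L (p.eval L σ))
  | loop p => .loop p.realizable_eval

/-- Whether a program may change a stack of integers. -/
def UsesWord (r : WReg) : Prog → Prop
  | skip => False
  | const _ r₁ => r = r₁
  | drop r₁ => r = r₁
  | move r₁ r₂ => r = r₁ ∨ r = r₂
  | copy r₁ r₂ _ => r = r₁ ∨ r = r₂
  | add r₁ r₂ _ => r = r₁ ∨ r = r₂
  | sub r₁ r₂ _ => r = r₁ ∨ r = r₂
  | mul r₁ r₂ _ _ _ _ => r = r₁ ∨ r = r₂
  | toBits r₁ _ => r = r₁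
  | push _ _ => False
  | pop _ f => ∃ o, (f o).UsesWord r
  | ifEmpty _ p p' => p.UsesWord r ∨ p'.UsesWord r
  | seq p p' => p.UsesWord r ∨ p'.UsesWord r
  | loop p => p.UsesWord r

/-- Whether a program may change a stack of symbols. -/
def UsesSym (q : SReg) : Prog → Prop
  | toBits _ q₁ => q = q₁
  | push q₁ _ => q = q₁
  | pop q₁ f => q = q₁ ∨ ∃ o, (f o).UsesSym q
  | ifEmpty _ p p' => p.UsesSym q ∨ p'.UsesSym q
  | seq p p' => p.UsesSym q ∨ p'.UsesSym q
  | loop p => p.UsesSym q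
  | _ => False

/-- A frame rule that later proofs use to track only the few stacks that matter. Multiplication
counts only its two operands as used, because its abstract effect leaves the work stacks as they
were. -/
theorem word_eval (L : ℕ) (r : WReg) : ∀ (p : Prog) (σ : St WReg SReg), ¬p.UsesWord r →
    (p.eval L σ).word r = σ.word r
  | skip, σ, _ => rfl
  | const b r₁, σ, h => by simp_all [eval, UsesWord, St.push]
  | drop r₁, σ, h => by simp_all [eval, UsesWord, St.drop]
  | move r₁ r₂, σ, h => by simp_all [eval, UsesWord, St.move, St.push, St.drop]
  | copy r₁ r₂ _, σ, h => by simp_all [eval, UsesWord, St.copy, St.push, St.drop]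
  | add r₁ r₂ _, σ, h => by simp_all [eval, UsesWord, St.add, St.push, St.drop]
  | sub r₁ r₂ _, σ, h => by simp_all [eval, UsesWord, St.sub, St.push, St.drop]
  | mul r₁ r₂ _ _ _ _, σ, h => by simp_all [eval, UsesWord, St.mul, St.push, St.drop]
  | toBits r₁ q, σ, h => by simp_all [eval, UsesWord, St.toBits, St.drop]
  | push q a, σ, _ => rfl
  | pop q f, σ, h => by
    rw [UsesWord, not_exists] at h
    rw [eval, word_eval L r _ _ (h _), St.word_setSym]
  | ifEmpty r₁ p p', σ, h => by
    rw [UsesWord, not_or] at h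
    rw [eval]
    split_ifs
    exacts [word_eval L r _ _ h.1, word_eval L r _ _ h.2]
  | seq p p', σ, h => by
    rw [UsesWord, not_or] at h
    rw [eval, word_eval L r _ _ h.2, word_eval L r _ _ h.1]
  | loop p, σ, h => by
    rw [UsesWord] at h
    rw [eval]
    generalize L = n at *
    have : ∀ k, ((p.eval n)^[k] σ).word r = σ.word r := by
      intro k
      induction k with
      | zero => rfl
      | succ k ih => rw [iterate_succ_apply', word_eval n r p _ h, ih]
    exact this _

theorem sym_eval (L : ℕ) (q : SReg) : ∀ (p : Prog) (σ : St WReg SReg), ¬p.UsesSym q →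
    (p.eval L σ).sym q = σ.sym q
  | skip, σ, _ => rfl
  | const b r₁, σ, h => rfl
  | drop r₁, σ, h => rfl
  | move r₁ r₂, σ, h => rfl
  | copy r₁ r₂ _, σ, h => rfl
  | add r₁ r₂ _, σ, h => rfl
  | sub r₁ r₂ _, σ, h => rfl
  | mul r₁ r₂ _ _ _ _, σ, h => rfl
  | toBits r₁ q₁, σ, h => by simp_all [eval, UsesSym, St.toBits, St.drop]
  | push q₁ a, σ, h => by simp_all [eval, UsesSym]
  | pop q₁ f, σ, h => by
    rw [UsesSym, not_or, not_exists] at h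
    rw [eval, sym_eval L q _ _ (h.2 _), St.sym_setSym, update_of_ne h.1]
  | ifEmpty r₁ p p', σ, h => by
    rw [UsesSym, not_or] at h
    rw [eval]
    split_ifs
    exacts [sym_eval L q _ _ h.1, sym_eval L q _ _ h.2]
  | seq p p', σ, h => by
    rw [UsesSym, not_or] at h
    rw [eval, sym_eval L q _ _ h.2, sym_eval L q _ _ h.1]
  | loop p, σ, h => by
    rw [UsesSym] at h
    rw [eval]
    have : ∀ k, ((p.eval L)^[k] σ).sym q = σ.sym q := by
      intro k
      induction k with
      | zero => rfl
      | succ k ih => rw [iterate_succ_apply', sym_eval L q p _ h, ih]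
    exact this _

/-- Executes a program for each symbol of a stack of length at most `L`. -/
def forEach (q : SReg) (f : InputSymbol → Prog) : Prog := loop (pop q fun o => o.elim skip f)

/-- Executes a program as long as a stack is nonempty, at most `L` times. -/
def whileNonempty (r : WReg) (p : Prog) : Prog := loop (ifEmpty r skip p)

/-- Three nested loops. -/
def cube (p : Prog) : Prog := loop (loop (loop p))

/-- Pushes one. -/
def one (r : WReg) (h : r ≠ .aux := by simp) : Prog := const false r ;; const true .aux ;; sub r .aux h

theorem eval_cube (L : ℕ) (p : Prog) : p.cube.eval L = (p.eval L)^[L ^ 3] := by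
  have : L ^ 3 = L * L * L := by ring
  rw [this, iterate_mul, iterate_mul]
  rfl

theorem eval_one (L : ℕ) (r : WReg) (h : r ≠ .aux) (σ : St WReg SReg) :
    (one r h).eval L σ = σ.push r 1 := by
  ext1
  · funext k
    by_cases e : k = .aux
    · subst e; simp [one, eval, St.sub, St.push, St.drop, h.symm]
    by_cases e' : k = r
    · subst e'; simp [one, eval, St.sub, St.push, St.drop, St.top, h]
    simp [one, eval, St.sub, St.push, St.drop, e, e']
  · rfl

/-- An invariant that counts the repetitions of a loop. -/
theorem eval_loop_induction {L : ℕ} {p : Prog} (I : ℕ → St WReg SReg → Prop) {σ : St WReg SReg}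
    (h₀ : I 0 σ) (h : ∀ k < L, ∀ σ, I k σ → I (k + 1) (p.eval L σ)) : I L ((loop p).eval L σ) := by
  have : ∀ k ≤ L, I k ((p.eval L)^[k] σ) := by
    intro k
    induction k with
    | zero => exact fun _ => h₀
    | succ k ih =>
      intro hk
      rw [iterate_succ_apply']
      exact h k hk _ (ih (by omega))
  exact this L le_rfl

/-- Loops always make L repetitions. A loop whose work is done after n ≤ L of them idles at a fixed
point, and so behaves like a loop with a stopping condition. -/
theorem iterate_of_fixed {α : Type} {f : α → α} {x : α} {n L : ℕ} (hn : n ≤ L)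
    (h : f (f^[n] x) = f^[n] x) : f^[L] x = f^[n] x := by
  obtain ⟨k, rfl⟩ := Nat.exists_eq_add_of_le hn
  rw [add_comm, iterate_add_apply, iterate_fixed h]

/-- An invariant that depends on the symbols that remain. -/
theorem eval_forEach_induction {L : ℕ} {q : SReg} {f : InputSymbol → Prog}
    (I : List InputSymbol → St WReg SReg → Prop) (l : List InputSymbol) {σ : St WReg SReg}
    (hl : l.length ≤ L) (h₀ : I l σ) (hq : ∀ l σ, I l σ → σ.sym q = l)
    (h : ∀ a l σ, I (a :: l) σ → I l ((f a).eval L (σ.setSym q l))) :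
    I [] ((forEach q f).eval L σ) := by
  have : ∀ (l : List InputSymbol) (σ : St WReg SReg), I l σ →
      I [] (((pop q fun o => o.elim skip f).eval L)^[l.length] σ) := by
    intro l
    induction l with
    | nil => exact fun σ h => h
    | cons a l ih =>
      intro σ hσ
      rw [List.length_cons, iterate_succ_apply]
      refine ih _ ?_
      rw [eval, hq _ _ hσ]
      exact h a l σ hσ
  rw [forEach, eval, iterate_of_fixed hl]
  · exact this l σ h₀
  · have h := hq _ _ (this l σ h₀)
    rw [eval, h]
    ext1
    · rfl
    · exact (congrArg _ h.symm).trans (update_eq_self _ _)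

/-- An invariant that depends on the entries that remain. -/
theorem eval_whileNonempty_induction {L : ℕ} {r : WReg} {p : Prog}
    (I : List ℤ → St WReg SReg → Prop) (l : List ℤ) {σ : St WReg SReg}
    (hl : l.length ≤ L) (h₀ : I l σ) (hr : ∀ l σ, I l σ → σ.word r = l)
    (h : ∀ z l σ, I (z :: l) σ → I l (p.eval L σ)) :
    I [] ((whileNonempty r p).eval L σ) := by
  have : ∀ (l : List ℤ) (σ : St WReg SReg), I l σ →
      I [] (((ifEmpty r skip p).eval L)^[l.length] σ) := by
    intro l
    induction l with
    | nil => exact fun σ h => h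
    | cons a l ih =>
      intro σ hσ
      rw [List.length_cons, iterate_succ_apply]
      refine ih _ ?_
      rw [eval, hr _ _ hσ, if_neg (by simp)]
      exact h a l σ hσ
  rw [whileNonempty, eval, iterate_of_fixed hl]
  · exact this l σ h₀
  · rw [eval, if_pos (hr _ _ (this l σ h₀)), eval]

/-- Moves all entries of a stack, in reverse order. -/
def moveAll (r r' : WReg) : Prog := whileNonempty r (move r r')

theorem eval_moveAll {L : ℕ} {r r' : WReg} (h : r ≠ r') {σ : St WReg SReg}
    (hL : (σ.word r).length ≤ L) : (moveAll r r').eval L σ =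
      (σ.setWord r []).setWord r' ((σ.word r).reverse ++ σ.word r') := by
  have := eval_whileNonempty_induction (L := L) (r := r) (p := move r r')
    -- The invariant says that moving the remaining entries at once would produce the desired final
    -- state.
    (fun l σ' => (σ'.setWord r []).setWord r' (l.reverse ++ σ'.word r') =
      (σ.setWord r []).setWord r' ((σ.word r).reverse ++ σ.word r') ∧ σ'.word r = l)
    (σ.word r) hL ⟨rfl, rfl⟩ (fun _ _ h => h.2) ?_
  · rw [← this.1]
    ext1
    · funext k
      by_cases e : k = r'
      · subst e; simp [moveAll]
      by_cases e' : k = r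
      · subst e'; simp [moveAll, e, this.2]
      simp [moveAll, e, e']
    · rfl
  · rintro z l σ' ⟨h₁, h₂⟩
    refine ⟨?_, ?_⟩
    · rw [← h₁]
      ext1
      · funext k
        by_cases e : k = r'
        · subst e; simp [eval, St.move, St.push, St.drop, St.top, h₂, h.symm]
        by_cases e' : k = r
        · subst e'; simp [eval, St.move, e]
        simp [eval, St.move, St.push, St.drop, e, e']
      · rfl
    · simp [eval, St.move, St.push, St.drop, h, h₂]

/-- Moves all symbols of a stack, in reverse order. -/
def transfer (q q' : SReg) : Prog := forEach q (push q')

theorem eval_transfer {L : ℕ} {q q' : SReg} (h : q ≠ q') {σ : St WReg SReg}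
    (hL : (σ.sym q).length ≤ L) : (transfer q q').eval L σ =
      (σ.setSym q []).setSym q' ((σ.sym q).reverse ++ σ.sym q') := by
  have := eval_forEach_induction (L := L) (q := q) (f := push q')
    (fun l σ' => (σ'.setSym q []).setSym q' (l.reverse ++ σ'.sym q') =
      (σ.setSym q []).setSym q' ((σ.sym q).reverse ++ σ.sym q') ∧ σ'.sym q = l)
    (σ.sym q) hL ⟨rfl, rfl⟩ (fun _ _ h => h.2) ?_
  · rw [← this.1]
    ext1
    · rfl
    · funext k
      by_cases e : k = q'
      · subst e; simp [transfer]
      by_cases e' : k = q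
      · subst e'; simp [transfer, e, this.2]
      simp [transfer, e, e']
  · rintro z l σ' ⟨h₁, h₂⟩
    refine ⟨?_, ?_⟩
    · rw [← h₁]
      ext1
      · rfl
      · funext k
        by_cases e : k = q'
        · subst e; simp [eval, h.symm]
        by_cases e' : k = q
        · subst e'; simp [e]
        simp [eval, e, e']
    · simp [eval, h]

end Prog

end LoopProgram

/-! ### The program for the SHAP-score -/

namespace LoopProgram

open Function

namespace Prog

/-- Computes the base `2 ^ L` of the Kronecker substitution, and half of it. -/
def setBase : Prog := one .base ;; loop (copy .base .half ;; copy .base .aux ;; add .base .aux)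

/-- Pushes the values of a variable, for the feature in question and for the other ones. -/
def pushLeaf (b mark c : Bool) : Prog :=
  if mark then (if b = c then one (.leaf c) else const false (.leaf c))
  else if b then one (.leaf c) ;; copy .base .aux ;; sub (.leaf c) .aux
  else copy .base (.leaf c)

/-- Reads the entity. -/
def readEntity : Prog := loop (pop .toks fun
  | some (.bit b) => pop .toks fun
    | some (.bit mark) => pushLeaf b mark true ;; pushLeaf b mark false
    | _ => skip
  -- The end mark is put back, so the remaining repetitions change nothing.
  | some a => push .toks a
  | none => skip)

/-- Reverses the description of the gates and initializes their values. -/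
def readGates : Prog := pop .toks (fun _ => skip) ;; forEach .toks fun
  | .bit b => push .gates (.bit b)
  | a => push .gates a ;; const false .val

/-- Processes a bit in the row of a gate, where the value is on top of `r`. -/
def useValue (r : WReg) (b : Bool) (h : r ≠ .arg := by simp) : Prog :=
  if b then copy r .arg h ;; add .sum .arg ;; copy r .arg h ;; mul .prod .arg else skip

/-- Processes a bit in the row of a gate. -/
def rowStep (c b : Bool) : Prog :=
  -- The row is read backwards: first the bits for the gates, matched with `val`, and once `val` is
  -- used up, those for the variables, matched with `leaf c`.
  ifEmpty .val (move (.leaf c) .leafBack ;; useValue .leafBack b)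
    (move .val .valBack ;; useValue .valBack b)

/-- Initializes the sum and the product for a gate. -/
def clearRow : Prog := const false .sum ;; one .prod

/-- Pushes the value of a gate. -/
def gateValue : InputSymbol → Prog
  | .andGate => copy .prod .new
  | .constGate true => copy .prod .new
  | .notGate => one .new ;; copy .sum .arg ;; sub .new .arg
  | _ => copy .sum .new

/-- Finishes the evaluation of a gate. -/
def finishGate (c : Bool) (kind : InputSymbol) (b : Bool) : Prog :=
  gateValue kind ;; (if b then copy .new .out else skip) ;; clearRow ;; moveAll .valBack .val ;;
    moveAll .leafBack (.leaf c)

/-- Processes a symbol of the reversed description of the gates. -/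
def gateStep (c : Bool) : InputSymbol → Prog
  -- In the reversed description the bit that marks the output gate follows the row and is
  -- recognized only by the kind symbol after it. Bits are therefore kept on `pend` and processed
  -- one symbol late.
  | .bit b => pop .pend (fun
      | some (.bit b') => rowStep c b'
      | _ => skip) ;; push .pend (.bit b)
  | kind => pop .pend fun
      | some (.bit b) => finishGate c kind b
      | _ => skip

/-- Evaluates all gates, based on the previous values. -/
def round (c : Bool) : Prog :=
  clearRow ;; forEach .gates (fun a => push .gatesBack a ;; gateStep c a) ;;
    whileNonempty .val (drop .val) ;; moveAll .new .val ;; transfer .gatesBack .gates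

/-- Evaluates the circuit. -/
def evalCircuit (c : Bool) : Prog := loop (round c)

/-- Computes the number whose digits are all equal to half the base. -/
def pushOffset : Prog :=
  const false .off ;; loop (copy .base .arg ;; mul .off .arg ;; copy .half .arg ;; add .off .arg)

/-- Reads the digits of the difference of the values of the output gate. -/
def readDigits : Prog :=
  (evalCircuit true ;; move .out .res) ;; evalCircuit false ;; move .out .arg ;; sub .res .arg ;;
    pushOffset ;; add .res .off ;; toBits .res .digs

/-- Computes the next coefficient. -/
def nextDigit : Prog :=
  const false .dig ;; one .unit ;; loop (pop .digs (fun o =>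
      if o = some (.bit true) then copy .unit .arg ;; add .dig .arg else skip) ;;
    copy .unit .arg ;; add .unit .arg) ;; copy .half .arg ;; sub .dig .arg

/-- Computes the next weight. -/
def nextWeight : Prog :=
  one .arg ;; add .idx .arg ;; copy .pow .arg ;; add .pow .arg ;; copy .idx .wt ;; copy .pow .arg ;;
    mul .wt .arg

/-- Adds a fraction. -/
def addFraction : Prog :=
  copy .wt .arg ;; mul .num .arg ;; copy .den .arg ;; mul .dig .arg ;; add .num .dig ;;
    mul .den .wt

/-- Integrates the polynomial. -/
def integrate : Prog :=
  const false .num ;; one .den ;; const false .idx ;; one .pow ;;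
    loop (nextDigit ;; nextWeight ;; addFraction)

/-- Outputs the sign and replaces the numerator by its absolute value. -/
def writeSign : Prog :=
  copy .num .arg ;; toBits .arg .sgn ;; cube (pop .sgn fun o => o.elim skip (push .sgnBack)) ;;
    -- The transfer has reversed the digits, so the top symbol is the most significant one, that is,
    -- the sign. It is output as a `constGate`, because a `bit false` would be swallowed by the
    -- removal of leading zeros in `writeNat`.
    pop .sgnBack fun o =>
      if o = some (.bit true) then
        push .outq (.constGate true) ;; const false .neg ;; sub .neg .num ;; move .neg .num
      else push .outq (.constGate false)

/-- Outputs a natural number. -/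
def writeNat (r : WReg) : Prog :=
  toBits r .numBits ;; cube (pop .numBits fun o => o.elim skip (push .outq)) ;;
    -- The most significant digit is on top. Zeros are discarded; any other symbol is pushed back,
    -- after which nothing changes.
    cube (pop .outq fun o => if o = some (.bit false) then skip else o.elim skip (push .outq))

/-- Reads the input. -/
def readInput : Prog := setBase ;; transfer .store .toks ;; readEntity ;; readGates

/-- The program for the SHAP-score. -/
def shap : Prog :=
  readInput ;; readDigits ;; integrate ;;
    writeSign ;; writeNat .num ;; push .outq .endEntity ;; writeNat .den

end Prog

end LoopProgram

/-! ### Correctness of the evaluation of one gate -/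

namespace LoopProgram

open Function

namespace Prog

/-- The stacks that matter for the evaluation of the gates. -/
structure GateInv (c : Bool) (V V' Lf Lf' N O : List ℤ) (s p : ℤ) (g g' pd : List InputSymbol)
    (σ : St WReg SReg) : Prop where
  val : σ.word .val = V
  valBack : σ.word .valBack = V'
  leaf : σ.word (.leaf c) = Lf
  leafBack : σ.word .leafBack = Lf'
  new : σ.word .new = N
  out : σ.word .out = O
  sum : σ.top .sum = s
  prod : σ.top .prod = p
  gates : σ.sym .gates = g
  gatesBack : σ.sym .gatesBack = g'
  pend : σ.sym .pend = pd

/-- The evaluation of a gate, where `R` are the values that are not yet used. -/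
def RowInv (c : Bool) (A B N O R : List ℤ) (s p : ℤ) (g g' pd : List InputSymbol)
    (σ : St WReg SReg) : Prop :=
  ∃ V V' Lf Lf', V'.reverse ++ V = A ∧ Lf'.reverse ++ Lf = B ∧ V ++ Lf = R ∧
    GateInv c V V' Lf Lf' N O s p g g' pd σ

/-- The value of a gate in terms of the sum and the product of the values of its inputs. -/
def gateFn : InputSymbol → ℤ → ℤ → ℤ
  | .andGate, _, p => p
  | .constGate true, _, p => p
  | .notGate, s, _ => 1 - s
  | _, s, _ => s

/-- The sum of the selected values. -/
def rowSum (row : List Bool) (vs : List ℤ) : ℤ := ((row.zip vs).map fun x => if x.1 then x.2 else 0).sum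

/-- The product of the selected values. -/
def rowProd (row : List Bool) (vs : List ℤ) : ℤ :=
  ((row.zip vs).map fun x => if x.1 then x.2 else 1).prod

/-- The body of the loop over the symbols of the description of the gates. -/
def gateBody (c : Bool) : Prog := pop .gates fun o => o.elim skip fun a => push .gatesBack a ;; gateStep c a

section Row

variable {L : ℕ} {c : Bool} {V V' Lf Lf' N O A B R : List ℤ} {s p : ℤ} {g g' pd : List InputSymbol}
  {σ : St WReg SReg}

theorem GateInv.rowStep_val {v : ℤ} (h : GateInv c (v :: V) V' Lf Lf' N O s p g g' pd σ) (b : Bool) :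
    GateInv c V (v :: V') Lf Lf' N O (s + if b then v else 0) (p * if b then v else 1) g g' pd
      ((rowStep c b).eval L σ) := by
  obtain ⟨h₁, h₂, h₃, h₄, h₅, h₆, h₇, h₈, h₉, h₁₀, h₁₁⟩ := h
  simp only [St.top, List.headD_eq_head?_getD] at h₇ h₈
  cases b <;> constructor <;>
    simp [rowStep, useValue, eval, St.move, St.copy, St.add, St.mul, St.push, St.drop, St.top, *]

theorem GateInv.rowStep_leaf {v : ℤ} (h : GateInv c [] V' (v :: Lf) Lf' N O s p g g' pd σ) (b : Bool) :
    GateInv c [] V' Lf (v :: Lf') N O (s + if b then v else 0) (p * if b then v else 1) g g' pd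
      ((rowStep c b).eval L σ) := by
  obtain ⟨h₁, h₂, h₃, h₄, h₅, h₆, h₇, h₈, h₉, h₁₀, h₁₁⟩ := h
  simp only [St.top, List.headD_eq_head?_getD] at h₇ h₈
  cases b <;> constructor <;>
    simp [rowStep, useValue, eval, St.move, St.copy, St.add, St.mul, St.push, St.drop, St.top, *]

theorem RowInv.rowStep {v : ℤ} (h : RowInv c A B N O (v :: R) s p g g' pd σ) (b : Bool) :
    RowInv c A B N O R (s + if b then v else 0) (p * if b then v else 1) g g' pd
      ((rowStep c b).eval L σ) := by
  obtain ⟨V, V', Lf, Lf', hA, hB, hR, h⟩ := h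
  cases V with
  | nil =>
    obtain rfl : Lf = v :: R := hR
    exact ⟨[], V', R, v :: Lf', hA, by simpa using hB, rfl, h.rowStep_leaf b⟩
  | cons w V =>
    obtain ⟨rfl, rfl⟩ := List.cons.inj hR
    exact ⟨V, w :: V', Lf, Lf', by simpa using hA, hB, rfl, h.rowStep_val b⟩

theorem RowInv.setPend (h : RowInv c A B N O R s p g g' pd σ) (l : List InputSymbol) :
    RowInv c A B N O R s p g g' l (σ.setSym .pend l) := by
  obtain ⟨V, V', Lf, Lf', hA, hB, hR, h⟩ := h
  obtain ⟨h₁, h₂, h₃, h₄, h₅, h₆, h₇, h₈, h₉, h₁₀, h₁₁⟩ := h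
  exact ⟨V, V', Lf, Lf', hA, hB, hR, h₁, h₂, h₃, h₄, h₅, h₆, h₇, h₈, by simpa, by simpa, by simp⟩

theorem RowInv.next {a : InputSymbol} (h : RowInv c A B N O R s p (a :: g) g' pd σ) :
    RowInv c A B N O R s p g (a :: g') pd
      ((σ.setSym .gates (σ.sym .gates).tail).setSym .gatesBack (a :: σ.sym .gatesBack)) := by
  obtain ⟨V, V', Lf, Lf', hA, hB, hR, h⟩ := h
  obtain ⟨h₁, h₂, h₃, h₄, h₅, h₆, h₇, h₈, h₉, h₁₀, h₁₁⟩ := h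
  exact ⟨V, V', Lf, Lf', hA, hB, hR, h₁, h₂, h₃, h₄, h₅, h₆, h₇, h₈, by simp [h₉], by simp [h₁₀],
    by simpa⟩

theorem RowInv.sym (h : RowInv c A B N O R s p g g' pd σ) :
    σ.sym .gates = g ∧ σ.sym .gatesBack = g' ∧ σ.sym .pend = pd := by
  obtain ⟨V, V', Lf, Lf', hA, hB, hR, h⟩ := h
  exact ⟨h.gates, h.gatesBack, h.pend⟩

theorem RowInv.exists_gateStep {a : InputSymbol} (h : RowInv c A B N O R s p (a :: g) g' pd σ) :
    ∃ τ, (gateBody c).eval L σ = (gateStep c a).eval L τ ∧ RowInv c A B N O R s p g (a :: g') pd τ :=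
  ⟨_, by rw [gateBody, eval, h.sym.1]; rfl, by
    simpa only [h.sym.1, eval, St.sym_setSym, ne_eq, reduceCtorEq, not_false_eq_true, update_of_ne]
      using h.next⟩

theorem RowInv.firstBit {b : Bool} (h : RowInv c A B N O R s p (.bit b :: g) g' [] σ) :
    RowInv c A B N O R s p g (.bit b :: g') [.bit b] ((gateBody c).eval L σ) := by
  obtain ⟨τ, e, h⟩ := h.exists_gateStep (L := L)
  rw [e]
  simp only [gateStep, eval, h.sym.2.2, List.head?_nil, List.tail_nil]
  simpa using (h.setPend []).setPend [.bit b]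

theorem RowInv.bit {b b' : Bool} {v : ℤ}
    (h : RowInv c A B N O (v :: R) s p (.bit b :: g) g' [.bit b'] σ) :
    RowInv c A B N O R (s + if b' then v else 0) (p * if b' then v else 1) g (.bit b :: g') [.bit b]
      ((gateBody c).eval L σ) := by
  obtain ⟨τ, e, h⟩ := h.exists_gateStep (L := L)
  have h' := (h.setPend []).rowStep (L := L) b'
  rw [e]
  simp only [gateStep, eval, h.sym.2.2, List.head?_cons, List.tail_cons, h'.sym.2.2]
  exact h'.setPend [.bit b]

/-- Processing lags by one symbol: with `b` pending and the symbols `bs` ahead, the bits processed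
are those of `b :: bs` except for the last one, the output mark, which stays pending. -/
theorem RowInv.bits {o : Bool} (row : List Bool) : ∀ (R : List ℤ) (σ : St WReg SReg) (s p : ℤ)
    (g' : List InputSymbol) (b : Bool) (bs : List Bool), row.length = R.length → b :: bs = row ++ [o] →
    RowInv c A B N O R s p (bs.map .bit ++ g) g' [.bit b] σ →
    RowInv c A B N O [] (s + rowSum row R) (p * rowProd row R) g ((bs.map .bit).reverse ++ g') [.bit o]
      (((gateBody c).eval L)^[row.length] σ) := by
  induction row with
  | nil =>
    rintro R σ s p g' b bs hR hb h
    obtain rfl : R = [] := by simpa using hR.symm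
    obtain ⟨rfl, rfl⟩ : b = o ∧ bs = [] := by simpa using hb
    simpa [rowSum, rowProd] using h
  | cons r row ih =>
    rintro R σ s p g' b bs hR hb h
    cases R with
    | nil => simp at hR
    | cons v R =>
      rw [List.cons_append, List.cons.injEq] at hb
      obtain ⟨rfl, hb⟩ := hb
      cases bs with
      | nil => simp at hb
      | cons b' bs =>
        have := ih R _ _ _ _ b' bs (by simpa using hR) hb (h.bit (L := L))
        simpa [rowSum, rowProd, add_assoc, mul_assoc] using this

theorem GateInv.gateValue (kind : InputSymbol) (h : GateInv c V V' Lf Lf' N O s p g g' pd σ) :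
    GateInv c V V' Lf Lf' (gateFn kind s p :: N) O s p g g' pd ((gateValue kind).eval L σ) := by
  obtain ⟨h₁, h₂, h₃, h₄, h₅, h₆, h₇, h₈, h₉, h₁₀, h₁₁⟩ := h
  simp only [St.top, List.headD_eq_head?_getD] at h₇ h₈
  rcases kind with _ | _ | (_ | _) | _ | _ | _ | _ <;> constructor <;>
    simp [Prog.gateValue, gateFn, eval, eval_one, St.copy, St.sub, St.push, St.drop, St.top, *]

theorem GateInv.copyOut {v : ℤ} (b : Bool) (h : GateInv c V V' Lf Lf' (v :: N) O s p g g' pd σ) :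
    GateInv c V V' Lf Lf' (v :: N) (if b then v :: O else O) s p g g' pd
      ((if b then copy .new .out else skip : Prog).eval L σ) := by
  obtain ⟨h₁, h₂, h₃, h₄, h₅, h₆, h₇, h₈, h₉, h₁₀, h₁₁⟩ := h
  simp only [St.top, List.headD_eq_head?_getD] at h₇ h₈
  cases b <;> constructor <;> simp [eval, St.copy, St.push, St.drop, St.top, *]

theorem GateInv.clearRow (h : GateInv c V V' Lf Lf' N O s p g g' pd σ) :
    GateInv c V V' Lf Lf' N O 0 1 g g' pd (clearRow.eval L σ) := by
  obtain ⟨h₁, h₂, h₃, h₄, h₅, h₆, h₇, h₈, h₉, h₁₀, h₁₁⟩ := h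
  constructor <;> simp [Prog.clearRow, eval, eval_one, St.push, St.top, *]

theorem GateInv.restore (h : GateInv c V V' Lf Lf' N O s p g g' pd σ) (hV' : V'.length ≤ L)
    (hLf' : Lf'.length ≤ L) : GateInv c (V'.reverse ++ V) [] (Lf'.reverse ++ Lf) [] N O s p g g' pd
      ((moveAll .valBack .val ;; moveAll .leafBack (.leaf c)).eval L σ) := by
  obtain ⟨h₁, h₂, h₃, h₄, h₅, h₆, h₇, h₈, h₉, h₁₀, h₁₁⟩ := h
  simp only [St.top, List.headD_eq_head?_getD] at h₇ h₈
  have e := eval_moveAll (r := .valBack) (r' := .val) (by simp) (h₂.symm ▸ hV')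
  rw [eval, e, eval_moveAll (by simp) (by simpa [h₄])]
  constructor <;> simp [St.top, *]

theorem RowInv.finish {b : Bool} {kind : InputSymbol} (hk : ∀ b, kind ≠ .bit b) (hA : A.length ≤ L)
    (hB : B.length ≤ L) (h : RowInv c A B N O [] s p (kind :: g) g' [.bit b] σ) :
    RowInv c A B (gateFn kind s p :: N) (if b then gateFn kind s p :: O else O) (A ++ B) 0 1 g
      (kind :: g') [] ((gateBody c).eval L σ) := by
  obtain ⟨τ, e, h⟩ := h.exists_gateStep (L := L)
  have e' : (gateStep c kind).eval L τ = (finishGate c kind b).eval L (τ.setSym .pend []) := by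
    rw [gateStep]
    · rw [eval, h.sym.2.2]; rfl
    · exact hk
  rw [e, e', finishGate]
  obtain ⟨V, V', Lf, Lf', rfl, rfl, hR, h⟩ := h.setPend []
  obtain ⟨rfl, rfl⟩ := List.append_eq_nil_iff.1 hR
  rw [List.append_nil] at hA hB
  exact ⟨_, [], _, [], rfl, rfl, by simp, (((h.gateValue kind).copyOut b).clearRow).restore
    (by simpa using hA) (by simpa using hB)⟩

end Row

end Prog

end LoopProgram

/-! ### Correctness of one round over all gates -/

namespace LoopProgram

open Function

namespace Prog

/-- The description of a gate: its kind, whether it is the output gate, and its row. -/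
structure GateDesc : Type where
  kind : InputSymbol
  out : Bool
  row : List Bool

/-- The description of a gate as a list of symbols. -/
def GateDesc.encode (d : GateDesc) : List InputSymbol := d.kind :: .bit d.out :: d.row.map .bit

/-- The value of a gate, where `vs` are the values of the variables and gates. -/
def GateDesc.value (d : GateDesc) (vs : List ℤ) : ℤ :=
  gateFn d.kind (rowSum d.row vs) (rowProd d.row vs)

theorem zip_reverse_reverse {α β : Type} {l : List α} {l' : List β} (h : l.length = l'.length) :
    l.reverse.zip l'.reverse = (l.zip l').reverse := by
  exact (List.reverse_zipWith h).symm

theorem rowSum_reverse (row : List Bool) (vs : List ℤ) (h : row.length = vs.length) :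
    rowSum row.reverse vs.reverse = rowSum row vs := by
  rw [rowSum, rowSum, zip_reverse_reverse h, List.map_reverse, List.sum_reverse]

theorem rowProd_reverse (row : List Bool) (vs : List ℤ) (h : row.length = vs.length) :
    rowProd row.reverse vs.reverse = rowProd row vs := by
  rw [rowProd, rowProd, zip_reverse_reverse h, List.map_reverse, List.prod_reverse]

section Gates

variable {L : ℕ} {c : Bool} {N O A B : List ℤ} {g g' : List InputSymbol} {σ : St WReg SReg}

/-- The row is met from its end, and the stacks hold the values in reverse as well, so both
reversals cancel in the sum and in the product. -/
theorem RowInv.gate {d : GateDesc} (hd : d.row.length = (A ++ B).length) (hk : ∀ b, d.kind ≠ .bit b)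
    (hA : A.length ≤ L) (hB : B.length ≤ L)
    (h : RowInv c A B N O (A ++ B) 0 1 (d.encode.reverse ++ g) g' [] σ) :
    RowInv c A B (d.value (A ++ B).reverse :: N)
      (if d.out then d.value (A ++ B).reverse :: O else O) (A ++ B) 0 1 g (d.encode ++ g') []
      (((gateBody c).eval L)^[d.encode.length] σ) := by
  obtain ⟨b, bs, hb⟩ : ∃ b bs, b :: bs = d.row.reverse ++ [d.out] := by
    cases h : d.row.reverse ++ [d.out] with
    | nil => simp at h
    | cons b bs => exact ⟨b, bs, rfl⟩
  have he : d.encode.reverse = .bit b :: (bs.map .bit ++ [d.kind]) := by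
    have := congrArg (List.map InputSymbol.bit) hb
    simp only [List.map_cons, List.map_append, List.map_reverse, List.map_nil] at this
    rw [GateDesc.encode, List.reverse_cons, List.reverse_cons, ← this, List.cons_append]
  rw [he, List.cons_append, List.append_assoc] at h
  have h' := (RowInv.bits (L := L) (o := d.out) d.row.reverse (A ++ B) _ _ _ _ b bs (by simpa using hd) hb
    (h.firstBit (L := L))).finish hk hA hB
  have e : d.encode.length = (d.row.reverse.length + 1) + 1 := by simp [GateDesc.encode]
  rw [e, iterate_succ_apply', iterate_succ_apply]
  have hs : rowSum d.row.reverse (A ++ B) = rowSum d.row (A ++ B).reverse := by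
    rw [← rowSum_reverse _ _ (by simpa using hd), List.reverse_reverse]
  have hp : rowProd d.row.reverse (A ++ B) = rowProd d.row (A ++ B).reverse := by
    rw [← rowProd_reverse _ _ (by simpa using hd), List.reverse_reverse]
  rw [hs, hp, zero_add, one_mul] at h'
  have he' : d.encode = d.kind :: ((bs.map .bit).reverse ++ [.bit b]) := by
    simpa using congrArg List.reverse he
  rw [he']
  simpa [GateDesc.value] using h'

theorem RowInv.gates (hA : A.length ≤ L) (hB : B.length ≤ L) (ds : List GateDesc) :
    ∀ (N O : List ℤ) (g' : List InputSymbol) (σ : St WReg SReg),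
    (∀ d ∈ ds, d.row.length = (A ++ B).length ∧ ∀ b, d.kind ≠ .bit b) →
    RowInv c A B N O (A ++ B) 0 1 (ds.flatMap (fun d => d.encode.reverse) ++ g) g' [] σ →
    RowInv c A B ((ds.map fun d => d.value (A ++ B).reverse).reverse ++ N)
      (((ds.filter GateDesc.out).map fun d => d.value (A ++ B).reverse).reverse ++ O) (A ++ B) 0 1 g
      ((ds.flatMap fun d => d.encode.reverse).reverse ++ g') []
      (((gateBody c).eval L)^[(ds.flatMap fun d => d.encode.reverse).length] σ) := by
  induction ds with
  | nil => intro N O g' σ _ h; simpa using h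
  | cons d ds ih =>
    intro N O g' σ hds h
    rw [List.forall_mem_cons] at hds
    rw [List.flatMap_cons, List.append_assoc] at h
    have h' := ih _ _ _ _ hds.2 (h.gate hds.1.1 hds.1.2 hA hB)
    rw [List.flatMap_cons, List.length_append, List.length_reverse, add_comm, iterate_add_apply]
    cases ho : d.out <;> simpa [ho] using h'

/-- The state between the rounds. -/
def RoundInv (c : Bool) (ds : List GateDesc) (leafs vals O : List ℤ) (σ : St WReg SReg) : Prop :=
  ∃ s p, GateInv c vals.reverse [] leafs.reverse [] [] O s p
    (ds.flatMap GateDesc.encode).reverse [] [] σ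

theorem eval_dropAll {r : WReg} (hr : (σ.word r).length ≤ L) :
    (whileNonempty r (drop r)).eval L σ = σ.setWord r [] := by
  have := eval_whileNonempty_induction (L := L) (r := r) (p := drop r)
    (fun l σ' => σ'.setWord r [] = σ.setWord r [] ∧ σ'.word r = l) (σ.word r) hr ⟨rfl, rfl⟩
    (fun _ _ h => h.2) ?_
  · rw [← this.1]
    ext1
    · exact (update_eq_self_iff.2 this.2.symm).symm
    · rfl
  · rintro z l σ' ⟨h₁, h₂⟩
    refine ⟨?_, ?_⟩
    · rw [← h₁]
      ext1
      · simp [eval, St.drop]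
      · rfl
    · simp [eval, St.drop, h₂]

/-- All gates are updated simultaneously: they read the old values, the new ones are collected on
`new` and replace them only at the end. The description of the gates is restored for the next round.
-/
theorem RoundInv.round {ds : List GateDesc} {leafs vals O : List ℤ}
    (hds : ∀ d ∈ ds, d.row.length = leafs.length + ds.length ∧ ∀ b, d.kind ≠ .bit b)
    (hvals : vals.length = ds.length) (hlen : leafs.length ≤ L)
    (hL : (ds.flatMap GateDesc.encode).length ≤ L) (h : RoundInv c ds leafs vals O σ) :
    RoundInv c ds leafs (ds.map fun d => d.value (leafs ++ vals))
      ((ds.filter GateDesc.out).map (fun d => d.value (leafs ++ vals)) ++ O)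
      ((round c).eval L σ) := by
  have hdsL : ds.length ≤ L := by
    refine le_trans ?_ hL
    rw [List.length_flatMap]
    exact List.length_le_sum_of_one_le _ (by simp [GateDesc.encode]) |>.trans_eq' (by simp)
  obtain ⟨s, p, h⟩ := h
  have e : (ds.flatMap GateDesc.encode).reverse = ds.reverse.flatMap fun d => d.encode.reverse := by
    rw [List.reverse_flatMap]; rfl
  have h₁ : RowInv c vals.reverse leafs.reverse [] O (vals.reverse ++ leafs.reverse) 0 1
      (ds.reverse.flatMap (fun d => d.encode.reverse) ++ []) [] [] (clearRow.eval L σ) := by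
    rw [List.append_nil, ← e]
    exact ⟨_, [], _, [], rfl, rfl, rfl, h.clearRow⟩
  have h₂ := h₁.gates (L := L) (by simp; omega) (by simpa) ds.reverse _ _ _ _
    (by simpa [hvals, add_comm] using hds)
  simp only [← e, List.append_nil, List.length_reverse, List.reverse_reverse, List.reverse_append,
    List.map_reverse, List.filter_reverse] at h₂
  have h₃ : (forEach .gates fun a => push .gatesBack a ;; gateStep c a).eval L (clearRow.eval L σ) =
      ((gateBody c).eval L)^[(ds.flatMap GateDesc.encode).length] (clearRow.eval L σ) := by
    rw [forEach, eval]
    refine iterate_of_fixed hL ?_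
    change (gateBody c).eval L (((gateBody c).eval L)^[_] _) = ((gateBody c).eval L)^[_] _
    rw [gateBody, eval]
    rw [← gateBody, h₂.sym.1]
    ext1
    · rfl
    · exact update_eq_self_iff.2 h₂.sym.1.symm
  rw [← h₃] at h₂
  obtain ⟨V, V', Lf, Lf', hV, hLf, hR, h₂⟩ := h₂
  -- The values that are still unused have the full total length, so nothing is left on the stacks
  -- of used values.
  obtain ⟨rfl, rfl⟩ : V' = [] ∧ Lf' = [] := by
    have h₁ := congrArg List.length hV
    have h₂ := congrArg List.length hLf
    have h₃ := congrArg List.length hR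
    simp only [List.length_append, List.length_reverse] at h₁ h₂ h₃
    exact ⟨List.eq_nil_of_length_eq_zero (by omega), List.eq_nil_of_length_eq_zero (by omega)⟩
  obtain rfl : V = vals.reverse := by simpa using hV
  obtain rfl : Lf = leafs.reverse := by simpa using hLf
  rw [Prog.round, eval, eval, eval, eval]
  generalize (forEach .gates fun a => push .gatesBack a ;; gateStep c a).eval L
    (clearRow.eval L σ) = τ at h₂
  obtain ⟨h₁, h₂, h₃, h₄, h₅, h₆, h₇, h₈, h₉, h₁₀, h₁₁⟩ := h₂
  rw [eval_dropAll (by rw [h₁]; simpa [hvals]), eval_moveAll (by simp) (by simp [h₅]; omega),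
    eval_transfer (by simp) (by simp [h₁₀]; simpa using hL)]
  refine ⟨0, 1, ?_⟩
  simp only [St.top, List.headD_eq_head?_getD] at h₇ h₈
  constructor <;> simp [St.top, *]

end Gates

end Prog

end LoopProgram

/-! ### Repeated rounds and their frame conditions -/

namespace LoopProgram

open Function

namespace Prog

/-- The values of the gates, computed from the previous ones. -/
def stepValues (ds : List GateDesc) (leafs vals : List ℤ) : List ℤ :=
  ds.map fun d => d.value (leafs ++ vals)

/-- The value of the output gate after `L` rounds, which does not depend on the initial values. -/
def IsOutputValue (L : ℕ) (ds : List GateDesc) (leafs : List ℤ) (a : ℤ) : Prop :=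
  ∀ vals : List ℤ, vals.length = ds.length →
    -- The exponent is L - 1 because the output pushed in the last of the L rounds is computed from
    -- the values after the round before.
    ((ds.filter GateDesc.out).map fun d =>
      d.value (leafs ++ (stepValues ds leafs)^[L - 1] vals)).head? = some a

theorem eval_seq (L : ℕ) (p p' : Prog) (σ : St WReg SReg) :
    (p ;; p').eval L σ = p'.eval L (p.eval L σ) := rfl

/-- Turns the quantifiers in `UsesWord` and `UsesSym` into finite disjunctions that `simp` decides.
-/
theorem exists_inputSymbol {P : InputSymbol → Prop} : (∃ a, P a) ↔ P (.bit true) ∨ P (.bit false) ∨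
    P .varGate ∨ P (.constGate true) ∨ P (.constGate false) ∨ P .andGate ∨ P .orGate ∨ P .notGate ∨
    P .endEntity := by
  constructor
  · rintro ⟨(_ | _) | _ | (_ | _) | _ | _ | _ | _, h⟩ <;> simp [h]
  · rintro (h | h | h | h | h | h | h | h | h) <;> exact ⟨_, h⟩

section

variable {L : ℕ} {c : Bool} {ds : List GateDesc} {leafs vals O : List ℤ} {σ : St WReg SReg}

theorem length_iterate_stepValues (h : vals.length = ds.length) (k : ℕ) :
    ((stepValues ds leafs)^[k] vals).length = ds.length := by
  cases k with
  | zero => exact h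
  | succ k => rw [iterate_succ_apply', stepValues, List.length_map]

/-- Each round pushes the current value of the output gate on `out`; the one from the last round is
on top, above obsolete ones that are never read. -/
theorem RoundInv.evalCircuit {a : ℤ}
    (hds : ∀ d ∈ ds, d.row.length = leafs.length + ds.length ∧ ∀ b, d.kind ≠ .bit b)
    (hvals : vals.length = ds.length) (hlen : leafs.length ≤ L)
    (hL : (ds.flatMap GateDesc.encode).length ≤ L) (hpos : 0 < L) (ha : IsOutputValue L ds leafs a)
    (h : RoundInv c ds leafs vals O σ) :
    ∃ vals' O', vals'.length = ds.length ∧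
      RoundInv c ds leafs vals' (a :: O') ((evalCircuit c).eval L σ) := by
  have h₁ := eval_loop_induction (L := L) (p := Prog.round c) (σ := σ) (fun k τ => ∃ O',
    RoundInv c ds leafs ((stepValues ds leafs)^[k] vals) O' τ ∧
      (0 < k → ∃ O'', O' = ((ds.filter GateDesc.out).map fun d =>
        d.value (leafs ++ (stepValues ds leafs)^[k - 1] vals)) ++ O'')) ⟨O, h, by simp⟩ ?_
  · obtain ⟨O', h₁, h₂⟩ := h₁
    obtain ⟨O'', h₂⟩ := h₂ hpos
    have h₃ := ha vals hvals
    cases e : (ds.filter GateDesc.out).map fun d =>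
      d.value (leafs ++ (stepValues ds leafs)^[L - 1] vals) with
    | nil => simp [e] at h₃
    | cons z l =>
      rw [e] at h₂ h₃
      obtain rfl : z = a := by simpa using h₃
      exact ⟨_, l ++ O'', length_iterate_stepValues hvals L, by rw [h₂] at h₁; exact h₁⟩
  · rintro k - τ ⟨O', h, -⟩
    refine ⟨_, ?_, fun _ => ⟨O', rfl⟩⟩
    rw [iterate_succ_apply']
    exact h.round hds (length_iterate_stepValues hvals k) hlen hL

theorem not_usesWord_evalCircuit {r : WReg} (c : Bool) (h : r ∉ [WReg.val, .valBack, .leaf c, .leafBack,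
    .new, .out, .sum, .prod, .arg, .aux]) : ¬(evalCircuit c).UsesWord r := by
  simp only [List.mem_cons, List.not_mem_nil, or_false, not_or] at h
  simp [Prog.evalCircuit, Prog.round, clearRow, one, forEach, whileNonempty, moveAll, transfer, UsesWord,
    Option.exists, exists_inputSymbol, gateStep, finishGate, gateValue, rowStep, useValue, h]

theorem not_usesSym_evalCircuit {q : SReg} (c : Bool) (h : q ∉ [SReg.gates, .gatesBack, .pend]) :
    ¬(evalCircuit c).UsesSym q := by
  simp only [List.mem_cons, List.not_mem_nil, or_false, not_or] at h
  simp [Prog.evalCircuit, Prog.round, clearRow, one, forEach, whileNonempty, moveAll, transfer, UsesSym,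
    Option.exists, exists_inputSymbol, gateStep, finishGate, gateValue, rowStep, useValue, h]

end

end Prog

end LoopProgram

/-! ### Evaluation for both values of the feature, and the offset -/

namespace LoopProgram

open Function

namespace Prog

section

variable {L : ℕ} {ds : List GateDesc} {leafs leafs' vals O : List ℤ} {σ : St WReg SReg}

theorem RoundInv.of_eq {c : Bool} {τ : St WReg SReg} (h : RoundInv c ds leafs vals O σ)
    (hw : ∀ r ∈ [WReg.val, .valBack, .leaf c, .leafBack, .new, .sum, .prod], τ.word r = σ.word r)
    (hs : τ.sym = σ.sym) : RoundInv c ds leafs vals (τ.word .out) τ := by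
  obtain ⟨s, p, h₁, h₂, h₃, h₄, h₅, h₆, h₇, h₈, h₉, h₁₀, h₁₁⟩ := h
  simp only [List.forall_mem_cons] at hw
  obtain ⟨w₁, w₂, w₃, w₄, w₅, w₆, w₇, -⟩ := hw
  rw [St.top] at h₇ h₈
  exact ⟨s, p, by rw [w₁, h₁], by rw [w₂, h₂], by rw [w₃, h₃], by rw [w₄, h₄], by rw [w₅, h₅], rfl,
    by rw [St.top, w₆, h₇], by rw [St.top, w₇, h₈], by rw [hs, h₉], by rw [hs, h₁₀], by rw [hs, h₁₁]⟩

/-- The second evaluation differs only in the leaf values. It starts from the gate values left by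
the first one, which is allowed since `IsOutputValue` quantifies over all initial values. -/
theorem RoundInv.other {c : Bool} {l : List ℤ} (h : RoundInv c ds leafs vals O σ)
    (hl : σ.word (.leaf !c) = l.reverse) : RoundInv (!c) ds l vals O σ := by
  obtain ⟨s, p, h₁, h₂, h₃, h₄, h₅, h₆, h₇, h₈, h₉, h₁₀, h₁₁⟩ := h
  exact ⟨s, p, h₁, h₂, hl, h₄, h₅, h₆, h₇, h₈, h₉, h₁₀, h₁₁⟩

/-- The offset that makes the digits nonnegative. -/
def offset (H B : ℤ) : ℕ → ℤ
  | 0 => 0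
  | k + 1 => offset H B k * B + H

theorem eval_pushOffset {H B : ℤ} {lb lh : List ℤ} (hb : σ.word .base = B :: lb)
    (hh : σ.word .half = H :: lh) : ∃ τ, pushOffset.eval L σ = τ ∧
      τ.word .off = offset H B L :: σ.word .off ∧ τ.word .half = H :: lh ∧
      τ.word .res = σ.word .res ∧ τ.sym = σ.sym := by
  have := eval_loop_induction (L := L)
    (p := copy .base .arg ;; mul .off .arg ;; copy .half .arg ;; add .off .arg)
    (σ := σ.push .off 0) (fun k τ => τ.word .off = offset H B k :: σ.word .off ∧
      τ.word .base = B :: lb ∧ τ.word .half = H :: lh ∧ τ.word .res = σ.word .res ∧ τ.sym = σ.sym)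
    ⟨by simp [St.push, offset], by simpa [St.push], by simpa [St.push], by simp [St.push], rfl⟩ ?_
  · obtain ⟨h₁, h₂, h₃, h₄, h₅⟩ := this
    exact ⟨_, rfl, h₁, h₃, h₄, h₅⟩
  · rintro k - τ ⟨h₁, h₂, h₃, h₄, h₅⟩
    refine ⟨?_, ?_, ?_, ?_, ?_⟩ <;>
      simp [eval, St.copy, St.add, St.mul, St.push, St.drop, St.top, offset, *]

theorem eval_readDigits {a a' H B : ℤ} {lb lh : List ℤ}
    (hds : ∀ d ∈ ds, d.row.length = leafs.length + ds.length ∧ ∀ b, d.kind ≠ .bit b)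
    (hlen : leafs.length ≤ L) (hlen' : leafs'.length = leafs.length) (hvals : vals.length = ds.length)
    (hL : (ds.flatMap GateDesc.encode).length ≤ L) (hpos : 0 < L)
    (ha : IsOutputValue L ds leafs a) (ha' : IsOutputValue L ds leafs' a')
    (h : RoundInv true ds leafs vals O σ) (hl : σ.word (.leaf false) = leafs'.reverse)
    (hb : σ.word .base = B :: lb) (hh : σ.word .half = H :: lh) :
    (readDigits.eval L σ).sym .digs =
        (bits (L ^ 3) (a - a' + offset H B L)).map .bit ++ σ.sym .digs ∧
      (readDigits.eval L σ).word .half = H :: lh ∧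
      (readDigits.eval L σ).sym .outq = σ.sym .outq := by
  obtain ⟨v₁, O₁, hv₁, h₁⟩ := h.evalCircuit hds hvals hlen hL hpos ha
  have w₁ := fun r h => word_eval L r (evalCircuit true) σ (not_usesWord_evalCircuit true h)
  have s₁ := fun q h => sym_eval L q (evalCircuit true) σ (not_usesSym_evalCircuit true h)
  generalize hτ₁ : (evalCircuit true ;; move .out .res).eval L σ = τ₁
  have h₂ : RoundInv true ds leafs v₁ O₁ τ₁ := by
    have := h₁.of_eq (τ := τ₁) ?_ ?_
    · obtain ⟨s, p, h₁⟩ := h₁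
      have e : τ₁.word .out = O₁ := by rw [← hτ₁]; simp [eval, St.move, St.push, St.drop, h₁.out]
      rwa [e] at this
    · rw [← hτ₁]; simp [eval, St.move, St.push, St.drop]
    · rw [← hτ₁]; simp [eval, St.move, St.push, St.drop]
  have hr : τ₁.word .res = a :: σ.word .res := by
    obtain ⟨s, p, h₁⟩ := h₁
    rw [← hτ₁]; simp [eval, St.move, St.push, St.drop, St.top, h₁.out, w₁]
  have w₂ : ∀ r ∈ [WReg.base, .half, .leaf false], τ₁.word r = σ.word r := by
    rw [← hτ₁]; simp [eval, St.move, St.push, St.drop, w₁]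
  have s₂ : ∀ q ∈ [SReg.digs, .outq], τ₁.sym q = σ.sym q := by
    rw [← hτ₁]; simp [eval, St.move, St.push, St.drop, s₁]
  obtain ⟨v₂, O₂, -, h₃⟩ := (h₂.other (l := leafs') (by rw [Bool.not_true, w₂ _ (by simp), hl])).evalCircuit
    (by rw [hlen']; exact hds) hv₁ (by omega) hL hpos ha'
  have w₃ := fun r h => word_eval L r (evalCircuit false) τ₁ (not_usesWord_evalCircuit false h)
  have s₃ := fun q h => sym_eval L q (evalCircuit false) τ₁ (not_usesSym_evalCircuit false h)
  rw [Bool.not_true] at h₃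
  rw [readDigits, eval, hτ₁, eval]
  generalize (evalCircuit false).eval L τ₁ = τ₂ at h₃ w₃ s₃
  obtain ⟨s, p, h₃⟩ := h₃
  have ho := h₃.out
  simp only [List.forall_mem_cons] at w₂ s₂
  obtain ⟨τ₃, e, h₄, h₅, h₆, h₇⟩ := eval_pushOffset (L := L) (H := H) (B := B) (lb := lb) (lh := lh)
    (σ := (sub .res .arg).eval L ((move .out .arg).eval L τ₂))
    (by simp [eval, St.move, St.sub, St.push, St.drop, w₃, w₂, hb])
    (by simp [eval, St.move, St.sub, St.push, St.drop, w₃, w₂, hh])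
  have hr' : τ₂.word .res = a :: σ.word .res := by rw [w₃ _ (by simp), hr]
  have h₆' : τ₃.word .res = (a - a') :: σ.word .res := by
    rw [h₆]; simp [eval, St.move, St.sub, St.push, St.drop, St.top, hr', ho]
  rw [eval_seq, eval_seq, eval_seq, e]
  refine ⟨?_, ?_, ?_⟩ <;>
    simp [eval, St.move, St.sub, St.add, St.push, St.drop, St.top, St.toBits, *]

end

end Prog

end LoopProgram

/-! ### Reading the entity and the gates -/

namespace LoopProgram

open Function

namespace Prog

/-- The values of a variable in terms of its value in the entity, the mark of the feature in question,
and the base: the probability under a product distribution, or `0` or `1` for the feature. -/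
def leafValue (V : ℤ) (c : Bool) (x : Bool × Bool) : ℤ :=
  if x.2 then (if x.1 = c then 1 else 0) else if x.1 then 1 - V else V

/-- The description of an entity as a list of symbols. -/
def encodeEntity (ps : List (Bool × Bool)) : List InputSymbol :=
  ps.flatMap fun x => [.bit x.1, .bit x.2]

/-- Whether a symbol is not a bit. -/
def isKind : InputSymbol → Bool
  | .bit _ => false
  | _ => true

/-- Each gate contributes exactly one symbol that is not a bit; `readGates` pushes one initial value
0 for each of these. -/
theorem countP_isKind (ds : List GateDesc) (hk : ∀ d ∈ ds, ∀ b, d.kind ≠ .bit b) :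
    (ds.flatMap GateDesc.encode).countP isKind = ds.length := by
  induction ds with
  | nil => rfl
  | cons d ds ih =>
    have h₁ : isKind d.kind = true := by
      have := hk d (by simp)
      cases h : d.kind <;> simp_all [isKind]
    have h₂ : (d.row.map InputSymbol.bit).countP isKind = 0 := by
      rw [List.countP_eq_zero]
      intro a ha
      obtain ⟨b, -, rfl⟩ := List.mem_map.1 ha
      simp [isKind]
    have ih := ih fun d h => hk d (by simp [h])
    rw [List.flatMap_cons, List.countP_append, ih, GateDesc.encode, List.countP_cons, List.countP_cons,
      h₂, h₁]
    simp [isKind, add_comm]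

section

variable {L : ℕ} {σ : St WReg SReg}

/-- Every repetition saves the base before doubling it, so the last saved copy is half of the final
base; the older copies stay below it. -/
theorem eval_setBase (hL : 0 < L) (hb : σ.word .base = []) : ∃ τ, setBase.eval L σ = τ ∧
    τ.word .base = [2 ^ L] ∧ (∃ lh, τ.word .half = 2 ^ (L - 1) :: lh) ∧
      (∀ r ∉ [WReg.base, .half, .aux], τ.word r = σ.word r) ∧ τ.sym = σ.sym := by
  have := eval_loop_induction (L := L) (p := copy .base .half ;; copy .base .aux ;; add .base .aux)
    (σ := σ.push .base 1) (fun k τ => τ.word .base = [2 ^ k] ∧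
      (0 < k → ∃ lh, τ.word .half = 2 ^ (k - 1) :: lh)) (by simp [St.push, hb]) ?_
  · refine ⟨_, rfl, ?_, ?_, ?_, ?_⟩
    · rw [setBase, eval_seq, eval_one]
      exact this.1
    · rw [setBase, eval_seq, eval_one]
      exact this.2 hL
    · intro r hr
      refine word_eval L r setBase σ ?_
      simp only [List.mem_cons, List.not_mem_nil, or_false, not_or] at hr
      simp [setBase, one, UsesWord, hr]
    · funext q
      refine sym_eval L q setBase σ ?_
      simp [setBase, one, UsesSym]
  · rintro k - τ ⟨h₁, -⟩
    refine ⟨?_, fun _ => ⟨τ.word .half, ?_⟩⟩ <;>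
      simp [eval, St.copy, St.add, St.push, St.drop, St.top, h₁]
    ring

theorem eval_pushLeaf {V : ℤ} {lb : List ℤ} (b mark c : Bool) (hb : σ.word .base = V :: lb) :
    ∃ τ, (pushLeaf b mark c).eval L σ = τ ∧
      τ.word (.leaf c) = leafValue V c (b, mark) :: σ.word (.leaf c) ∧
      (∀ r ∉ [WReg.aux, .leaf c], τ.word r = σ.word r) ∧ τ.sym = σ.sym := by
  refine ⟨_, rfl, ?_, ?_, ?_⟩
  · cases mark <;> cases b <;> cases c <;> simp [pushLeaf, leafValue, eval, eval_one, St.copy, St.sub, St.push,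
      St.drop, St.top, hb]
  · intro r hr
    simp only [List.mem_cons, List.not_mem_nil, or_false, not_or] at hr
    by_cases h : r = .base
    · subst h
      cases mark <;> cases b <;> cases c <;> simp [pushLeaf, eval, eval_one, St.copy, St.sub,
        St.push, St.drop, St.top, hb]
    refine word_eval L r _ σ ?_
    cases mark <;> cases b <;> cases c <;> simp [pushLeaf, one, UsesWord, hr, h]
  · funext q
    refine sym_eval L q _ σ ?_
    cases mark <;> cases b <;> cases c <;> simp [pushLeaf, one, UsesSym]

theorem eval_readEntity {V : ℤ} {lb : List ℤ} (ps : List (Bool × Bool)) {g : List InputSymbol}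
    (hps : ps.length ≤ L) (hb : σ.word .base = V :: lb)
    (ht : σ.sym .toks = encodeEntity ps ++ .endEntity :: g) : ∃ τ, readEntity.eval L σ = τ ∧
      (∀ c, τ.word (.leaf c) = (ps.map (leafValue V c)).reverse ++ σ.word (.leaf c)) ∧
      (∀ r ∉ [WReg.aux, .leaf true, .leaf false], τ.word r = σ.word r) ∧
      τ.sym .toks = .endEntity :: g ∧ ∀ q ≠ .toks, τ.sym q = σ.sym q := by
  rw [readEntity, eval]
  generalize hF : eval L (pop .toks _) = F
  have key : ∀ (ps : List (Bool × Bool)) (σ : St WReg SReg), σ.word .base = V :: lb →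
      σ.sym .toks = encodeEntity ps ++ .endEntity :: g → ∃ τ, F^[ps.length] σ = τ ∧
      (∀ c, τ.word (.leaf c) = (ps.map (leafValue V c)).reverse ++ σ.word (.leaf c)) ∧
      (∀ r ∉ [WReg.aux, .leaf true, .leaf false], τ.word r = σ.word r) ∧
      τ.sym .toks = .endEntity :: g ∧ ∀ q ≠ .toks, τ.sym q = σ.sym q := by
    intro ps
    induction ps with
    | nil => intro σ hb ht; exact ⟨σ, rfl, by simp, fun _ _ => rfl, ht, fun _ _ => rfl⟩
    | cons x ps ih =>
      intro σ hb ht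
      obtain ⟨b, m⟩ := x
      obtain ⟨τ₁, e₁, hl₁, hw₁, hs₁⟩ := eval_pushLeaf (L := L)
        (σ := (σ.setSym .toks (σ.sym .toks).tail).setSym .toks (σ.sym .toks).tail.tail) b m true hb
      obtain ⟨τ₂, e₂, hl₂, hw₂, hs₂⟩ := eval_pushLeaf (L := L) (σ := τ₁) (V := V) (lb := lb) b m false
        (by rw [hw₁ _ (by simp)]; exact hb)
      have e : F σ = τ₂ := by
        rw [← e₂, ← e₁, ← hF, eval, ht]
        simp [encodeEntity, eval]
      have ht₂ : τ₂.sym .toks = encodeEntity ps ++ .endEntity :: g := by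
        rw [hs₂, hs₁]; simp [ht, encodeEntity]
      obtain ⟨τ, e', h₁, h₂, h₃, h₄⟩ := ih τ₂ (by rw [hw₂ _ (by simp), hw₁ _ (by simp)]; exact hb) ht₂
      refine ⟨τ, by rw [List.length_cons, iterate_succ_apply, e, e'], ?_, ?_, h₃, ?_⟩
      · intro c
        rw [h₁]
        cases c
        · rw [hl₂, hw₁ _ (by simp)]; simp
        · rw [hw₂ _ (by simp), hl₁]; simp
      · intro r hr
        rw [h₂ r hr]
        simp only [List.mem_cons, List.not_mem_nil, or_false, not_or] at hr
        rw [hw₂ r (by simp [hr]), hw₁ r (by simp [hr])]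
        rfl
      · intro q hq
        rw [h₄ q hq, hs₂, hs₁]
        simp [hq]
  obtain ⟨τ, e, h₁, h₂, h₃, h₄⟩ := key ps σ hb ht
  refine ⟨τ, ?_, h₁, h₂, h₃, h₄⟩
  rw [iterate_of_fixed hps, e]
  rw [e, ← hF, eval, h₃]
  ext1
  · simp [eval]
  · simp only [List.head?_cons, List.tail_cons, eval, St.sym_setSym, update_self, update_idem]
    exact update_eq_self_iff.2 h₃.symm

theorem eval_readGates (ds : List GateDesc) (a : InputSymbol) (hk : ∀ d ∈ ds, ∀ b, d.kind ≠ .bit b)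
    (hL : (ds.flatMap GateDesc.encode).length ≤ L)
    (ht : σ.sym .toks = a :: ds.flatMap GateDesc.encode) : ∃ τ, readGates.eval L σ = τ ∧
      τ.word .val = List.replicate ds.length 0 ++ σ.word .val ∧ (∀ r ≠ .val, τ.word r = σ.word r) ∧
      τ.sym .gates = (ds.flatMap GateDesc.encode).reverse ++ σ.sym .gates ∧
      ∀ q ∉ [SReg.toks, .gates], τ.sym q = σ.sym q := by
  have hframe : ∀ r ≠ WReg.val, (readGates.eval L σ).word r = σ.word r := fun r hr =>
    word_eval L r _ σ (by simp [readGates, forEach, UsesWord, Option.exists, exists_inputSymbol, hr])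
  have hframe' : ∀ q ∉ [SReg.toks, .gates], (readGates.eval L σ).sym q = σ.sym q := by
    intro q hq
    simp only [List.mem_cons, List.not_mem_nil, or_false, not_or] at hq
    exact sym_eval L q _ σ
      (by simp [readGates, forEach, UsesSym, Option.exists, exists_inputSymbol, hq])
  have := eval_forEach_induction (L := L) (q := .toks) (f := fun
      | .bit b => push .gates (.bit b)
      | a => push .gates a ;; const false .val)
    (fun l τ => τ.sym .toks = l ∧ l.reverse ++ τ.sym .gates =
        (ds.flatMap GateDesc.encode).reverse ++ σ.sym .gates ∧
        List.replicate (l.countP isKind) 0 ++ τ.word .val =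
          List.replicate ds.length 0 ++ σ.word .val)
    (ds.flatMap GateDesc.encode) (σ := σ.setSym .toks (σ.sym .toks).tail) hL ?_ ?_ ?_
  · exact ⟨_, rfl, this.2.2, hframe, this.2.1, hframe'⟩
  · simp [ht, countP_isKind ds hk]
  · exact fun l τ h => h.1
  · rintro a l τ ⟨h₁, h₂, h₃⟩
    have h₄ : List.replicate (l.countP isKind) (0 : ℤ) ++ 0 :: τ.word .val =
        0 :: (List.replicate (l.countP isKind) 0 ++ τ.word .val) := by
      rw [← List.cons_append, ← List.replicate_succ, List.replicate_succ']; simp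
    rcases a with b | _ | b | _ | _ | _ | _ <;> refine ⟨?_, ?_, ?_⟩ <;>
      simp_all [eval, St.push, isKind, List.countP_cons, List.replicate_succ]

end

end Prog

end LoopProgram

/-! ### The whole input phase, and the extraction of one coefficient -/

namespace LoopProgram

open Function

namespace Prog

section

variable {L : ℕ} {σ : St WReg SReg}

theorem eval_readInput {ps : List (Bool × Bool)} {ds : List GateDesc} (hL : 0 < L)
    (hk : ∀ d ∈ ds, ∀ b, d.kind ≠ .bit b) (hw : σ.word = fun _ => [])
    (hs : ∀ q ≠ .store, σ.sym q = [])
    (hi : σ.sym .store = (encodeEntity ps ++ .endEntity :: ds.flatMap GateDesc.encode).reverse)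
    (hlen : (encodeEntity ps ++ .endEntity :: ds.flatMap GateDesc.encode).length ≤ L) :
    ∃ τ, readInput.eval L σ = τ ∧
      RoundInv true ds (ps.map (leafValue (2 ^ L) true)) (List.replicate ds.length 0) [] τ ∧
      τ.word (.leaf false) = (ps.map (leafValue (2 ^ L) false)).reverse ∧
      τ.word .base = [2 ^ L] ∧ (∃ lh, τ.word .half = 2 ^ (L - 1) :: lh) ∧
      τ.sym .digs = [] ∧ τ.sym .outq = [] := by
  obtain ⟨τ₁, e₁, hb₁, hh₁, hw₁, hs₁⟩ := eval_setBase (L := L) hL (σ := σ) (by rw [hw])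
  have hps : ps.length ≤ (encodeEntity ps).length := by
    rw [encodeEntity, List.length_flatMap]
    simp
    omega
  simp only [List.length_append, List.length_cons] at hlen
  have e₂ := eval_transfer (L := L) (q := .store) (q' := .toks) (by simp) (σ := τ₁)
    (by rw [hs₁, hi]; simp only [List.length_reverse, List.length_append, List.length_cons]; omega)
  rw [hs₁, hi, hs _ (by simp), List.reverse_reverse, List.append_nil] at e₂
  generalize hτ₂ : St.setSym SReg.toks _ _ = τ₂ at e₂
  obtain ⟨τ₃, e₃, hl₃, hw₃, ht₃, hs₃⟩ := eval_readEntity (L := L) (σ := τ₂) (lb := [])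
    (V := 2 ^ L) ps (g := ds.flatMap GateDesc.encode) (by omega) (by rw [← hτ₂]; exact hb₁)
    (by rw [← hτ₂]; simp)
  obtain ⟨τ₄, e₄, hv₄, hw₄, hg₄, hs₄⟩ := eval_readGates (L := L) ds _ hk (by omega) ht₃
  have w₂ : τ₂.word = τ₁.word := by rw [← hτ₂]; rfl
  have s₂ : ∀ q ∉ [SReg.store, .toks], τ₂.sym q = [] := by
    intro q hq
    simp only [List.mem_cons, List.not_mem_nil, or_false, not_or] at hq
    rw [← hτ₂]
    simp [hq, hs₁, hs]
  have w : ∀ r ∉ [WReg.base, .half, .aux, .leaf true, .leaf false, .val], τ₄.word r = [] := by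
    intro r hr
    simp only [List.mem_cons, List.not_mem_nil, or_false, not_or] at hr
    rw [hw₄ _ (by simp [hr]), hw₃ _ (by simp [hr]), w₂, hw₁ _ (by simp [hr]), hw]
  have l : ∀ c, τ₄.word (.leaf c) = (ps.map (leafValue (2 ^ L) c)).reverse := by
    intro c
    rw [hw₄ _ (by simp), hl₃, w₂, hw₁ _ (by simp), hw, List.append_nil]
  have s : ∀ q ∉ [SReg.store, .toks, .gates], τ₄.sym q = [] := by
    intro q hq
    simp only [List.mem_cons, List.not_mem_nil, or_false, not_or] at hq
    rw [hs₄ _ (by simp [hq]), hs₃ _ (by simp [hq]), s₂ _ (by simp [hq])]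
  refine ⟨τ₄, ?_, ⟨0, 0, ?_, ?_, ?_, ?_, ?_, ?_, ?_, ?_, ?_, ?_, ?_⟩, ?_, ?_, ?_, ?_, ?_⟩
  · rw [readInput, eval_seq, eval_seq, eval_seq, e₁, e₂, e₃, e₄]
  · rw [hv₄, hw₃ _ (by simp), w₂, hw₁ _ (by simp), hw]; simp
  · exact w _ (by simp)
  · exact l true
  · exact w _ (by simp)
  · exact w _ (by simp)
  · exact w _ (by simp)
  · rw [St.top, w _ (by simp)]; rfl
  · rw [St.top, w _ (by simp)]; rfl
  · rw [hg₄, hs₃ _ (by simp), s₂ _ (by simp), List.append_nil]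
  · exact s _ (by simp)
  · exact s _ (by simp)
  · exact l false
  · rw [hw₄ _ (by simp), hw₃ _ (by simp), w₂, hb₁]
  · rw [hw₄ _ (by simp), hw₃ _ (by simp), w₂]; exact hh₁
  · exact s _ (by simp)
  · exact s _ (by simp)

/-- L binary digits are assembled into one digit in base 2^L; subtracting H undoes the offset. -/
theorem eval_nextDigit {H : ℤ} {lh : List ℤ} {n : ℕ} {z : ℤ} (hn : L ≤ n)
    (hh : σ.word .half = H :: lh) (hd : σ.sym .digs = (bits n z).map .bit) :
    ∃ τ, nextDigit.eval L σ = τ ∧ τ.word .dig = (z % 2 ^ L - H) :: σ.word .dig ∧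
      τ.word .half = H :: lh ∧ τ.sym .digs = (bits (n - L) (z / 2 ^ L)).map .bit ∧
      (∀ r ∉ [WReg.dig, .unit, .arg, .half, .aux], τ.word r = σ.word r) ∧
      ∀ q ≠ .digs, τ.sym q = σ.sym q := by
  have hframe : ∀ r ∉ [WReg.dig, .unit, .arg, .half, .aux],
      (nextDigit.eval L σ).word r = σ.word r := by
    intro r hr
    simp only [List.mem_cons, List.not_mem_nil, or_false, not_or] at hr
    exact word_eval L r _ σ
      (by simp [nextDigit, one, UsesWord, Option.exists, exists_inputSymbol, hr])
  have hframe' : ∀ q ≠ .digs, (nextDigit.eval L σ).sym q = σ.sym q := by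
    intro q hq
    exact sym_eval L q _ σ
      (by simp [nextDigit, one, UsesSym, Option.exists, exists_inputSymbol, hq])
  have := eval_loop_induction (L := L) (p := pop .digs (fun o =>
      if o = some (.bit true) then copy .unit .arg ;; add .dig .arg else skip) ;;
      copy .unit .arg ;; add .unit .arg) (σ := (σ.push .dig 0).push .unit 1) (fun k τ =>
      τ.word .dig = z % 2 ^ k :: σ.word .dig ∧ τ.word .unit = 2 ^ k :: σ.word .unit ∧
      τ.sym .digs = (bits (n - k) (z / 2 ^ k)).map .bit ∧ τ.word .half = H :: lh) ?_ ?_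
  · obtain ⟨h₁, h₂, h₃, h₄⟩ := this
    refine ⟨_, rfl, ?_, ?_, ?_, hframe, hframe'⟩
    all_goals
      rw [nextDigit, eval_seq, eval_seq, eval_one, eval_seq, eval_seq]
      simp only [eval, Bool.false_eq_true, if_false] at h₁ h₂ h₃ h₄ ⊢
      simp [St.copy, St.sub, St.push, St.drop, St.top] at h₁ h₂ h₃ h₄ ⊢
      simp [*]
  · refine ⟨?_, ?_, ?_, ?_⟩ <;> simp [St.push, hh, hd]
  · rintro k hk τ ⟨h₁, h₂, h₃, h₄⟩
    have e : n - k = (n - (k + 1)) + 1 := by omega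
    rw [e, bits] at h₃
    have e' : z % 2 ^ (k + 1) = z % 2 ^ k + 2 ^ k * (z / 2 ^ k % 2) := by
      rw [pow_succ, Int.emod_def, Int.emod_def (z / 2 ^ k), Int.emod_def z,
        ← Int.ediv_ediv_of_nonneg (by positivity)]
      ring
    have e'' : z / 2 ^ (k + 1) = z / 2 ^ k / 2 := by
      rw [pow_succ, Int.ediv_ediv_of_nonneg (by positivity)]
    rw [e', e'']
    rcases Int.emod_two_eq_zero_or_one (z / 2 ^ k) with h | h <;> refine ⟨?_, ?_, ?_, ?_⟩ <;>
      simp [eval, St.copy, St.add, St.push, St.drop, St.top, *] <;> ring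

end

end Prog

end LoopProgram

/-! ### Integration as a fraction, and the output -/

namespace LoopProgram

open Function

namespace Prog

/-- The numerator and denominator of `∑ k < n, f k / ((k + 1) * 2 ^ (k + 1))`. -/
def weightedSum (f : ℕ → ℤ) : ℕ → ℤ × ℤ
  | 0 => (0, 1)
  | k + 1 => ((weightedSum f k).1 * ((k + 1) * 2 ^ (k + 1)) + f k * (weightedSum f k).2,
      (weightedSum f k).2 * ((k + 1) * 2 ^ (k + 1)))

/-- The digits of a number, reduced by `H`. -/
def digit (L : ℕ) (H z : ℤ) (k : ℕ) : ℤ := z / 2 ^ (L * k) % 2 ^ L - H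

/-- Removes trailing zeros from a list of digits. -/
def trim (l : List Bool) : List Bool := (l.reverse.dropWhile fun b => !b).reverse

section

variable {L : ℕ} {σ : St WReg SReg}

theorem eval_nextWeight {i p : ℤ} {li lp : List ℤ} (hi : σ.word .idx = i :: li)
    (hp : σ.word .pow = p :: lp) : ∃ τ, nextWeight.eval L σ = τ ∧ τ.word .idx = (i + 1) :: li ∧
      τ.word .pow = (p + p) :: lp ∧ τ.word .wt = ((i + 1) * (p + p)) :: σ.word .wt ∧
      (∀ r ∉ [WReg.idx, .pow, .arg, .wt, .aux], τ.word r = σ.word r) ∧ τ.sym = σ.sym := by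
  refine ⟨_, rfl, ?_, ?_, ?_, ?_, ?_⟩
  on_goal 4 =>
    intro r hr
    simp only [List.mem_cons, List.not_mem_nil, or_false, not_or] at hr
    exact word_eval L r _ σ (by simp [nextWeight, one, UsesWord, hr])
  on_goal 4 => funext q; exact sym_eval L q _ σ (by simp [nextWeight, one, UsesSym])
  all_goals rw [nextWeight, eval_seq, eval_one]
            simp [eval, St.copy, St.add, St.mul, St.push, St.drop, St.top, hi, hp]

theorem eval_addFraction {w p q d : ℤ} {lw lp lq ld : List ℤ} (hw : σ.word .wt = w :: lw)
    (hp : σ.word .num = p :: lp) (hq : σ.word .den = q :: lq) (hd : σ.word .dig = d :: ld) :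
    ∃ τ, addFraction.eval L σ = τ ∧ τ.word .num = (p * w + d * q) :: lp ∧
      τ.word .den = (q * w) :: lq ∧
      (∀ r ∉ [WReg.wt, .arg, .num, .den, .dig], τ.word r = σ.word r) ∧ τ.sym = σ.sym := by
  refine ⟨_, rfl, ?_, ?_, ?_, ?_⟩
  on_goal 3 =>
    intro r hr
    simp only [List.mem_cons, List.not_mem_nil, or_false, not_or] at hr
    exact word_eval L r _ σ (by simp [addFraction, UsesWord, hr])
  on_goal 3 => funext q; exact sym_eval L q _ σ (by simp [addFraction, UsesSym])
  all_goals simp [addFraction, eval, St.copy, St.add, St.mul, St.push, St.drop, St.top, *]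

theorem eval_integrate {H z : ℤ} {lh : List ℤ}
    (hh : σ.word .half = H :: lh) (hd : σ.sym .digs = (bits (L ^ 3) z).map .bit) :
    ∃ τ, integrate.eval L σ = τ ∧
      (∃ lp, τ.word .num = (weightedSum (digit L H z) L).1 :: lp) ∧
      (∃ lq, τ.word .den = (weightedSum (digit L H z) L).2 :: lq) ∧
      τ.sym .outq = σ.sym .outq := by
  have := eval_loop_induction (L := L) (p := nextDigit ;; nextWeight ;; addFraction)
    (σ := (((σ.push .num 0).push .den 1).push .idx 0).push .pow 1) (fun k τ =>
      (∃ lp, τ.word .num = (weightedSum (digit L H z) k).1 :: lp) ∧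
      (∃ lq, τ.word .den = (weightedSum (digit L H z) k).2 :: lq) ∧
      τ.sym .outq = σ.sym .outq ∧ (∃ li, τ.word .idx = (k : ℤ) :: li) ∧
      (∃ lp, τ.word .pow = 2 ^ k :: lp) ∧ τ.word .half = H :: lh ∧
      τ.sym .digs = (bits (L ^ 3 - L * k) (z / 2 ^ (L * k))).map .bit) ?_ ?_
  · refine ⟨_, rfl, ?_⟩
    rw [integrate, eval_seq, eval_seq, eval_one, eval_seq, eval_seq, eval_one]
    exact ⟨this.1, this.2.1, this.2.2.1⟩
  · refine ⟨⟨σ.word .num, ?_⟩, ⟨σ.word .den, ?_⟩, ?_, ⟨σ.word .idx, ?_⟩, ⟨σ.word .pow, ?_⟩, ?_, ?_⟩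
    iterate 5 simp [St.push, weightedSum]
    · simpa [St.push] using hh
    · simpa [St.push] using hd
  · rintro k hk τ ⟨⟨lp, h₁⟩, ⟨lq, h₂⟩, h₃, ⟨li, h₄⟩, ⟨lw, h₅⟩, h₆, h₇⟩
    -- All L blocks of L binary digits lie within one word, so no coefficient is cut off.
    have hk' : L * k + L ≤ L ^ 3 := by
      calc L * k + L = L * (k + 1) := by ring
        _ ≤ L * (L * L) := Nat.mul_le_mul_left _ (hk.trans_le (Nat.le_mul_self L))
        _ = L ^ 3 := by ring
    obtain ⟨τ₁, e₁, d₁, d₂, d₃, d₄, d₅⟩ := eval_nextDigit (L := L) (by omega) h₆ h₇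
    obtain ⟨τ₂, e₂, w₁, w₂, w₃, w₄, w₅⟩ := eval_nextWeight (L := L) (σ := τ₁)
      (by rw [d₄ _ (by simp), h₄]) (by rw [d₄ _ (by simp), h₅])
    obtain ⟨τ₃, e₃, a₁, a₂, a₃, a₄⟩ := eval_addFraction (L := L) (σ := τ₂) w₃
      (by rw [w₄ _ (by simp), d₄ _ (by simp), h₁]) (by rw [w₄ _ (by simp), d₄ _ (by simp), h₂])
      (by rw [w₄ _ (by simp), d₁])
    rw [eval_seq, eval_seq, e₁, e₂, e₃]
    have e : (2 : ℤ) ^ k + 2 ^ k = 2 ^ (k + 1) := by ring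
    rw [e] at a₁ a₂ w₂
    refine ⟨⟨_, a₁⟩, ⟨_, a₂⟩, ?_, ⟨li, ?_⟩, ⟨lw, ?_⟩, ?_, ?_⟩
    · rw [a₄, w₅, d₅ _ (by simp), h₃]
    · rw [a₃ _ (by simp), w₁]; simp
    · rw [a₃ _ (by simp), w₂]
    · rw [a₃ _ (by simp), w₄ _ (by simp), d₂]
    · have e : L ^ 3 - L * (k + 1) = L ^ 3 - L * k - L := by rw [mul_add, mul_one]; omega
      rw [a₄, w₅, d₃, e, mul_add, mul_one, pow_add, Int.ediv_ediv_of_nonneg (by positivity)]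

/-- Moves the first symbols of a stack. -/
theorem iterate_pop_push {q q' : SReg} (h : q ≠ q') (l : List InputSymbol) : ∀ (σ : St WReg SReg)
    (l' : List InputSymbol), σ.sym q = l ++ l' →
    ((pop q fun o => o.elim skip (push q')).eval L)^[l.length] σ =
      (σ.setSym q l').setSym q' (l.reverse ++ σ.sym q') := by
  induction l with
  | nil =>
    intro σ l' hl
    ext1
    · rfl
    · funext k
      by_cases h' : k = q'
      · subst h'; simp
      by_cases h'' : k = q
      · subst h''; simp [h, hl]
      · simp [h', h'']
  | cons a l ih =>
    intro σ l' hl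
    rw [List.length_cons, iterate_succ_apply, ih _ l']
    · ext1
      · simp [eval, hl]
      · funext k
        by_cases h' : k = q'
        · subst h'; simp [eval, hl, h.symm]
        by_cases h'' : k = q
        · subst h''; simp [h]
        · simp [eval, hl, h', h'']
    · simp [eval, hl, h]

/-- The sign of an integer and its absolute value. -/
theorem eval_writeSign {p : ℤ} {lp : List ℤ} (hp : σ.word .num = p :: lp) (hL : 0 < L)
    (hp' : |p| < 2 ^ (L ^ 3 - 1)) : ∃ τ, writeSign.eval L σ = τ ∧
      (∃ lp, τ.word .num = |p| :: lp) ∧ τ.word .den = σ.word .den ∧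
      τ.sym .outq = .constGate (decide (p < 0)) :: σ.sym .outq := by
  have e : L ^ 3 = L ^ 3 - 1 + 1 := (Nat.succ_pred_eq_of_pos (by positivity)).symm
  -- By the size bound, the top digit in two's complement is the sign.
  have hbits : bits (L ^ 3) p = bits (L ^ 3 - 1) p ++ [decide (p < 0)] := by
    rw [e, bits_add, ← e]
    simp only [bits]
    congr 2
    rw [abs_lt] at hp'
    rcases lt_or_ge p 0 with h | h
    · have : p / 2 ^ (L ^ 3 - 1) = -1 := by
        rw [Int.ediv_eq_iff_of_pos (by positivity)]
        constructor <;> linarith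
      simp [this, h]
    · rw [Int.ediv_eq_zero_of_lt h hp'.2]
      simp [h]
  rw [writeSign, eval_seq, eval_seq, eval_seq]
  have hd : ∃ τ, (toBits .arg .sgn).eval L ((copy .num .arg).eval L σ) = τ ∧
      τ.sym .sgn = (bits (L ^ 3) p).map .bit ++ σ.sym .sgn ∧ τ.word .num = p :: lp ∧
      τ.word .den = σ.word .den ∧ τ.sym .outq = σ.sym .outq := by
    refine ⟨_, rfl, ?_⟩
    simp [eval, St.toBits, St.copy, St.push, St.drop, St.top, hp]
  obtain ⟨τ, e₁, h₁, h₂, h₃, h₄⟩ := hd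
  have := iterate_pop_push (L := L) (q := .sgn) (q' := .sgnBack) (by simp)
    ((bits (L ^ 3) p).map .bit) τ _ h₁
  rw [List.length_map, length_bits] at this
  rw [e₁, eval_cube, this, eval, hbits]
  by_cases h : p < 0
  · refine ⟨_, rfl, ⟨lp, ?_⟩, ?_, ?_⟩ <;>
      simp [eval, St.move, St.sub, St.push, St.drop, St.top, h, h₂, h₃, h₄, abs_of_neg]
  · refine ⟨_, rfl, ⟨lp, ?_⟩, ?_, ?_⟩ <;> simp [eval, h, h₂, h₃, h₄, abs_of_nonneg (not_lt.1 h)]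

theorem trim_cons (b : Bool) (l : List Bool) :
    trim (b :: l) = if trim l = [] ∧ b = false then [] else b :: trim l := by
  rw [trim, trim, List.reverse_cons, List.dropWhile_append]
  cases h : l.reverse.dropWhile fun b => !b <;> cases b <;> simp

theorem trim_bits (n : ℕ) : ∀ m : ℕ, m < 2 ^ n → trim (bits n m) = m.bits := by
  induction n with
  | zero =>
    intro m hm
    obtain rfl : m = 0 := by simpa using hm
    rfl
  | succ n ih =>
    intro m hm
    have h₁ := ih (m / 2) (by rw [pow_succ] at hm; omega)
    have h₄ : ((m : ℤ) % 2 = 1) ↔ m % 2 = 1 := by omega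
    have h₅ : (m : ℤ) / 2 = (m / 2 : ℕ) := by omega
    rw [bits, trim_cons, h₅, h₁, decide_eq_decide.2 h₄]
    have h₃ : Nat.bit (decide (m % 2 = 1)) (m / 2) = m := by
      rw [Nat.bit_val]
      rcases Nat.mod_two_eq_zero_or_one m with h | h <;> simp [h] <;> omega
    by_cases h : m / 2 = 0 ∧ m % 2 = 0
    · obtain rfl : m = 0 := by omega
      simp
    · have h₂ := Nat.bits_append_bit (m / 2) (m % 2 = 1) (by simp; omega)
      rw [h₃] at h₂
      rw [h₂, if_neg]
      rintro ⟨h', h''⟩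
      refine h ⟨?_, by simp at h''; omega⟩
      rw [← Nat.size_eq_zero, ← Nat.size_eq_bits_len, h', List.length_nil]

/-- The symbol `a` below the digits stops the removal of zeros even if all digits vanish. It is the
sign in the case of the numerator and the separator in the case of the denominator. -/
theorem iterate_pop_trim (l : List Bool) (a : InputSymbol) (l' : List InputSymbol)
    (ha : a ≠ .bit false) : ∀ (n : ℕ) (σ : St WReg SReg), l.length ≤ n →
    σ.sym .outq = l.map .bit ++ a :: l' →
    ((pop .outq fun o => if o = some (.bit false) then skip else o.elim skip (push .outq)).eval L)^[n] σ =
      σ.setSym .outq ((l.dropWhile fun b => !b).map .bit ++ a :: l') := by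
  have hfix : ∀ (a : InputSymbol) (l' : List InputSymbol) (n : ℕ) (σ : St WReg SReg),
      a ≠ .bit false → σ.sym .outq = a :: l' →
      ((pop .outq fun o => if o = some (.bit false) then skip else o.elim skip (push .outq)).eval L)^[n] σ
        = σ.setSym .outq (a :: l') := by
    intro a l' n σ ha h
    have : σ.setSym .outq (a :: l') = σ := by
      rw [St.setSym, ← h, update_eq_self]
    rw [this]
    refine iterate_fixed ?_ n
    rw [eval, h]
    simpa [ha, eval, St.setSym, h] using this
  induction l with
  | nil => exact fun n σ _ h => hfix a l' n σ ha h
  | cons b l ih =>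
    intro n σ hn h
    cases b with
    | true => exact hfix _ _ n σ (by simp) h
    | false =>
      obtain ⟨n, rfl⟩ : ∃ k, n = k + 1 := ⟨n - 1, by simp at hn; omega⟩
      rw [iterate_succ_apply, ih n _ (by simpa using hn) (by simp [eval, h])]
      simp [eval, h, St.setSym]

theorem eval_writeNat {r : WReg} {m : ℕ} {lm : List ℤ} {a : InputSymbol} {l : List InputSymbol}
    (hr : σ.word r = (m : ℤ) :: lm) (hm : m < 2 ^ L ^ 3) (ho : σ.sym .outq = a :: l)
    (ha : a ≠ .bit false) : ∃ τ, (writeNat r).eval L σ = τ ∧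
      (∀ r' ≠ r, τ.word r' = σ.word r') ∧
      τ.sym .outq = (m.bits.map .bit).reverse ++ σ.sym .outq := by
  rw [writeNat, eval_seq, eval_seq]
  have h := iterate_pop_push (L := L) (q := .numBits) (q' := .outq) (by simp)
    ((bits (L ^ 3) m).map .bit) ((toBits r .numBits).eval L σ) (σ.sym .numBits)
    (by simp [eval, St.toBits, St.top, hr])
  rw [List.length_map, length_bits] at h
  rw [eval_cube, eval_cube, h, iterate_pop_trim (bits (L ^ 3) m).reverse a l ha _ _ (by simp)
    (by simp [eval, St.toBits, St.drop, ho])]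
  refine ⟨_, rfl, ?_, ?_⟩
  · intro r' hr'
    simp [eval, St.toBits, St.drop, hr']
  · rw [← trim_bits _ m hm, trim, ho]
    simp

end

end Prog

end LoopProgram

/-! ### Size bounds and correctness of the whole program -/

namespace LoopProgram

open Function

namespace Prog

theorem one_le_weightedSum_snd (f : ℕ → ℤ) (n : ℕ) : 1 ≤ (weightedSum f n).2 := by
  induction n with
  | zero => simp [weightedSum]
  | succ n ih =>
    rw [weightedSum]
    have h₁ : (1 : ℤ) ≤ (n + 1) * 2 ^ (n + 1) := by
      have : (1 : ℤ) ≤ 2 ^ (n + 1) := one_le_pow₀ (by norm_num)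
      nlinarith
    exact one_le_mul_of_one_le_of_one_le ih h₁

/-- Each of the n factors (k+1) 2^(k+1) is at most 2^L * 2^L. -/
theorem weightedSum_snd_le (f : ℕ → ℤ) {n L : ℕ} (h : n ≤ L) :
    (weightedSum f n).2 ≤ 2 ^ (2 * L * n) := by
  induction n with
  | zero => simp [weightedSum]
  | succ n ih =>
    have h₁ : ((n : ℤ) + 1) ≤ 2 ^ L := by
      have := Nat.lt_two_pow_self (n := L)
      have h' : n + 1 ≤ 2 ^ L := by omega
      exact_mod_cast h'
    have h₂ : (2 : ℤ) ^ (n + 1) ≤ 2 ^ L := pow_le_pow_right₀ (by norm_num) h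
    calc (weightedSum f (n + 1)).2 = (weightedSum f n).2 * ((n + 1) * 2 ^ (n + 1)) := rfl
      _ ≤ 2 ^ (2 * L * n) * (2 ^ L * 2 ^ L) := by gcongr; exact ih (by omega)
      _ = 2 ^ (2 * L * (n + 1)) := by ring

/-- The weights 1 / ((k+1) 2^(k+1)) are at most 1, so the fraction is at most n * B in absolute
value. -/
theorem abs_weightedSum_fst_le {f : ℕ → ℤ} {B : ℤ} (hf : ∀ k, |f k| ≤ B) (n : ℕ) :
    |(weightedSum f n).1| ≤ n * B * (weightedSum f n).2 := by
  have hB : 0 ≤ B := (abs_nonneg _).trans (hf 0)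
  induction n with
  | zero => simp [weightedSum]
  | succ n ih =>
    have h₀ := one_le_weightedSum_snd f n
    have h₁ : (1 : ℤ) ≤ (n + 1) * 2 ^ (n + 1) := by
      have : (1 : ℤ) ≤ 2 ^ (n + 1) := one_le_pow₀ (by norm_num)
      nlinarith
    simp only [weightedSum]
    generalize ((n : ℤ) + 1) * 2 ^ (n + 1) = w at h₁
    generalize weightedSum f n = x at *
    calc |x.1 * w + f n * x.2| ≤ |x.1| * w + |f n| * x.2 := by
          refine (abs_add_le _ _).trans_eq ?_
          rw [abs_mul, abs_mul, abs_of_nonneg (by linarith : 0 ≤ w),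
            abs_of_nonneg (by linarith : 0 ≤ x.2)]
      _ ≤ n * B * x.2 * w + B * x.2 * w := by
          refine add_le_add (by gcongr) ?_
          calc |f n| * x.2 ≤ B * x.2 := by gcongr; exact hf n
            _ ≤ B * x.2 * w := le_mul_of_one_le_right (by positivity) h₁
      _ = (n + 1 : ℕ) * B * (x.2 * w) := by push_cast; ring

theorem abs_digit_le {L : ℕ} (hL : 0 < L) (z : ℤ) (k : ℕ) :
    |digit L (2 ^ (L - 1)) z k| ≤ 2 ^ L := by
  have h₁ := Int.emod_nonneg (z / 2 ^ (L * k)) (b := 2 ^ L) (by positivity)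
  have h₂ := Int.emod_lt_of_pos (z / 2 ^ (L * k)) (b := 2 ^ L) (by positivity)
  have h₃ : (2 : ℤ) ^ L = 2 ^ (L - 1) * 2 := by rw [← pow_succ, Nat.sub_add_cancel hL]
  rw [digit, abs_le]
  constructor <;> linarith

/-- The final fraction has to fit into words of L^3 digits, with one digit of the numerator reserved
for the sign. -/
theorem weightedSum_digit_lt {L : ℕ} (hL : 3 ≤ L) (z : ℤ) :
    |(weightedSum (digit L (2 ^ (L - 1)) z) L).1| < 2 ^ (L ^ 3 - 1) ∧
      (weightedSum (digit L (2 ^ (L - 1)) z) L).2 < 2 ^ L ^ 3 := by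
  have h₁ := abs_weightedSum_fst_le (abs_digit_le (by omega : 0 < L) z) L
  have h₂ := weightedSum_snd_le (digit L (2 ^ (L - 1)) z) (le_refl L)
  -- This is where L ≥ 3 is needed: 2L^2 + 2L + 1 ≤ L^3 fails for L = 2.
  have h₃ : 2 * L * L + 2 * L ≤ L ^ 3 - 1 := by
    refine Nat.le_sub_of_add_le ?_
    nlinarith [Nat.mul_le_mul hL hL, Nat.mul_le_mul_right (L * L) hL]
  have h₄ : (L : ℤ) < 2 ^ L := by exact_mod_cast Nat.lt_two_pow_self
  constructor
  · calc _ ≤ _ := h₁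
      _ ≤ L * 2 ^ L * 2 ^ (2 * L * L) := by gcongr
      _ < 2 ^ L * 2 ^ L * 2 ^ (2 * L * L) := by gcongr
      _ = 2 ^ (2 * L * L + 2 * L) := by ring
      _ ≤ _ := pow_le_pow_right₀ (by norm_num) h₃
  · exact h₂.trans_lt (pow_lt_pow_right₀ (by norm_num) (by omega))

/-- The symbol of the output alphabet that a symbol stands for. -/
def outputSymbol : InputSymbol → Option Bool
  | .bit b => some b
  | .constGate b => some b
  | _ => none

/-- The numerator and denominator that the program computes, where `a` and `a'` are the values of the
output gate. -/
def shapPair (L : ℕ) (a a' : ℤ) : ℤ × ℤ :=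
  weightedSum (digit L (2 ^ (L - 1)) (a - a' + offset (2 ^ (L - 1)) (2 ^ L) L)) L

theorem eval_shap {L : ℕ} {σ : St WReg SReg} {ps : List (Bool × Bool)} {ds : List GateDesc} (hL : 3 ≤ L)
    (hds : ∀ d ∈ ds, d.row.length = ps.length + ds.length ∧ ∀ b, d.kind ≠ .bit b)
    (hw : σ.word = fun _ => []) (hs : ∀ q ≠ .store, σ.sym q = [])
    (hi : σ.sym .store = (encodeEntity ps ++ .endEntity :: ds.flatMap GateDesc.encode).reverse)
    (hlen : (encodeEntity ps ++ .endEntity :: ds.flatMap GateDesc.encode).length ≤ L) {a a' : ℤ}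
    (ha : IsOutputValue L ds (ps.map (leafValue (2 ^ L) true)) a)
    (ha' : IsOutputValue L ds (ps.map (leafValue (2 ^ L) false)) a') :
    ((shap.eval L σ).sym .outq).reverse.map outputSymbol =
      encodeFraction ((shapPair L a a').1, (shapPair L a a').2.toNat) := by
  have hpos : 0 < L := by omega
  obtain ⟨τ₁, e₁, h₁, hl, hb, ⟨lh, hh⟩, hd, ho⟩ := eval_readInput hpos (fun d h => (hds d h).2) hw hs hi
    hlen
  have hps : ps.length ≤ (encodeEntity ps).length := by
    rw [encodeEntity, List.length_flatMap]
    simp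
    omega
  simp only [List.length_append, List.length_cons] at hlen
  have h₂ := eval_readDigits (L := L) (by simpa using hds) (by simp; omega) (by simp) (by simp)
    (by omega) hpos ha ha' h₁ hl hb hh
  rw [shap, eval_seq, e₁, eval_seq]
  generalize readDigits.eval L τ₁ = τ₂ at h₂
  obtain ⟨d₂, h₂, o₂⟩ := h₂
  rw [hd, List.append_nil] at d₂
  obtain ⟨τ₃, e₃, ⟨lp, h₃⟩, ⟨lq, h₃'⟩, o₃⟩ := eval_integrate h₂ d₂
  obtain ⟨hp, hq⟩ := weightedSum_digit_lt hL (a - a' + offset (2 ^ (L - 1)) (2 ^ L) L)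
  have hq' := one_le_weightedSum_snd
    (digit L (2 ^ (L - 1)) (a - a' + offset (2 ^ (L - 1)) (2 ^ L) L)) L
  obtain ⟨τ₄, e₄, ⟨lp', h₄⟩, h₄', o₄⟩ := eval_writeSign h₃ hpos hp
  change _ < (2 : ℤ) ^ (L ^ 3 - 1) at hp
  rw [← shapPair] at *
  generalize shapPair L a a' = x at *
  obtain ⟨p, q⟩ := x
  dsimp only at *
  lift q to ℕ using by omega
  rw [Int.abs_eq_natAbs] at h₄ hp
  have hp' : p.natAbs < 2 ^ L ^ 3 := by
    refine lt_of_lt_of_le ?_ (Nat.pow_le_pow_right (by norm_num) (Nat.sub_le _ 1))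
    exact_mod_cast hp
  obtain ⟨τ₅, e₅, h₅, o₅⟩ := eval_writeNat (L := L) h₄ hp' o₄ (by simp)
  have o₆ : ((push .outq .endEntity).eval L τ₅).sym .outq = .endEntity :: τ₅.sym .outq := by
    simp [eval]
  obtain ⟨τ₇, e₇, -, o₇⟩ := eval_writeNat (L := L) (r := .den) (m := q) (lm := lq)
    (σ := (push .outq .endEntity).eval L τ₅) (by rw [← h₃', ← h₄', ← h₅ _ (by simp)]; rfl)
    (by exact_mod_cast hq) o₆ (by simp)
  rw [eval_seq, e₃, eval_seq, e₄, eval_seq, e₅, eval_seq, e₇, o₇, o₆, o₅, o₄, o₃, o₂, ho]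
  simp [encodeFraction, outputSymbol, Function.comp_def]

/-- The functions computed by the program are computable in polynomial time. -/
theorem nonempty_tm2ComputableInPolyTime_shap {α : Type} (ps : α → List (Bool × Bool))
    (ds : α → List GateDesc) (ea : α → List InputSymbol) (f : α → ℤ × ℕ)
    (hea : ∀ i, ea i = encodeEntity (ps i) ++ .endEntity :: (ds i).flatMap GateDesc.encode)
    (hds : ∀ i, ∀ d ∈ ds i, d.row.length = (ps i).length + (ds i).length ∧ ∀ b, d.kind ≠ .bit b)
    (hL : ∀ i, 3 ≤ (ea i).length)
    (h : ∀ i, ∃ a a', IsOutputValue (ea i).length (ds i)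
        ((ps i).map (leafValue (2 ^ (ea i).length) true)) a ∧
      IsOutputValue (ea i).length (ds i) ((ps i).map (leafValue (2 ^ (ea i).length) false)) a' ∧
      f i = ((shapPair (ea i).length a a').1, (shapPair (ea i).length a a').2.toNat)) :
    Nonempty (Turing.TM2ComputableInPolyTime ea encodeFraction f) := by
  obtain ⟨c, hc⟩ := realizable_eval shap
  have : Fintype SReg := Fintype.ofFinite _
  refine nonempty_tm2ComputableInPolyTime c (.sym .store) (.sym .outq) outputSymbol fun i => ?_
  obtain ⟨a, a', ha, ha', hf⟩ := h i
  let σ : St WReg SReg := ⟨fun _ => [], update (fun _ => []) .store (ea i).reverse⟩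
  have hσ : update (fun _ => []) (.sym .store) (ea i).reverse = enc (ea i).length σ := by
    funext k
    cases k with
    | sym q =>
      by_cases hq : q = .store
      · subst hq; simp [enc, σ]
      · simp [enc, σ, hq]
    | _ => simp [enc, σ, encWords]
  rw [hσ, hc _ (by have := hL i; omega), hf]
  exact eval_shap (hL i) (hds i) rfl (fun q hq => by simp [σ, hq])
    (by simp [σ, hea]) (by rw [← hea]) ha ha'

end Prog

end LoopProgram

/-! ### Product weights on entities and independence -/

section ProductWeight

variable {X : Type} [Fintype X] {R : Type} [CommRing R]

/-- The weight of an entity if the features are independent, where `w y` is the weight of the value `1`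
of the feature `y`. -/
def entityWeight (w : X → R) (e : X → Bool) : R := ∏ y, if e y then w y else 1 - w y

/-- The sum of a function on the entities with respect to a product weight. -/
def weightedCount [DecidableEq X] (w : X → R) (f : (X → Bool) → R) : R := ∑ e, f e * entityWeight w e

theorem map_entityWeight {R' : Type} [CommRing R'] (φ : R →+* R') (w : X → R) (e : X → Bool) :
    φ (entityWeight w e) = entityWeight (fun y => φ (w y)) e := by
  rw [entityWeight, map_prod]
  refine Finset.prod_congr rfl fun y _ => ?_
  cases e y <;> simp

variable [DecidableEq X]

/-- Expand ∏ (w y + (1 - w y)) = 1. Weights need not be nonnegative, so w may be any ring element.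
-/
theorem weightedCount_one (w : X → R) : weightedCount w (fun _ => 1) = 1 := by
  have := Finset.prod_univ_sum (fun _ : X => (Finset.univ : Finset Bool))
    (fun y b => if b then w y else 1 - w y)
  simp only [Fintype.sum_bool, Bool.false_eq_true, if_true, if_false, add_sub_cancel,
    Finset.prod_const_one, Fintype.piFinset_univ] at this
  simp [weightedCount, entityWeight, ← this]

theorem weightedCount_sub (w : X → R) (f g : (X → Bool) → R) :
    weightedCount w (fun e => f e - g e) = weightedCount w f - weightedCount w g := by
  simp [weightedCount, sub_mul]

theorem weightedCount_sum {ι : Type} (w : X → R) (s : Finset ι) (f : ι → (X → Bool) → R) :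
    weightedCount w (fun e => ∑ i ∈ s, f i e) = ∑ i ∈ s, weightedCount w (f i) := by
  simp only [weightedCount, Finset.sum_mul]
  exact Finset.sum_comm

/-- Functions of disjoint sets of features are independent. -/
theorem weightedCount_mul (w : X → R) {f g : (X → Bool) → R} {S T : Set X} (hf : DependsOn f S)
    (hg : DependsOn g T) (h : Disjoint S T) :
    weightedCount w (fun e => f e * g e) = weightedCount w f * weightedCount w g := by
  classical
  -- Two entities exchange their values outside `S`. This involution preserves the product of their
  -- weights and turns the independent pair in f(p.1) g(p.2) into a single entity, since f sees only
  -- `S` and g only its complement.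
  let mix : (X → Bool) × (X → Bool) → (X → Bool) × (X → Bool) := fun p =>
    (fun y => if y ∈ S then p.1 y else p.2 y, fun y => if y ∈ S then p.2 y else p.1 y)
  have hmix : Function.Involutive mix := by
    intro p
    ext y <;> by_cases hy : y ∈ S <;> simp [mix, hy]
  have hw : ∀ p, entityWeight w (mix p).1 * entityWeight w (mix p).2 =
      entityWeight w p.1 * entityWeight w p.2 := by
    intro p
    simp only [entityWeight, ← Finset.prod_mul_distrib]
    refine Finset.prod_congr rfl fun y _ => ?_
    by_cases hy : y ∈ S <;> simp [mix, hy, mul_comm]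
  have h₁ : weightedCount w f * weightedCount w g =
      ∑ p : (X → Bool) × (X → Bool), f p.1 * g p.2 * (entityWeight w p.1 * entityWeight w p.2) := by
    rw [weightedCount, weightedCount, Finset.sum_mul_sum, Fintype.sum_prod_type]
    exact Finset.sum_congr rfl fun _ _ => Finset.sum_congr rfl fun _ _ => by ring
  have h₂ : weightedCount w (fun e => f e * g e) = ∑ p : (X → Bool) × (X → Bool),
      f p.1 * g p.1 * (entityWeight w p.1 * entityWeight w p.2) := by
    rw [← mul_one (weightedCount w _), ← weightedCount_one w, weightedCount, weightedCount,
      Finset.sum_mul_sum, Fintype.sum_prod_type]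
    exact Finset.sum_congr rfl fun _ _ => Finset.sum_congr rfl fun _ _ => by ring
  rw [h₁, h₂, ← Equiv.sum_comp hmix.toPerm]
  refine Finset.sum_congr rfl fun p _ => ?_
  rw [Function.Involutive.coe_toPerm, hw,
    hf (x := (mix p).1) (y := p.1) (by intro y hy; simp [mix, hy]),
    hg (x := (mix p).1) (y := p.2) (by
      intro y hy
      have : y ∉ S := fun h' => Set.disjoint_left.1 h h' hy
      simp [mix, this])]

theorem weightedCount_prod {ι : Type} (w : X → R) (s : Finset ι) (f : ι → (X → Bool) → R)
    (S : ι → Set X) (hf : ∀ i ∈ s, DependsOn (f i) (S i))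
    (hS : ∀ i ∈ s, ∀ j ∈ s, i ≠ j → Disjoint (S i) (S j)) :
    weightedCount w (fun e => ∏ i ∈ s, f i e) = ∏ i ∈ s, weightedCount w (f i) := by
  classical
  induction s using Finset.induction_on with
  | empty => simpa using weightedCount_one w
  | insert a s ha ih =>
    simp only [Finset.prod_insert ha]
    rw [← ih (fun i hi => hf i (by simp [hi])) (fun i hi j hj => hS i (by simp [hi]) j (by simp [hj]))]
    refine weightedCount_mul w (hf a (by simp)) (T := ⋃ i ∈ s, S i) ?_ ?_
    · intro e e' h
      refine Finset.prod_congr rfl fun i hi => hf i (by simp [hi]) fun y hy => h y ?_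
      simp only [Set.mem_iUnion]
      exact ⟨i, hi, hy⟩
    · simp only [Set.disjoint_iUnion_right]
      exact fun i hi => hS a (by simp) i (by simp [hi]) (by rintro rfl; exact ha hi)

theorem weightedCount_apply (w : X → R) (y : X) :
    weightedCount w (fun e => if e y then 1 else 0) = w y := by
  -- Expand the product with the weight of the value 0 at `y` replaced by 0: this keeps exactly the
  -- entities with value 1 at `y`.
  have := Finset.prod_univ_sum (fun _ : X => (Finset.univ : Finset Bool))
    (fun y' b => if b then w y' else if y' = y then 0 else 1 - w y')
  simp only [Fintype.sum_bool, Bool.false_eq_true, if_true, if_false, Fintype.piFinset_univ] at this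
  have h₁ : ∏ y', (w y' + if y' = y then 0 else 1 - w y') = w y := by
    rw [Finset.prod_eq_single y]
    · simp
    · intro y' _ h; simp [h]
    · simp
  rw [h₁] at this
  rw [this, weightedCount]
  refine Finset.sum_congr rfl fun e _ => ?_
  cases h : e y
  · rw [Finset.prod_eq_zero (Finset.mem_univ y) (by simp [h])]
    simp
  · simp only [if_true, one_mul, entityWeight]
    refine Finset.prod_congr rfl fun y' _ => ?_
    by_cases h' : y' = y
    · subst h'; simp [h]
    · simp [h']

end ProductWeight

/-! ### Weighted model counting on deterministic and decomposable circuits -/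

namespace BoolCircuit

variable {X : Type} (C : BoolCircuit X)

theorem dependsOn_eval (g : Fin C.size) : DependsOn (fun e => C.eval e g) (C.vars g) := by
  induction g using C.wire_wellFounded.induction with
  | _ g ih =>
    intro e e' h
    have hin : ∀ i ∈ C.inputs g, C.eval e i = C.eval e' i := fun i hi =>
      ih i hi fun y ⟨h', hr, hl⟩ => h y ⟨h', hr.tail hi, hl⟩
    show C.eval e g = C.eval e' g
    rw [eval_eq, eval_eq]
    cases hl : C.label g with
    | var x => exact h x ⟨g, .refl, hl⟩
    | const b => rfl
    | and => exact decide_eq_decide.2 (forall₂_congr fun i hi => by rw [hin i hi])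
    | or => exact decide_eq_decide.2 (exists_congr fun i => and_congr_right fun hi => by rw [hin i hi])
    | not => exact decide_eq_decide.2 (exists_congr fun i => and_congr_right fun hi => by rw [hin i hi])

variable [Fintype X] [DecidableEq X] {R : Type} [CommRing R]

/-- The weighted model count of a gate. -/
noncomputable def modelCount (w : X → R) (g : Fin C.size) : R :=
  weightedCount w fun e => if C.eval e g then 1 else 0

variable {C} {w : X → R} {g : Fin C.size}

theorem modelCount_var {x : X} (h : C.label g = .var x) : C.modelCount w g = w x := by
  rw [modelCount, ← weightedCount_apply w x]
  congr 1
  funext e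
  rw [eval_eq, h]

theorem modelCount_const {b : Bool} (h : C.label g = .const b) :
    C.modelCount w g = if b then 1 else 0 := by
  have : ∀ e, C.eval e g = b := fun e => by rw [eval_eq, h]
  simp only [modelCount, this]
  cases b
  · simp [weightedCount]
  · exact weightedCount_one w

/-- Decomposability makes the inputs functions of disjoint sets of variables, hence independent for
a product weight. -/
theorem modelCount_and (hC : C.Decomposable) (h : C.label g = .and) :
    C.modelCount w g = ∏ i ∈ C.inputs g, C.modelCount w i := by
  simp only [modelCount]
  rw [← weightedCount_prod w (C.inputs g) (fun i e => if C.eval e i then 1 else 0) C.vars]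
  · congr 1
    funext e
    rw [eval_eq, h, Finset.prod_boole]
    simp
  · intro i _ e e' he
    have : C.eval e i = C.eval e' i := C.dependsOn_eval i he
    simp only [this]
  · exact hC g h

/-- By determinism at most one input is true, so the indicator of the disjunction is the sum of the
indicators. -/
theorem modelCount_or (hC : C.Deterministic) (h : C.label g = .or) :
    C.modelCount w g = ∑ i ∈ C.inputs g, C.modelCount w i := by
  simp only [modelCount]
  rw [← weightedCount_sum]
  congr 1
  funext e
  rw [eval_eq, h]
  by_cases h' : ∃ i ∈ C.inputs g, C.eval e i = true
  · obtain ⟨i, hi, hi'⟩ := h'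
    rw [if_pos (decide_eq_true ⟨i, hi, hi'⟩), Finset.sum_eq_single i, if_pos hi']
    · intro j hj hij
      exact if_neg fun hj' => hC g h j hj i hi hij ⟨e, hj', hi'⟩
    · exact fun h => absurd hi h
  · rw [if_neg (by simpa using h')]
    exact (Finset.sum_eq_zero fun i hi => if_neg fun hi' => h' ⟨i, hi, hi'⟩).symm

/-- The total weight is 1. The sum over the inputs has a single term; in this form the rule uses the
same row sum as an ∨-gate. -/
theorem modelCount_not (h : C.label g = .not) :
    C.modelCount w g = 1 - ∑ i ∈ C.inputs g, C.modelCount w i := by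
  obtain ⟨i, hi⟩ := Finset.card_eq_one.1 (C.not_fanin g h)
  have := weightedCount_sub w (fun _ => 1) fun e => if C.eval e i then 1 else 0
  rw [weightedCount_one] at this
  rw [hi, Finset.sum_singleton, modelCount, modelCount, ← this]
  congr 1
  funext e
  rw [eval_eq, h, hi]
  by_cases h : C.eval e i = true <;> simp [h]

/-- Counting commutes with evaluation at V = 2^L, so integer arithmetic yields the value of the
polynomial count. -/
theorem map_modelCount {R' : Type} [CommRing R'] (φ : R →+* R') :
    φ (C.modelCount w g) = C.modelCount (fun y => φ (w y)) g := by
  rw [modelCount, weightedCount, map_sum]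
  refine Finset.sum_congr rfl fun e _ => ?_
  rw [map_mul, map_entityWeight]
  by_cases h : C.eval e g = true <;> simp [h]

end BoolCircuit

/-! ### The beta integral over [0, 1/2] -/

section Integral

open Polynomial

/-- The integral of a polynomial over the interval from zero to one half. -/
noncomputable def halfIntegral : ℤ[X] →ₗ[ℤ] ℚ :=
  lsum fun k => LinearMap.toSpanSingleton ℤ ℚ (1 / ((k + 1) * 2 ^ (k + 1)))

theorem halfIntegral_eq_sum {p : ℤ[X]} {n : ℕ} (h : p.natDegree < n) :
    halfIntegral p = ∑ k ∈ Finset.range n, (p.coeff k : ℚ) / ((k + 1) * 2 ^ (k + 1)) := by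
  rw [halfIntegral, lsum_apply, sum_over_range' p _ n h]
  · refine Finset.sum_congr rfl fun k _ => ?_
    simp [div_eq_mul_inv]
  · simp

theorem halfIntegral_X_pow (k : ℕ) : halfIntegral (X ^ k) = 1 / ((k + 1) * 2 ^ (k + 1)) := by
  rw [← monomial_one_right_eq_X_pow, halfIntegral, lsum_apply, sum_monomial_index _ _ (by simp)]
  simp

/-- Splitting off one factor 1 - 2X lowers s at the cost of a term with j + 1, and both sides
satisfy this recursion; so no analysis is needed. -/
theorem halfIntegral_beta (s j : ℕ) : halfIntegral ((1 - 2 * X) ^ s * X ^ j) =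
    (s.factorial * j.factorial : ℚ) / ((s + j + 1).factorial * 2 ^ (j + 1)) := by
  induction s generalizing j with
  | zero =>
    rw [pow_zero, one_mul, halfIntegral_X_pow, zero_add, Nat.factorial_succ, Nat.factorial_zero]
    have := Nat.factorial_ne_zero j
    push_cast
    field_simp
  | succ s ih =>
    have e : ((1 : ℤ[X]) - 2 * X) ^ (s + 1) * X ^ j =
        (1 - 2 * X) ^ s * X ^ j - (2 : ℤ) • ((1 - 2 * X) ^ s * X ^ (j + 1)) := by
      rw [zsmul_eq_mul]; push_cast; ring
    have e₁ : s + 1 + j + 1 = (s + j + 1) + 1 := by ring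
    have e₂ : s + (j + 1) + 1 = (s + j + 1) + 1 := by ring
    rw [e, map_sub, map_zsmul, ih, ih, e₁, e₂, Nat.factorial_succ (s + j + 1), Nat.factorial_succ s,
      Nat.factorial_succ j, zsmul_eq_mul]
    have h := Nat.factorial_ne_zero (s + j + 1)
    push_cast
    field_simp
    ring

end Integral

/-! ### The SHAP-score as an integral -/

section Shap

variable {X : Type} [DecidableEq X]

/-- The weights for which each feature `y ≠ x` agrees with the entity with weight `1 - V`, and the
feature `x` agrees with the entity if `c` is true, and disagrees otherwise. -/
def agreementWeight {R : Type} [CommRing R] (V : R) (e : X → Bool) (x : X) (c : Bool) (y : X) : R :=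
  if y = x then (if e y = c then 1 else 0) else if e y then 1 - V else V

theorem map_agreementWeight {R R' : Type} [CommRing R] [CommRing R'] (φ : R →+* R') (V : R)
    (e : X → Bool) (x : X) (c : Bool) (y : X) :
    φ (agreementWeight V e x c y) = agreementWeight (φ V) e x c y := by
  simp only [agreementWeight]
  split_ifs <;> simp

variable [Fintype X]

/-- The number of positive entities that agree with `e` on `S` and agree, or disagree, on `x`. -/
def agreementCount (M : (X → Bool) → Bool) (e : X → Bool) (x : X) (c : Bool) (S : Finset X) : ℕ :=
  (Finset.univ.filter fun e' => (decide (e' x = e x) = c ∧ ∀ y ∈ S, e' y = e y) ∧ M e' = true).card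

/-- A feature other than x contributes 1 - V = (1 - 2V) + V if it agrees and V = 0 + V otherwise. In
the expanded product, S collects the features that take the first summand, and its term vanishes
unless all of S agrees. -/
theorem entityWeight_agreementWeight {R : Type} [CommRing R] (V : R) (e : X → Bool) (x : X) (c : Bool)
    (e' : X → Bool) : entityWeight (agreementWeight V e x c) e' =
      ∑ S ∈ (Finset.univ.erase x).powerset,
        if decide (e' x = e x) = c ∧ ∀ y ∈ S, e' y = e y then
          (1 - 2 * V) ^ S.card * V ^ (Fintype.card X - 1 - S.card) else 0 := by
  have h₁ : ∏ y ∈ Finset.univ.erase x,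
      (if e' y then agreementWeight V e x c y else 1 - agreementWeight V e x c y) =
        ∏ y ∈ Finset.univ.erase x, ((if e' y = e y then 1 - 2 * V else 0) + V) := by
    refine Finset.prod_congr rfl fun y hy => ?_
    rw [agreementWeight, if_neg (Finset.ne_of_mem_erase hy)]
    cases e y <;> cases e' y <;> simp <;> ring
  have h₂ : (if e' x then agreementWeight V e x c x else 1 - agreementWeight V e x c x) =
      if decide (e' x = e x) = c then 1 else 0 := by
    rw [agreementWeight, if_pos rfl]
    cases e x <;> cases e' x <;> cases c <;> simp
  rw [entityWeight, ← Finset.mul_prod_erase _ _ (Finset.mem_univ x), h₁, h₂, Finset.prod_add,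
    Finset.mul_sum]
  refine Finset.sum_congr rfl fun S hS => ?_
  rw [Finset.prod_const, Finset.card_sdiff_of_subset (Finset.mem_powerset.1 hS),
    Finset.card_erase_of_mem (Finset.mem_univ x), Finset.card_univ]
  by_cases h : ∀ y ∈ S, e' y = e y
  · rw [Finset.prod_congr rfl fun y hy => if_pos (h y hy), Finset.prod_const]
    by_cases h' : decide (e' x = e x) = c
    · rw [if_pos h', if_pos ⟨h', h⟩, one_mul]
    · rw [if_neg h', if_neg fun h => h' h.1, zero_mul]
  · have h' : ¬(decide (e' x = e x) = c ∧ ∀ y ∈ S, e' y = e y) := fun h' => h h'.2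
    push Not at h
    obtain ⟨y, hy, h⟩ := h
    rw [if_neg h', Finset.prod_eq_zero hy (if_neg h), zero_mul, mul_zero]

theorem weightedCount_agreementWeight {R : Type} [CommRing R] (M : (X → Bool) → Bool) (V : R)
    (e : X → Bool) (x : X) (c : Bool) :
    weightedCount (agreementWeight V e x c) (fun e' => if M e' then 1 else 0) =
      ∑ S ∈ (Finset.univ.erase x).powerset, (agreementCount M e x c S : R) *
        ((1 - 2 * V) ^ S.card * V ^ (Fintype.card X - 1 - S.card)) := by
  simp only [weightedCount, entityWeight_agreementWeight, Finset.mul_sum]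
  rw [Finset.sum_comm]
  refine Finset.sum_congr rfl fun S _ => ?_
  rw [agreementCount, ← nsmul_eq_mul, ← Finset.sum_const, Finset.sum_filter]
  refine Finset.sum_congr rfl fun e' _ => ?_
  by_cases h : M e' = true <;> simp [h]

theorem card_consistentWith (e : X → Bool) (S : Finset X) :
    (consistentWith e S).card = 2 ^ (Fintype.card X - S.card) := by
  have : consistentWith e S = Fintype.piFinset fun y => if y ∈ S then {e y} else Finset.univ := by
    ext e'
    simp only [consistentWith, Finset.mem_filter, Finset.mem_univ, true_and, Fintype.mem_piFinset]
    refine forall_congr' fun y => ?_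
    by_cases h : y ∈ S <;> simp [h]
  rw [this, Fintype.card_piFinset, ← Finset.card_compl, ← Finset.prod_const,
    ← Finset.prod_subset (Finset.subset_univ Sᶜ)]
  · refine Finset.prod_congr rfl fun y hy => ?_
    rw [if_neg (Finset.mem_compl.1 hy)]
    simp
  · intro y _ hy
    rw [if_pos (by simpa using hy)]
    simp

theorem expectedValue_eq (M : (X → Bool) → Bool) (e : X → Bool) (S : Finset X) :
    expectedValue M e S = (((consistentWith e S).filter fun e' => M e' = true).card : ℚ) /
      2 ^ (Fintype.card X - S.card) := by
  simp only [expectedValue, uniformProb, card_consistentWith, Finset.card_singleton]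
  rw [← Finset.mul_sum, Finset.sum_boole]
  push_cast
  field_simp

/-- Let a and d count the accepted entities that agree and disagree on x. Then φ(S ∪ {x}) has
numerator a over half the denominator of φ(S), whose numerator is a + d; the difference has
numerator 2a - (a + d) = a - d. -/
theorem expectedValue_sub (M : (X → Bool) → Bool) (e : X → Bool) {x : X} {S : Finset X} (hx : x ∉ S) :
    expectedValue M e (insert x S) - expectedValue M e S =
      ((agreementCount M e x true S : ℚ) - agreementCount M e x false S) /
        2 ^ (Fintype.card X - S.card) := by
  have hS : S.card + 1 ≤ Fintype.card X := by
    rw [← Finset.card_insert_of_notMem hx]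
    exact Finset.card_le_univ _
  have h₁ : ((consistentWith e (insert x S)).filter fun e' => M e' = true).card =
      agreementCount M e x true S := by
    rw [agreementCount, consistentWith, Finset.filter_filter]
    simp
  have h₂ : ((consistentWith e S).filter fun e' => M e' = true).card =
      agreementCount M e x true S + agreementCount M e x false S := by
    rw [agreementCount, agreementCount, ← Finset.card_union_of_disjoint, ← Finset.filter_or,
      consistentWith, Finset.filter_filter]
    · congr 1
      ext e'
      by_cases h : e' x = e x <;> simp [h]
    · rw [Finset.disjoint_left]
      intro e' h h'
      simp at h h'
      exact h'.1.1 h.1.1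
  have e : Fintype.card X - S.card = Fintype.card X - (S.card + 1) + 1 := by omega
  rw [expectedValue_eq, expectedValue_eq, h₁, h₂, Finset.card_insert_of_notMem hx, e, pow_succ]
  push_cast
  field_simp
  ring

/-- The SHAP-score as the integral of a polynomial. -/
theorem SHAP_eq_halfIntegral (M : (X → Bool) → Bool) (e : X → Bool) (x : X) :
    SHAP M e x = halfIntegral
      (weightedCount (agreementWeight Polynomial.X e x true) (fun e' => if M e' then 1 else 0) -
        weightedCount (agreementWeight Polynomial.X e x false) (fun e' => if M e' then 1 else 0)) := by
  rw [weightedCount_agreementWeight, weightedCount_agreementWeight, ← Finset.sum_sub_distrib, map_sum,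
    SHAP]
  refine Finset.sum_congr rfl fun S hS => ?_
  have hx : x ∉ S := fun h => Finset.notMem_erase x _ (Finset.mem_powerset.1 hS h)
  have hS : S.card + 1 ≤ Fintype.card X := by
    rw [← Finset.card_insert_of_notMem hx]
    exact Finset.card_le_univ _
  have e₁ : S.card + (Fintype.card X - 1 - S.card) + 1 = Fintype.card X := by omega
  have e₂ : Fintype.card X - 1 - S.card + 1 = Fintype.card X - S.card := by omega
  have e₃ : Fintype.card X - S.card - 1 = Fintype.card X - 1 - S.card := by omega
  have e₄ : ∀ (m n : ℕ) (p : Polynomial ℤ), (m : Polynomial ℤ) * p - n * p = ((m : ℤ) - n) • p := by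
    intro m n p
    rw [zsmul_eq_mul, ← sub_mul]
    push_cast
    rfl
  -- With s = |S| and j = n - 1 - s, the beta integral provides both the Shapley coefficient and the
  -- denominator 2^(n-s) of the conditional expectations.
  rw [e₄, map_zsmul, halfIntegral_beta, expectedValue_sub M e hx, e₁, e₂, e₃, zsmul_eq_mul]
  push_cast
  field_simp

end Shap

/-! ### Degree and coefficient bounds -/

section Bounds

open Polynomial

/-- A polynomial of degree at most `n` with coefficients of absolute value at most `B`. -/
structure CoeffBound (p : ℤ[X]) (n : ℕ) (B : ℤ) : Prop where
  natDegree_le : p.natDegree ≤ n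
  abs_coeff_le : ∀ k, |p.coeff k| ≤ B

/-- Each factor raises the degree by at most one and at most doubles the largest coefficient. -/
theorem coeffBound_prod {ι : Type} (s : Finset ι) (p : ι → ℤ[X])
    (hp : ∀ i ∈ s, p i = 0 ∨ p i = 1 ∨ p i = X ∨ p i = 1 - X) :
    CoeffBound (∏ i ∈ s, p i) s.card (2 ^ s.card) := by
  classical
  induction s using Finset.induction_on with
  | empty =>
    refine ⟨by simp, fun k => ?_⟩
    rw [Finset.prod_empty, coeff_one]
    split_ifs <;> simp
  | insert a s ha ih =>
    obtain ⟨h₁, h₂⟩ := ih fun i hi => hp i (by simp [hi])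
    rw [Finset.prod_insert ha, Finset.card_insert_of_notMem ha, mul_comm]
    generalize ∏ i ∈ s, p i = q at h₁ h₂
    have h₃ : ∀ k, |(q * X).coeff k| ≤ 2 ^ s.card := by
      intro k
      cases k with
      | zero => simp
      | succ k => rw [coeff_mul_X]; exact h₂ k
    have h₄ : (q * X).natDegree ≤ s.card + 1 :=
      natDegree_mul_le.trans (add_le_add h₁ natDegree_X_le)
    have h₅ : (2 : ℤ) ^ (s.card + 1) = 2 ^ s.card + 2 ^ s.card := by ring
    have h₆ : (0 : ℤ) ≤ 2 ^ s.card := by positivity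
    rw [h₅]
    rcases hp a (by simp) with h | h | h | h <;> rw [h]
    · rw [mul_zero]
      exact ⟨by simp, by simp⟩
    · rw [mul_one]
      exact ⟨h₁.trans (Nat.le_succ _), fun k => (h₂ k).trans (by linarith)⟩
    · exact ⟨h₄, fun k => (h₃ k).trans (by linarith)⟩
    · rw [mul_sub, mul_one]
      refine ⟨(natDegree_sub_le _ _).trans (max_le (h₁.trans (Nat.le_succ _)) h₄), fun k => ?_⟩
      rw [coeff_sub]
      exact (abs_sub _ _).trans (add_le_add (h₂ k) (h₃ k))

theorem coeffBound_sum {ι : Type} (s : Finset ι) (p : ι → ℤ[X]) {n : ℕ} {B : ℤ}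
    (hp : ∀ i ∈ s, CoeffBound (p i) n B) : CoeffBound (∑ i ∈ s, p i) n (s.card * B) := by
  refine ⟨natDegree_sum_le_of_forall_le _ _ fun i hi => (hp i hi).1, fun k => ?_⟩
  rw [finsetSum_coeff, ← nsmul_eq_mul]
  exact (Finset.abs_sum_le_sum_abs _ _).trans (Finset.sum_le_card_nsmul _ _ _ fun i hi => (hp i hi).2 k)

/-- One factor 2^n bounds the coefficients of the weight of an entity, the other is the number of
entities. -/
theorem coeffBound_weightedCount {α : Type} [Fintype α] [DecidableEq α] (M : (α → Bool) → Bool)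
    (e : α → Bool) (x : α) (c : Bool) :
    CoeffBound (weightedCount (agreementWeight X e x c) fun e' => if M e' then 1 else 0)
      (Fintype.card α) (2 ^ (2 * Fintype.card α)) := by
  have h₁ : (2 : ℤ) ^ (2 * Fintype.card α) =
      (Finset.univ : Finset (α → Bool)).card * 2 ^ Fintype.card α := by
    rw [Finset.card_univ, Fintype.card_fun, Fintype.card_bool]
    push_cast
    ring
  rw [h₁]
  refine coeffBound_sum _ _ fun e' _ => ?_
  beta_reduce
  by_cases h : M e' = true
  · rw [if_pos h, one_mul]
    refine coeffBound_prod _ _ fun y _ => ?_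
    rw [agreementWeight]
    split_ifs <;> simp
  · rw [if_neg h, zero_mul]
    exact ⟨by simp, by simp⟩

theorem CoeffBound.sub {p q : ℤ[X]} {n : ℕ} {B : ℤ} (hp : CoeffBound p n B) (hq : CoeffBound q n B) :
    CoeffBound (p - q) n (2 * B) := by
  refine ⟨(natDegree_sub_le _ _).trans (max_le hp.1 hq.1), fun k => ?_⟩
  rw [coeff_sub, two_mul]
  exact (abs_sub _ _).trans (add_le_add (hp.2 k) (hq.2 k))

end Bounds

/-! ### Recovering the coefficients from the value at 2^L -/

namespace LoopProgram.Prog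

open Polynomial

theorem offset_eq_sum (H B : ℤ) (n : ℕ) : offset H B n = ∑ k ∈ Finset.range n, H * B ^ k := by
  induction n with
  | zero => rfl
  | succ n ih =>
    rw [offset, ih, Finset.sum_range_succ', Finset.sum_mul]
    simp [pow_succ, mul_assoc]

theorem sum_ediv_emod {B : ℤ} (j : ℕ) : ∀ (n : ℕ) (d : ℕ → ℤ), (∀ k, 0 ≤ d k ∧ d k < B) → j < n →
    (∑ k ∈ Finset.range n, d k * B ^ k) / B ^ j % B = d j := by
  induction j with
  | zero =>
    intro n d hd hn
    obtain ⟨n, rfl⟩ : ∃ m, n = m + 1 := ⟨n - 1, by omega⟩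
    have : ∑ k ∈ Finset.range n, d (k + 1) * B ^ (k + 1) =
        B * ∑ k ∈ Finset.range n, d (k + 1) * B ^ k := by
      rw [Finset.mul_sum]
      exact Finset.sum_congr rfl fun _ _ => by ring
    rw [Finset.sum_range_succ', this, pow_zero, mul_one, Int.ediv_one, add_comm,
      Int.add_mul_emod_self_left, Int.emod_eq_of_lt (hd 0).1 (hd 0).2]
  | succ j ih =>
    intro n d hd hn
    obtain ⟨n, rfl⟩ : ∃ m, n = m + 1 := ⟨n - 1, by omega⟩
    have hB : 0 < B := (hd 0).1.trans_lt (hd 0).2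
    have : ∑ k ∈ Finset.range n, d (k + 1) * B ^ (k + 1) =
        B * ∑ k ∈ Finset.range n, d (k + 1) * B ^ k := by
      rw [Finset.mul_sum]
      exact Finset.sum_congr rfl fun _ _ => by ring
    rw [Finset.sum_range_succ', this, pow_zero, mul_one, pow_succ', ← Int.ediv_ediv_of_nonneg hB.le,
      add_comm, Int.add_mul_ediv_left _ _ hB.ne', Int.ediv_eq_zero_of_lt (hd 0).1 (hd 0).2, zero_add]
    exact ih n (fun k => d (k + 1)) (fun k => hd _) (by omega)

/-- The offset adds 2^(L-1) to every coefficient, which moves it into the range from 0 to 2^L - 1.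
The shifted coefficients are then the digits in base 2^L, without any borrow between them. -/
theorem digit_eval {p : ℤ[X]} {L : ℕ} (hL : 0 < L) (hp : p.natDegree < L)
    (hp' : ∀ k, |p.coeff k| < 2 ^ (L - 1)) {k : ℕ} (hk : k < L) :
    digit L (2 ^ (L - 1)) (p.eval (2 ^ L) + offset (2 ^ (L - 1)) (2 ^ L) L) k = p.coeff k := by
  have h : (2 : ℤ) ^ L = 2 ^ (L - 1) * 2 := by rw [← pow_succ, Nat.sub_add_cancel hL]
  rw [digit, offset_eq_sum, eval_eq_sum_range' hp, ← Finset.sum_add_distrib, pow_mul]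
  simp only [← add_mul]
  rw [sum_ediv_emod k L (fun k => p.coeff k + 2 ^ (L - 1)) _ hk]
  · ring
  · intro k
    have := abs_lt.1 (hp' k)
    constructor <;> linarith

theorem weightedSum_div (f : ℕ → ℤ) (n : ℕ) : ((weightedSum f n).1 : ℚ) / (weightedSum f n).2 =
    ∑ k ∈ Finset.range n, (f k : ℚ) / ((k + 1) * 2 ^ (k + 1)) := by
  induction n with
  | zero => simp [weightedSum]
  | succ n ih =>
    have h : ((weightedSum f n).2 : ℚ) ≠ 0 := by
      have := one_le_weightedSum_snd f n
      exact_mod_cast (by omega : (weightedSum f n).2 ≠ 0)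
    rw [Finset.sum_range_succ, ← ih, weightedSum]
    push_cast
    field_simp

theorem shapPair_div {p : ℤ[X]} {L : ℕ} (hL : 0 < L) (hp : p.natDegree < L)
    (hp' : ∀ k, |p.coeff k| < 2 ^ (L - 1)) {a a' : ℤ} (h : p.eval (2 ^ L) = a - a') :
    ((shapPair L a a').1 : ℚ) / (shapPair L a a').2 = halfIntegral p := by
  rw [shapPair, weightedSum_div, halfIntegral_eq_sum hp, ← h]
  refine Finset.sum_congr rfl fun k hk => ?_
  rw [digit_eval hL hp hp' (Finset.mem_range.1 hk)]

end LoopProgram.Prog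

/-! ### Rows of the adjacency matrix as sums and products -/

namespace LoopProgram.Prog

theorem rowSum_append {r r' : List Bool} {v v' : List ℤ} (h : r.length = v.length) :
    rowSum (r ++ r') (v ++ v') = rowSum r v + rowSum r' v' := by
  rw [rowSum, List.zip_append h, List.map_append, List.sum_append, rowSum, rowSum]

theorem rowProd_append {r r' : List Bool} {v v' : List ℤ} (h : r.length = v.length) :
    rowProd (r ++ r') (v ++ v') = rowProd r v * rowProd r' v' := by
  rw [rowProd, List.zip_append h, List.map_append, List.prod_append, rowProd, rowProd]

theorem zip_ofFn {α β : Type} {n : ℕ} (f : Fin n → α) (g : Fin n → β) :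
    (List.ofFn f).zip (List.ofFn g) = List.ofFn fun i => (f i, g i) := by
  refine List.ext_getElem (by simp) fun i h h' => by simp

theorem rowSum_ofFn {n : ℕ} (p : Fin n → Prop) [DecidablePred p] (v : Fin n → ℤ) :
    rowSum (List.ofFn fun i => decide (p i)) (List.ofFn v) = ∑ i with p i, v i := by
  rw [rowSum, zip_ofFn, List.map_ofFn, List.sum_ofFn, Finset.sum_filter]
  simp

theorem rowProd_ofFn {n : ℕ} (p : Fin n → Prop) [DecidablePred p] (v : Fin n → ℤ) :
    rowProd (List.ofFn fun i => decide (p i)) (List.ofFn v) = ∏ i with p i, v i := by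
  rw [rowProd, zip_ofFn, List.map_ofFn, List.prod_ofFn, Finset.prod_filter]
  simp

end LoopProgram.Prog

/-! ### Convergence of the rounds to the model counts -/

namespace BoolCircuit

open LoopProgram.Prog

/-- The number of gates from which there is a nonempty path to a gate. -/
noncomputable def rank {X : Type} (C : BoolCircuit X) (g : Fin C.size) : ℕ := by
  classical exact (Finset.univ.filter fun h => Relation.TransGen C.Wire h g).card

/-- Predecessors of h are predecessors of g, and h itself is one of g but, by acyclicity, not of h.
-/
theorem rank_lt_rank {X : Type} {C : BoolCircuit X} {h g : Fin C.size} (hg : h ∈ C.inputs g) :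
    C.rank h < C.rank g := by
  classical
  refine Finset.card_lt_card (Finset.ssubset_iff_of_subset ?_ |>.2 ⟨h, ?_, ?_⟩)
  · intro i hi
    simp only [Finset.mem_filter, Finset.mem_univ, true_and] at hi ⊢
    exact hi.tail hg
  · simpa using Relation.TransGen.single hg
  · simp only [Finset.mem_filter, Finset.mem_univ, true_and]
    exact C.acyclic h

theorem rank_lt_size {X : Type} {C : BoolCircuit X} (g : Fin C.size) : C.rank g < C.size := by
  classical
  refine (Finset.card_lt_card (Finset.ssubset_univ_iff.2 fun h => ?_)).trans_eq (by simp)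
  have : g ∈ Finset.univ.filter fun h => Relation.TransGen C.Wire h g := by rw [h]; simp
  simp only [Finset.mem_filter, Finset.mem_univ, true_and] at this
  exact C.acyclic g this

/-- The description of a gate. -/
def gateDesc {n : ℕ} (C : BoolCircuit (Fin n)) (g : Fin C.size) : GateDesc where
  kind := (C.label g).symbol
  out := decide (g = C.output)
  row := (List.ofFn fun y : Fin n => decide (C.label g = GateLabel.var y)) ++
    List.ofFn fun h : Fin C.size => decide (h ∈ C.inputs g)

variable {n : ℕ} {C : BoolCircuit (Fin n)}

theorem encode_gateDesc (g : Fin C.size) : (C.gateDesc g).encode = C.encodeGate g := by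
  simp [gateDesc, GateDesc.encode, encodeGate, List.map_ofFn, Function.comp_def]

/-- The variable part of the row selects the leaf of a variable gate and is empty for other gates,
and source gates have no inputs. Hence a variable gate and the constant 0 are row sums, the constant
1 is an empty product, and the logic gates follow the rules for the model count. -/
theorem value_gateDesc (hC : C.Deterministic) (hC' : C.Decomposable) (w : Fin n → ℤ)
    (v : Fin C.size → ℤ) (g : Fin C.size) (hv : ∀ h ∈ C.inputs g, v h = C.modelCount w h) :
    (C.gateDesc g).value (List.ofFn w ++ List.ofFn v) = C.modelCount w g := by
  have hs : ∑ h with h ∈ C.inputs g, v h = ∑ h ∈ C.inputs g, C.modelCount w h := by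
    rw [Finset.filter_mem_eq_inter, Finset.univ_inter]
    exact Finset.sum_congr rfl hv
  have hp : ∏ h with h ∈ C.inputs g, v h = ∏ h ∈ C.inputs g, C.modelCount w h := by
    rw [Finset.filter_mem_eq_inter, Finset.univ_inter]
    exact Finset.prod_congr rfl hv
  have hsource : (C.label g).IsSource → C.inputs g = ∅ := (C.source_iff g).2
  rw [GateDesc.value, gateDesc]
  dsimp only
  rw [rowSum_append (by simp), rowProd_append (by simp), rowSum_ofFn, rowProd_ofFn, rowSum_ofFn,
    rowProd_ofFn, hs, hp]
  cases h : C.label g with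
  | var x =>
    rw [modelCount_var h, hsource (by rw [h]; trivial)]
    simp [GateLabel.symbol, gateFn, Finset.filter_eq]
  | const b =>
    rw [modelCount_const h, hsource (by rw [h]; trivial)]
    cases b <;> simp [GateLabel.symbol, gateFn]
  | and => rw [modelCount_and hC' h]; simp [GateLabel.symbol, gateFn]
  | or => rw [modelCount_or hC h]; simp [GateLabel.symbol, gateFn]
  | not => rw [modelCount_not h]; simp [GateLabel.symbol, gateFn]

/-- After k rounds all gates of rank below k are correct, whatever the initial values. Ranks are
below the number of gates, which is at most L - 1. -/
theorem isOutputValue_modelCount (hC : C.Deterministic) (hC' : C.Decomposable) (w : Fin n → ℤ) {L : ℕ}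
    (hL : C.size < L) :
    IsOutputValue L (List.ofFn C.gateDesc) (List.ofFn w) (C.modelCount w C.output) := by
  intro vals hvals
  have key : ∀ k, ∃ v : Fin C.size → ℤ,
      (stepValues (List.ofFn C.gateDesc) (List.ofFn w))^[k] vals = List.ofFn v ∧
        ∀ g, C.rank g < k → v g = C.modelCount w g := by
    intro k
    induction k with
    | zero =>
      rw [List.length_ofFn] at hvals
      exact ⟨fun g => vals[g], by
        refine List.ext_getElem (by simpa using hvals) fun i h h' => by simp, by simp⟩
    | succ k ih =>
      obtain ⟨v, hv, hv'⟩ := ih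
      refine ⟨_, by rw [Function.iterate_succ_apply', hv, stepValues, List.map_ofFn], fun g hg => ?_⟩
      exact value_gateDesc hC hC' w v g fun h hh => hv' h (by have := rank_lt_rank hh; omega)
  obtain ⟨v, hv, hv'⟩ := key (L - 1)
  have hall : ∀ g, v g = C.modelCount w g := fun g => hv' g (by have := rank_lt_size g; omega)
  rw [hv]
  have h₁ : ∀ d ∈ (List.ofFn C.gateDesc).filter GateDesc.out,
      d.value (List.ofFn w ++ List.ofFn v) = C.modelCount w C.output := by
    intro d hd
    rw [List.mem_filter, List.mem_ofFn] at hd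
    obtain ⟨⟨g, rfl⟩, hg⟩ := hd
    obtain rfl : g = C.output := by simpa [gateDesc] using hg
    exact value_gateDesc hC hC' w v _ fun h _ => hall h
  have h₂ : C.gateDesc C.output ∈ (List.ofFn C.gateDesc).filter GateDesc.out := by
    rw [List.mem_filter, List.mem_ofFn]
    exact ⟨⟨_, rfl⟩, by simp [gateDesc]⟩
  cases h : (List.ofFn C.gateDesc).filter GateDesc.out with
  | nil => simp [h] at h₂
  | cons d l => simpa using h₁ d (by simp [h])

end BoolCircuit

/-! ### Assembling the result for an encoded input -/

namespace ShapInput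

open LoopProgram.Prog

variable (i : ShapInput)

/-- The values of the features, with marks for the given feature. -/
def markedEntity : List (Bool × Bool) :=
  List.ofFn fun y : Fin i.numFeatures => (i.entity y, decide (y = i.feature))

theorem encode_eq : i.encode = encodeEntity i.markedEntity ++
    .endEntity :: (List.ofFn i.circuit.gateDesc).flatMap GateDesc.encode := by
  rw [encode, encodeEntity, markedEntity, List.flatMap_def, List.flatMap_def, List.map_ofFn,
    List.map_ofFn]
  congr 4
  funext g
  exact (BoolCircuit.encode_gateDesc g).symm

theorem length_encode : i.encode.length =
    2 * i.numFeatures + 1 + i.circuit.size * (2 + i.numFeatures + i.circuit.size) := by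
  simp [encode, BoolCircuit.encodeGate, List.length_flatten, List.map_ofFn, Function.comp_def]
  ring

/-- The first bound makes the coefficients, at most 2^(2n+1), smaller than half the base; the second
makes L rounds sufficient. -/
theorem lt_length_encode :
    2 * i.numFeatures + 4 < i.encode.length ∧ i.circuit.size < i.encode.length := by
  have h₁ : 0 < i.numFeatures := i.feature.pos
  have h₂ : 0 < i.circuit.size := i.circuit.output.pos
  rw [length_encode]
  constructor <;> nlinarith

/-- The weighted model count of the circuit in which the given feature agrees with the entity, or
disagrees with it. -/
noncomputable def agreementModelCount (c : Bool) : ℤ :=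
  i.circuit.modelCount (agreementWeight (2 ^ i.encode.length) i.entity i.feature c) i.circuit.output

open Polynomial in
theorem shapPair_agreementModelCount :
    ((shapPair i.encode.length (i.agreementModelCount true) (i.agreementModelCount false)).1 : ℚ) /
      (shapPair i.encode.length (i.agreementModelCount true) (i.agreementModelCount false)).2 =
        SHAP i.circuit.classifier i.entity i.feature := by
  have hL := i.lt_length_encode.1
  obtain ⟨h₁, h₂⟩ := (coeffBound_weightedCount i.circuit.classifier i.entity i.feature true).sub
    (coeffBound_weightedCount i.circuit.classifier i.entity i.feature false)
  rw [Fintype.card_fin] at h₁ h₂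
  rw [SHAP_eq_halfIntegral]
  refine shapPair_div (by omega) (by omega) (fun k => (h₂ k).trans_lt ?_) ?_
  · rw [← pow_succ']
    exact pow_lt_pow_right₀ (by norm_num) (by omega)
  -- The integer obtained from the circuit with weights at 2^L is the value of the polynomial count
  -- there.
  · have : ∀ c, (weightedCount (agreementWeight X i.entity i.feature c)
        fun e' => if i.circuit.classifier e' then 1 else 0).eval (2 ^ i.encode.length) =
          i.agreementModelCount c := by
      intro c
      have := i.circuit.map_modelCount (w := agreementWeight X i.entity i.feature c)
        (g := i.circuit.output) (evalRingHom (2 ^ i.encode.length : ℤ))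
      simp only [map_agreementWeight, coe_evalRingHom, eval_X] at this
      exact this
    rw [eval_sub, this, this]

theorem exists_polyTime_SHAP :
    ∃ f : ShapInput → ℤ × ℕ,
      Nonempty (Turing.TM2ComputableInPolyTime ShapInput.encode encodeFraction f) ∧
      ∀ i : ShapInput, 0 < (f i).2 ∧
        SHAP i.circuit.classifier i.entity i.feature = ((f i).1 : ℚ) / ((f i).2 : ℚ) := by
  refine ⟨fun i =>
    ((shapPair i.encode.length (i.agreementModelCount true) (i.agreementModelCount false)).1,
    (shapPair i.encode.length (i.agreementModelCount true) (i.agreementModelCount false)).2.toNat),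
    nonempty_tm2ComputableInPolyTime_shap ShapInput.markedEntity
      (fun i => List.ofFn i.circuit.gateDesc) _ _ ShapInput.encode_eq ?_ ?_ ?_, ?_⟩
  · intro i d hd
    obtain ⟨g, rfl⟩ := List.mem_ofFn.1 hd
    refine ⟨by simp [BoolCircuit.gateDesc, ShapInput.markedEntity], fun b => ?_⟩
    simp only [BoolCircuit.gateDesc]
    cases i.circuit.label g <;> simp [GateLabel.symbol]
  · intro i
    have := i.lt_length_encode.1
    omega
  · intro i
    have h : ∀ c, i.markedEntity.map (leafValue (2 ^ i.encode.length) c) =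
        List.ofFn (agreementWeight (2 ^ i.encode.length) i.entity i.feature c) := by
      intro c
      rw [ShapInput.markedEntity, List.map_ofFn]
      congr 1
      funext y
      simp [leafValue, agreementWeight]
    refine ⟨i.agreementModelCount true, i.agreementModelCount false, ?_, ?_, rfl⟩ <;> rw [h] <;>
      exact BoolCircuit.isOutputValue_modelCount i.deterministic i.decomposable _ i.lt_length_encode.2
  · intro i
    have h := i.shapPair_agreementModelCount
    have h' : 1 ≤ (shapPair i.encode.length (i.agreementModelCount true)
      (i.agreementModelCount false)).2 := one_le_weightedSum_snd _ _
    dsimp only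
    generalize shapPair i.encode.length (i.agreementModelCount true)
      (i.agreementModelCount false) = x at h h'
    obtain ⟨p, q⟩ := x
    lift q to ℕ using by dsimp only at h'; omega
    rw [← h]
    refine ⟨?_, rfl⟩
    dsimp only at h' ⊢
    omega

end ShapInput

/-- There is a polynomial-time Turing machine which, given a deterministic and decomposable Boolean
circuit, an entity and a feature, outputs the SHAP-score as a fraction `p / q` of integers. -/
theorem mainTheorem1 :
    ∃ f : ShapInput → ℤ × ℕ,
      Nonempty (Turing.TM2ComputableInPolyTime ShapInput.encode encodeFraction f) ∧
      ∀ i : ShapInput, 0 < (f i).2 ∧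
        SHAP i.circuit.classifier i.entity i.feature = ((f i).1 : ℚ) / ((f i).2 : ℚ) := by
  exact ShapInput.exists_polyTime_SHAP
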